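/- Let $n\ge 2$ and $N$ be integers, let $n<p<q<N-1$, $0<\sigma\le 1$, $\alpha=\min(\sigma,1-\tfrac np)$, and assume $\frac qp<\frac{n+\alpha}{n}$. Let $\Omega\subset\mathbb{R}^n$ be open and bounded, and let $f:\Omega\times\mathbb{R}^{N\times n}\to\mathbb{R}$ be a Carathéodory function. Write $f'=D_\zeta f$ and use the Euclidean norm and inner product on $\mathbb{R}^{N\times n}$. Assume that for some $1\le C<\infty$ and $0\le\mu\le1$, for all $x,x_1,x_2\in\Omega$ and $\zeta,\zeta_1,\zeta_2\in\mathbb{R}^{N\times n}$: (H1) $\zeta\mapsto f(x,\zeta)$ is $C^1$; (H2) $|\zeta|^p\le f(x,\zeta)\le C(|\zeta|^q+1)$; (H3) $C^{-1}(\mu^2+|\zeta_1|^2+|\zeta_2|^2)^{\frac{p-2}2}|\zeta_1-\zeta_2|^2\le\langle f'(x,\zeta_1)-f'(x,\zeta_2),\zeta_1-\zeta_2\rangle$; (H4) $|f'(x_1,\zeta)-f'(x_2,\zeta)|\le C|x_1-x_2|^\sigma(1+|\zeta|^{q-1})$; (H5) there is $K>0$ such that for every $v\in W^{1,p}_{\rm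 loc}(\Omega,\mathbb{R}^N)$, with $w^a=\frac{v-a}{|v-a|}$ and $Dw^a$ computed by the chain rule, $\int_{\{a\in\mathbb{R}^N:|a|<1/2\}}f(x,Dw^a(x))\,da\le K(f(x,Dv(x))+1)$ for a.e. $x\in\Omega$. Assume moreover that $f$ belongs to one of the following classes, where $L$ denotes a finite constant and $C^{0,\sigma}(\Omega)$ the $\sigma$-Hölder functions on $\Omega$. (A) $f(x,\zeta)=g(\zeta)$. (B) $f(x,\zeta)=a(x)g(\zeta)$ with $a\in C^{0,\sigma}(\Omega)$, $1\le a\le L$, $|\zeta|^p\le g(\zeta)\le L(|\zeta|^q+1)$. (C) $\sum_{i=1}^4(c_i^{-1}f_i-c_i)\le f\le\sum_{i=1}^4c_i(f_i+1)$ with constants $1\le c_i<\infty$, where - $f_1(x,\zeta)=\sum_{k=1}^n a_k(x)|\zeta_k|^{p_k}$, $\zeta_k$ being the $k$-th column of $\zeta$, $a_k\in C^{0,\sigma}(\Omega)$, $1\le a_k\le L$, $2\le p=p_1\le\dots\le p_n=q$; - $f_2(x,\zeta)=|\zeta|^p+a(x)|\zeta|^q$, $a\in C^{0,\sigma}(\Omega)$,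 $0\le a\le L$; - $f_3(x,\zeta)=|\zeta|^{e(x)}$, $e\in C^{0,\sigma}(\Omega)$, $p\le e(x)\le q-\varepsilon$, $\varepsilon>0$; - $f_4(x,\zeta)=|\zeta|^{e(x)}h(|\zeta|)$ (with possibly different $e,\varepsilon$), $e\in C^{0,\sigma}(\Omega)$, $p\le e(x)\le q-q_1-\varepsilon$, $\varepsilon>0$, $q_1\ge0$, $h:[0,\infty)\to[1,\infty)$ continuous, $h(r)\le L(1+r^{q_1})$, and $\zeta\mapsto|\zeta|^sh(|\zeta|)$ convex for every constant $s\in[p,q-q_1-\varepsilon]$. Let $u\in W^{1,p}_{\rm loc}(\Omega,\mathbb{S}^{N-1})$ be a constrained local minimizer, i.e. $f(\cdot,Du)\in L^1_{\rm loc}(\Omega)$ and $\int_\omega f(x,Du)\,dx\le\int_\omega f(x,Dv)\,dx$ for all open $\omega\subset\subset\Omega$ and all $v\in(u+W^{1,1}_0(\omega,\mathbb{R}^N))\cap W^{1,1}(\omega,\mathbb{S}^{N-1})$. Then $$u\in W^{1,t}_{\rm loc}(\Omega,\mathbb{S}^{N-1})\quad\text{for all }t\in\Bigl(1,\tfrac{np}{n-\alpha}\Bigr).$$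 Moreover, for each such $t$ there are exponents $\tilde\alpha,\tilde\beta>0$ depending only on $n,p,q,t,\alpha$, and for each $R_0>0$ a constant $c<\infty$ depending only on $n,N,p,q,t,\alpha,C,R_0$, such that for all $0<\rho<R\le R_0$ and all $x_0$ with $\overline{B_R(x_0)}\subset\Omega$ $$\int_{B_\rho(x_0)}|Du|^t\,dx\le\frac{c}{(R-\rho)^{\tilde\alpha}}\Bigl(1+\int_{B_R(x_0)}f(x,Du)\,dx\Bigr)^{\tilde\beta}.$$ -/

import Mathlib

open MeasureTheory Set Filter Topology
open scoped ContDiff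

noncomputable section

namespace SphereMin

/-- Euclidean space `ℝ^d`. -/
abbrev Vec (d : ℕ) : Type := EuclideanSpace ℝ (Fin d)

/-- The space `ℝ^{N × n}` of real matrices with the Euclidean (Frobenius) norm and inner product.
The entry `(i, j)` of a gradient is the `j`-th partial derivative of the `i`-th component. -/
abbrev Mat (N n : ℕ) : Type := EuclideanSpace ℝ (Fin N × Fin n)

/-- The `j`-th column of a matrix; for a gradient `ζ = Du` it is the partial derivative `D_j u`. -/
def col {N n : ℕ} (ζ : Mat N n) (j : Fin n) : Vec N := WithLp.toLp 2 fun i => ζ (i, j)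

/-- The classical gradient (Jacobian matrix) of a map `ℝ^n → ℝ^N`. -/
def jacobian {N n : ℕ} (u : Vec n → Vec N) (x : Vec n) : Mat N n :=
  WithLp.toLp 2 fun ij => fderiv ℝ u x (EuclideanSpace.single ij.2 1) ij.1

/-! ### Sobolev spaces -/

/-- `U ⊂⊂ Ω` for open sets `U`. -/
def IsOpenSubcompact {n : ℕ} (U Ω : Set (Vec n)) : Prop :=
  IsOpen U ∧ IsCompact (closure U) ∧ closure U ⊆ Ω

/-- `Du` is the weak (distributional) gradient of `u` on the open set `Ω`. -/
structure IsWeakGradient {N n : ℕ} (Ω : Set (Vec n)) (u : Vec n → Vec N)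
    (Du : Vec n → Mat N n) : Prop where
  locallyIntegrable : LocallyIntegrableOn u Ω
  locallyIntegrable_grad : LocallyIntegrableOn Du Ω
  integral_eq : ∀ φ : Vec n → ℝ, ContDiff ℝ ∞ φ → HasCompactSupport φ → tsupport φ ⊆ Ω →
    ∀ (i : Fin N) (j : Fin n),
      ∫ x in Ω, u x i * fderiv ℝ φ x (EuclideanSpace.single j 1) = -∫ x in Ω, Du x (i, j) * φ x

/-- `u ∈ W^{1,t}(Ω, ℝ^N)`, with weak gradient `Du`. -/
structure MemW1 {N n : ℕ} (Ω : Set (Vec n)) (t : ℝ) (u : Vec n → Vec N)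
    (Du : Vec n → Mat N n) : Prop where
  isWeakGradient : IsWeakGradient Ω u Du
  memLp : MemLp u (ENNReal.ofReal t) (volume.restrict Ω)
  memLp_grad : MemLp Du (ENNReal.ofReal t) (volume.restrict Ω)

/-- `u ∈ W^{1,t}(Ω, 𝕊^{N-1})`, with weak gradient `Du`. -/
def MemW1Sphere {N n : ℕ} (Ω : Set (Vec n)) (t : ℝ) (u : Vec n → Vec N)
    (Du : Vec n → Mat N n) : Prop :=
  MemW1 Ω t u Du ∧ ∀ᵐ x ∂(volume.restrict Ω), ‖u x‖ = 1

/-- `u ∈ W^{1,t}_loc(Ω, ℝ^N)`, with weak gradient `Du`. -/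
def MemW1Loc {N n : ℕ} (Ω : Set (Vec n)) (t : ℝ) (u : Vec n → Vec N)
    (Du : Vec n → Mat N n) : Prop :=
  ∀ U : Set (Vec n), IsOpenSubcompact U Ω → MemW1 U t u Du

/-- `u ∈ W^{1,t}_loc(Ω, 𝕊^{N-1})`, with weak gradient `Du`. -/
def MemW1LocSphere {N n : ℕ} (Ω : Set (Vec n)) (t : ℝ) (u : Vec n → Vec N)
    (Du : Vec n → Mat N n) : Prop :=
  ∀ U : Set (Vec n), IsOpenSubcompact U Ω → MemW1Sphere U t u Du

/-- `w ∈ W^{1,1}_0(U, ℝ^N)`, with weak gradient `Dw`: the closure of `C_c^∞(U, ℝ^N)` in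
`W^{1,1}(U, ℝ^N)`. -/
def MemW1Zero {N n : ℕ} (U : Set (Vec n)) (w : Vec n → Vec N) (Dw : Vec n → Mat N n) : Prop :=
  MemW1 U 1 w Dw ∧
  ∃ φ : ℕ → Vec n → Vec N,
    (∀ k, ContDiff ℝ ∞ (φ k) ∧ HasCompactSupport (φ k) ∧ tsupport (φ k) ⊆ U) ∧
    Tendsto (fun k => eLpNorm (fun x => φ k x - w x) 1 (volume.restrict U)) atTop (𝓝 0) ∧
    Tendsto (fun k => eLpNorm (fun x => jacobian (φ k) x - Dw x) 1 (volume.restrict U))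
      atTop (𝓝 0)

/-! ### Constrained local minimizers of `∫_Ω f(x, Du) dx` -/

/-- `u` (with weak gradient `Du`) is a constrained local minimizer of `∫_Ω f(x, Du(x)) dx` among
maps with values in the sphere. -/
structure IsConstrainedLocalMinimizer {N n : ℕ} (Ω : Set (Vec n)) (f : Vec n → Mat N n → ℝ)
    (u : Vec n → Vec N) (Du : Vec n → Mat N n) : Prop where
  memW1Loc : MemW1LocSphere Ω 1 u Du
  locallyIntegrable : LocallyIntegrableOn (fun x => f x (Du x)) Ω
  le : ∀ U : Set (Vec n), IsOpenSubcompact U Ω →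
    ∀ (v : Vec n → Vec N) (Dv : Vec n → Mat N n), MemW1Sphere U 1 v Dv →
      MemW1Zero U (fun x => v x - u x) (fun x => Dv x - Du x) →
      ∫⁻ x in U, ENNReal.ofReal (f x (Du x)) ≤ ∫⁻ x in U, ENNReal.ofReal (f x (Dv x))

/-! ### Structure conditions on the integrand -/

/-- `Z ↦ D[(v - a)/|v - a|]` at a point where `v = y` and `Dv = Z`, by the chain rule. -/
def gradProj {N n : ℕ} (a y : Vec N) (Z : Mat N n) : Mat N n :=
  WithLp.toLp 2 fun ij =>
    fderiv ℝ (fun z : Vec N => ‖z - a‖⁻¹ • (z - a)) y (col Z ij.2) ij.1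

/-- The standing hypotheses on the integrand `f : Ω × ℝ^{N × n} → ℝ`. The derivative `f'(x, ζ)`
with respect to `ζ` is `gradient (f x) ζ`. -/
structure IsAdmissible {N n : ℕ} (p q σ C μ : ℝ) (Ω : Set (Vec n))
    (f : Vec n → Mat N n → ℝ) : Prop where
  /-- measurability in `x`; with the next field, `f` is a Carathéodory function -/
  aemeasurable : ∀ ζ, AEMeasurable (fun x => f x ζ) (volume.restrict Ω)
  contDiff : ∀ x ∈ Ω, ContDiff ℝ 1 (f x)
  growth : ∀ x ∈ Ω, ∀ ζ, ‖ζ‖ ^ p ≤ f x ζ ∧ f x ζ ≤ C * (‖ζ‖ ^ q + 1)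
  monotone : ∀ x ∈ Ω, ∀ ζ₁ ζ₂,
    C⁻¹ * (μ ^ 2 + ‖ζ₁‖ ^ 2 + ‖ζ₂‖ ^ 2) ^ ((p - 2) / 2) * ‖ζ₁ - ζ₂‖ ^ 2 ≤
      inner ℝ (gradient (f x) ζ₁ - gradient (f x) ζ₂) (ζ₁ - ζ₂)
  holder : ∀ x₁ ∈ Ω, ∀ x₂ ∈ Ω, ∀ ζ,
    ‖gradient (f x₁) ζ - gradient (f x₂) ζ‖ ≤ C * ‖x₁ - x₂‖ ^ σ * (1 + ‖ζ‖ ^ (q - 1))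
  projection : ∃ K : ℝ, 0 < K ∧
    ∀ (v : Vec n → Vec N) (Dv : Vec n → Mat N n), MemW1Loc Ω p v Dv →
      ∀ᵐ x ∂(volume.restrict Ω),
        ∫⁻ a in Metric.ball (0 : Vec N) (1 / 2), ENNReal.ofReal (f x (gradProj a (v x) (Dv x))) ≤
          ENNReal.ofReal (K * (f x (Dv x) + 1))

/-! ### The three classes of functionals -/

/-- `a ∈ C^{0,σ}(Ω)`: the Hölder seminorm of `a` is finite. -/
def IsHolder {n : ℕ} (Ω : Set (Vec n)) (σ : ℝ) (a : Vec n → ℝ) : Prop :=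
  ∃ L : ℝ, ∀ x ∈ Ω, ∀ y ∈ Ω, |a x - a y| ≤ L * ‖x - y‖ ^ σ

/-- Class (A): autonomous integrands `g(ζ)`. -/
def ClassA {N n : ℕ} (Ω : Set (Vec n)) (f : Vec n → Mat N n → ℝ) : Prop :=
  ∃ g : Mat N n → ℝ, ∀ x ∈ Ω, ∀ ζ, f x ζ = g ζ

/-- Class (B): integrands `a(x) g(ζ)`. -/
def ClassB {N n : ℕ} (p q σ : ℝ) (Ω : Set (Vec n)) (f : Vec n → Mat N n → ℝ) : Prop :=
  ∃ (L : ℝ) (a : Vec n → ℝ) (g : Mat N n → ℝ),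
    IsHolder Ω σ a ∧ (∀ x ∈ Ω, 1 ≤ a x ∧ a x ≤ L) ∧
    (∀ ζ, ‖ζ‖ ^ p ≤ g ζ ∧ g ζ ≤ L * (‖ζ‖ ^ q + 1)) ∧
    ∀ x ∈ Ω, ∀ ζ, f x ζ = a x * g ζ

/-- Model density `∑_k a_k(x) |ζ_k|^{p_k}`, `ζ_k` the columns of `ζ`. -/
def IsModel1 {N n : ℕ} (p q σ : ℝ) (Ω : Set (Vec n)) (f : Vec n → Mat N n → ℝ) : Prop :=
  ∃ (L : ℝ) (a : Fin n → Vec n → ℝ) (e : Fin n → ℝ),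
    (∀ k, IsHolder Ω σ (a k) ∧ ∀ x ∈ Ω, 1 ≤ a k x ∧ a k x ≤ L) ∧
    2 ≤ p ∧ Monotone e ∧ (∀ k : Fin n, k.val = 0 → e k = p) ∧
    (∀ k : Fin n, k.val + 1 = n → e k = q) ∧
    ∀ x ∈ Ω, ∀ ζ, f x ζ = ∑ k, a k x * ‖col ζ k‖ ^ e k

/-- Model density `|ζ|^p + a(x)|ζ|^q`. -/
def IsModel2 {N n : ℕ} (p q σ : ℝ) (Ω : Set (Vec n)) (f : Vec n → Mat N n → ℝ) : Prop :=
  ∃ (L : ℝ) (a : Vec n → ℝ),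
    IsHolder Ω σ a ∧ (∀ x ∈ Ω, 0 ≤ a x ∧ a x ≤ L) ∧
    ∀ x ∈ Ω, ∀ ζ, f x ζ = ‖ζ‖ ^ p + a x * ‖ζ‖ ^ q

/-- Model density `|ζ|^{e(x)}`. -/
def IsModel3 {N n : ℕ} (p q σ : ℝ) (Ω : Set (Vec n)) (f : Vec n → Mat N n → ℝ) : Prop :=
  ∃ (ε : ℝ) (e : Vec n → ℝ),
    0 < ε ∧ 1 < p ∧ IsHolder Ω σ e ∧ (∀ x ∈ Ω, p ≤ e x ∧ e x ≤ q - ε) ∧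
    ∀ x ∈ Ω, ∀ ζ, f x ζ = ‖ζ‖ ^ e x

/-- Model density `|ζ|^{e(x)} h(|ζ|)`. -/
def IsModel4 {N n : ℕ} (p q σ : ℝ) (Ω : Set (Vec n)) (f : Vec n → Mat N n → ℝ) : Prop :=
  ∃ (L ε q₁ : ℝ) (e : Vec n → ℝ) (h : ℝ → ℝ),
    0 < ε ∧ 0 ≤ q₁ ∧ 1 < p ∧ IsHolder Ω σ e ∧ (∀ x ∈ Ω, p ≤ e x ∧ e x ≤ q - q₁ - ε) ∧
    ContinuousOn h (Ici 0) ∧ (∀ r, 0 ≤ r → 1 ≤ h r ∧ h r ≤ L * (1 + r ^ q₁)) ∧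
    (∀ s : ℝ, p ≤ s → s ≤ q - q₁ - ε →
      ConvexOn ℝ univ fun ζ : Mat N n => ‖ζ‖ ^ s * h ‖ζ‖) ∧
    ∀ x ∈ Ω, ∀ ζ, f x ζ = ‖ζ‖ ^ e x * h ‖ζ‖

/-- Class (C): integrands controlled from both sides by the model densities. -/
def ClassC {N n : ℕ} (p q σ : ℝ) (Ω : Set (Vec n)) (f : Vec n → Mat N n → ℝ) : Prop :=
  ∃ (m : Fin 4 → Vec n → Mat N n → ℝ) (c : Fin 4 → ℝ),
    IsModel1 p q σ Ω (m 0) ∧ IsModel2 p q σ Ω (m 1) ∧ IsModel3 p q σ Ω (m 2) ∧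
    IsModel4 p q σ Ω (m 3) ∧ (∀ i, 1 ≤ c i) ∧
    ∀ x ∈ Ω, ∀ ζ, ∑ i, ((c i)⁻¹ * m i x ζ - c i) ≤ f x ζ ∧
      f x ζ ≤ ∑ i, c i * (m i x ζ + 1)

end SphereMin

end

/-! The minimizer is compared with a smoothed copy of itself. Let τ be a smooth radius function that
equals ε on an inner ball and vanishes near the boundary. The competitor is the radial projection to
the sphere of `avg τ u`, whose value at x is the mean of u over the ball of radius τ(x) around x.
Its energy is bounded by means of f(·,Du) itself, so the functional is never regularized and no
Lavrentiev gap can interfere.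

Projection is cheap. Since p > n, the Poincaré inequality bounds the oscillation of u on a ball of
radius r by a multiple of r^(1-n/p), so the mean stays near the sphere. Since Du is tangential to
the sphere, the mean gradient has a small normal part. By `norm_lmul_proj_mean_sub_le` the projected
gradient differs from the mean of Du by at most (8P + |∇τ|)A, where P is the oscillation bound and A
= (mean of |Du|^s)^(1/s).

Convexity pays. In `IsAdmissible.energy_mean_le` the energy at the mean lies below the mean energy,
with a gain of the order of the mean of |Du - mean|^p. The Hölder condition on f' costs r^σ. The
errors together are of order r^α (1+A)^q. As A^s ≤ W r^(-n), the power q can be lowered to s at the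
price r^(-n(q-s)/s), which leaves r^κ (1+A^s) with κ = α - n(q-s)/s (`errorExp`). The hypothesis on
q/p says that κ > 0 for s = p.

Averaging over variable balls is almost a contraction of the integral: for fixed z the map x ↦ x +
τ(x)z is injective with Jacobian at least 1 - l, where l = O(ε) bounds |∇τ|. Minimality cancels the
main terms and leaves the gain bounded by O(ε^κ). Means of Du over balls of radius ε are
O(ε^(-n/s)); where |Du| exceeds twice this bound, |Du - mean| ≥ |Du|/2. Hence (`superlevel_decay`)
the integral of |Du|^p over {|Du| > λ} is O(ε^κ) for λ of order ε^(-n/s).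

Taking ε = ε₀ 2^(-j) and summing over the shells between successive thresholds gives integrability
of |Du|^s' whenever n(s'-p)/s < κ (`HigherIntegrability.improve`). In κ the exponent s is replaced
by min(s,q), so κ = α once s ≥ q, and the condition becomes n(s'-p) < αs. Its fixed point is
np/(n-α), and every smaller exponent is reached after finitely many steps of a fixed length. All
bounds are powers of an energy bound X that also dominates (R-ρ)⁻¹, which gives the final estimate.
-/

noncomputable section

namespace SphereMin

/-! ### Linear algebra of gradients -/

section Matrices

variable {N n : ℕ}

/-- The application of a matrix to a vector. -/
def act (Z : Mat N n) (h : Vec n) : Vec N := ∑ j, h j • col Z j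

/-- The rank-one matrix `a ⊗ g`. -/
def tens (a : Vec N) (g : Vec n) : Mat N n := WithLp.toLp 2 fun ij => a ij.1 * g ij.2

/-- The product of a transposed vector and a matrix. -/
def coact (v : Vec N) (Z : Mat N n) : Vec n := WithLp.toLp 2 fun j => inner ℝ v (col Z j)

/-- The product of a linear map and a matrix. -/
def lmul (T : Vec N →L[ℝ] Vec N) (Z : Mat N n) : Mat N n :=
  WithLp.toLp 2 fun ij => T (col Z ij.2) ij.1

@[simp] lemma col_apply (Z : Mat N n) (j : Fin n) (i : Fin N) : col Z j i = Z (i, j) := rfl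
@[simp] lemma tens_apply (a : Vec N) (g : Vec n) (i : Fin N) (j : Fin n) :
    tens a g (i, j) = a i * g j := rfl
@[simp] lemma coact_apply (v : Vec N) (Z : Mat N n) (j : Fin n) :
    coact v Z j = inner ℝ v (col Z j) := rfl
@[simp] lemma lmul_apply (T : Vec N →L[ℝ] Vec N) (Z : Mat N n) (i : Fin N) (j : Fin n) :
    lmul T Z (i, j) = T (col Z j) i := rfl

lemma col_add (Z W : Mat N n) (j : Fin n) : col (Z + W) j = col Z j + col W j := rfl
lemma col_smul (c : ℝ) (Z : Mat N n) (j : Fin n) : col (c • Z) j = c • col Z j := rfl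
lemma col_tens (a : Vec N) (g : Vec n) (j : Fin n) : col (tens a g) j = g j • a := by
  ext i; simp [mul_comm]
lemma col_lmul (T : Vec N →L[ℝ] Vec N) (Z : Mat N n) (j : Fin n) :
    col (lmul T Z) j = T (col Z j) := by
  ext i; simp

lemma norm_sq_eq_sum_col (Z : Mat N n) : ‖Z‖ ^ 2 = ∑ j, ‖col Z j‖ ^ 2 := by
  simp only [EuclideanSpace.norm_sq_eq, col_apply]
  rw [Fintype.sum_prod_type, Finset.sum_comm]

lemma norm_tens (a : Vec N) (g : Vec n) : ‖tens a g‖ = ‖a‖ * ‖g‖ := by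
  have h : ‖tens a g‖ ^ 2 = (‖a‖ * ‖g‖) ^ 2 := by
    rw [norm_sq_eq_sum_col]
    simp only [col_tens, norm_smul, mul_pow]
    rw [← Finset.sum_mul, EuclideanSpace.norm_sq_eq g, mul_comm]
  exact (pow_left_inj₀ (norm_nonneg _) (by positivity) two_ne_zero).1 h

lemma norm_lmul_le (T : Vec N →L[ℝ] Vec N) (Z : Mat N n) : ‖lmul T Z‖ ≤ ‖T‖ * ‖Z‖ := by
  refine (sq_le_sq₀ (norm_nonneg _) (by positivity)).1 ?_
  rw [mul_pow, norm_sq_eq_sum_col, norm_sq_eq_sum_col, Finset.mul_sum]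
  gcongr with j
  rw [← mul_pow, col_lmul]
  gcongr
  exact T.le_opNorm _

lemma norm_coact_le (v : Vec N) (Z : Mat N n) : ‖coact v Z‖ ≤ ‖v‖ * ‖Z‖ := by
  refine (sq_le_sq₀ (norm_nonneg _) (by positivity)).1 ?_
  rw [mul_pow, norm_sq_eq_sum_col, EuclideanSpace.norm_sq_eq, Finset.mul_sum]
  gcongr with j
  rw [← mul_pow, coact_apply]
  gcongr
  exact abs_real_inner_le_norm _ _

lemma norm_act_le (Z : Mat N n) (h : Vec n) : ‖act Z h‖ ≤ ‖Z‖ * ‖h‖ := by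
  calc ‖act Z h‖ ≤ ∑ j, |h j| * ‖col Z j‖ := by
        refine (norm_sum_le _ _).trans (le_of_eq ?_)
        simp [norm_smul]
    _ ≤ √(∑ j, |h j| ^ 2) * √(∑ j, ‖col Z j‖ ^ 2) := Real.sum_mul_le_sqrt_mul_sqrt _ _ _
    _ = ‖Z‖ * ‖h‖ := by
        rw [← norm_sq_eq_sum_col, Real.sqrt_sq (norm_nonneg _), EuclideanSpace.norm_eq h, mul_comm]
        simp

lemma inner_act_eq (v : Vec N) (Z : Mat N n) (h : Vec n) :
    inner ℝ v (act Z h) = inner ℝ (coact v Z) h := by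
  simp only [act, inner_sum, inner_smul_right, PiLp.inner_apply (coact v Z), coact_apply]
  simp

lemma coact_tens (v a : Vec N) (g : Vec n) : coact v (tens a g) = (inner ℝ v a : ℝ) • g := by
  ext j; simp [col_tens, inner_smul_right, mul_comm]

/-- `act` as a continuous bilinear map. -/
def actL : Mat N n →L[ℝ] Vec n →L[ℝ] Vec N :=
  LinearMap.mkContinuous₂ (LinearMap.mk₂ ℝ act
    (by intro Z W h; simp [act, col_add, Finset.sum_add_distrib])
    (by intro c Z h; simp [act, col_smul, Finset.smul_sum, smul_comm c])
    (by intro Z h k; simp [act, add_smul, Finset.sum_add_distrib])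
    (by intro c Z h; simp [act, mul_smul, Finset.smul_sum])) 1
    (by intro Z h; rw [one_mul]; exact norm_act_le Z h)

/-- `tens` as a continuous bilinear map. -/
def tensL : Vec N →L[ℝ] Vec n →L[ℝ] Mat N n :=
  LinearMap.mkContinuous₂ (LinearMap.mk₂ ℝ tens
    (by intro a b g; ext ij; simp [tens, add_mul])
    (by intro c a g; ext ij; simp [tens, mul_assoc])
    (by intro a g k; ext ij; simp [tens, mul_add])
    (by intro c a g; ext ij; simp [tens, mul_left_comm])) 1
    (by intro a g; simpa using (norm_tens a g).le)

/-- `coact` as a continuous bilinear map. -/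
def coactL : Vec N →L[ℝ] Mat N n →L[ℝ] Vec n :=
  LinearMap.mkContinuous₂ (LinearMap.mk₂ ℝ coact
    (by intro a b g; ext j; simp [inner_add_left])
    (by intro c a g; ext j; simp [inner_smul_left])
    (by intro a g k; ext j; simp [col_add, inner_add_right])
    (by intro c a g; ext j; simp [col_smul, inner_smul_right])) 1
    (by intro a g; simpa using norm_coact_le a g)

/-- `lmul` as a continuous bilinear map. -/
def lmulL : (Vec N →L[ℝ] Vec N) →L[ℝ] Mat N n →L[ℝ] Mat N n :=
  LinearMap.mkContinuous₂ (LinearMap.mk₂ ℝ lmul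
    (by intro a b g; ext ij; simp [lmul])
    (by intro c a g; ext ij; simp [lmul])
    (by intro a g k; ext ij; simp [lmul, col_add])
    (by intro c a g; ext ij; simp [lmul, col_smul])) 1
    (by intro a g; simpa using norm_lmul_le a g)

/-- The matrix of a linear map. -/
def toMat : (Vec n →L[ℝ] Vec N) →L[ℝ] Mat N n :=
  LinearMap.toContinuousLinearMap
    { toFun := fun A => WithLp.toLp 2 fun ij => A (EuclideanSpace.single ij.2 1) ij.1
      map_add' := by intro A B; ext ij; simp
      map_smul' := by intro c A; ext ij; simp }

@[simp] lemma coactL_apply (a : Vec N) (Z : Mat N n) : coactL a Z = coact a Z := rfl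
@[simp] lemma lmulL_apply (T : Vec N →L[ℝ] Vec N) (Z : Mat N n) : lmulL T Z = lmul T Z := rfl

lemma jacobian_eq_toMat (u : Vec n → Vec N) (x : Vec n) : jacobian u x = toMat (fderiv ℝ u x) := rfl

lemma col_toMat (A : Vec n →L[ℝ] Vec N) (j : Fin n) :
    col (toMat A) j = A (EuclideanSpace.single j 1) := rfl

lemma act_toMat (A : Vec n →L[ℝ] Vec N) (h : Vec n) : act (toMat A) h = A h := by
  conv_rhs => rw [← (EuclideanSpace.basisFun (Fin n) ℝ).sum_repr h]
  simp [act, col_toMat]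

lemma toMat_comp_left (T : Vec N →L[ℝ] Vec N) (A : Vec n →L[ℝ] Vec N) :
    toMat (T ∘L A) = lmul T (toMat A) := rfl

lemma norm_le_norm_toMat (A : Vec n →L[ℝ] Vec N) : ‖A‖ ≤ ‖toMat A‖ :=
  A.opNorm_le_bound (norm_nonneg _) fun h => by
    rw [← act_toMat A h]; exact norm_act_le _ _

/-- The derivative along `x ↦ x + η(x) z` for `∇η = g`: the matrix `Z (1 + z ⊗ g)`. -/
def shear (Z : Mat N n) (z g : Vec n) : Mat N n := Z + tens (act Z z) g

lemma norm_shear_sub_le (Z : Mat N n) (z g : Vec n) : ‖shear Z z g - Z‖ ≤ ‖Z‖ * ‖z‖ * ‖g‖ := by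
  rw [shear, add_sub_cancel_left, norm_tens]
  gcongr
  exact norm_act_le _ _

lemma norm_shear_le (Z : Mat N n) (z g : Vec n) : ‖shear Z z g‖ ≤ ‖Z‖ * (1 + ‖z‖ * ‖g‖) := by
  have := norm_add_le Z (tens (act Z z) g)
  rw [norm_tens] at this
  have h2 := norm_act_le Z z
  rw [shear]
  nlinarith [norm_nonneg g]

/-- The shear adds only multiples of `act Z z`, a combination of the columns of `Z`, so columns
tangent to the sphere stay tangent. This lets the variable radius interact well with the projection.
-/
lemma coact_shear_eq_zero {v : Vec N} {Z : Mat N n} (h : coact v Z = 0) (z g : Vec n) :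
    coact v (shear Z z g) = 0 := by
  have h1 : coact v (shear Z z g) = coact v Z + coact v (tens (act Z z) g) :=
    (coactL v).map_add _ _
  rw [h1, coact_tens, inner_act_eq, h]
  simp

/-- Matrix form of the chain rule for u(x + τ(x)z), with g = ∇τ(x). -/
lemma toMat_comp_shear (A : Vec n →L[ℝ] Vec N) (z g : Vec n) :
    toMat (A ∘L (ContinuousLinearMap.id ℝ (Vec n) +
      (innerSL ℝ g).smulRight z)) = shear (toMat A) z g := by
  ext ij
  obtain ⟨i, j⟩ := ij
  have : toMat (A ∘L (ContinuousLinearMap.id ℝ (Vec n) + (innerSL ℝ g).smulRight z)) (i, j)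
      = (A (EuclideanSpace.single j 1 + (inner ℝ g (EuclideanSpace.single j 1) : ℝ) • z)) i := rfl
  rw [this, shear, act_toMat]
  have h2 : (toMat A + tens (A z) g) (i, j) = (A (EuclideanSpace.single j 1)) i + (A z) i * g j := rfl
  rw [h2]
  simp [EuclideanSpace.inner_single_right, mul_comm]

end Matrices

/-! ### Consequences of convexity and growth -/

section Convexity

variable {H : Type*} [NormedAddCommGroup H] [InnerProductSpace ℝ H] [CompleteSpace H]

lemma hasDerivAt_comp_segment {g : H → ℝ} (hg : ContDiff ℝ 1 g) (ζ ξ : H) (s : ℝ) :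
    HasDerivAt (fun s : ℝ => g (ζ + s • ξ)) (inner ℝ (gradient g (ζ + s • ξ)) ξ) s := by
  have h1 : HasFDerivAt g (fderiv ℝ g (ζ + s • ξ)) (ζ + s • ξ) :=
    (hg.differentiable one_ne_zero _).hasFDerivAt
  have h2 : HasDerivAt (fun s : ℝ => ζ + s • ξ) ξ s := by
    simpa using ((hasDerivAt_id s).smul_const ξ).const_add ζ
  have := h1.comp_hasDerivAt s h2
  rw [gradient, InnerProductSpace.toDual_symm_apply]
  exact this

/-- The tangent inequality for an integrand with degenerate `p`-monotone gradient. -/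
lemma tangent_inequality {g : H → ℝ} (hg : ContDiff ℝ 1 g) {p C μ : ℝ} (hp : 2 ≤ p) (hC : 1 ≤ C)
    (hmono : ∀ ζ₁ ζ₂, C⁻¹ * (μ ^ 2 + ‖ζ₁‖ ^ 2 + ‖ζ₂‖ ^ 2) ^ ((p - 2) / 2) * ‖ζ₁ - ζ₂‖ ^ 2 ≤
      inner ℝ (gradient g ζ₁ - gradient g ζ₂) (ζ₁ - ζ₂)) (ζ₁ ζ₂ : H) :
    g ζ₂ + inner ℝ (gradient g ζ₂) (ζ₁ - ζ₂) +
      C⁻¹ * (1 / 2) ^ ((p - 2) / 2) / p * ‖ζ₁ - ζ₂‖ ^ p ≤ g ζ₁ := by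
  have hC0 : 0 < C := by linarith
  have hp0 : 0 < p := by linarith
  set k : ℝ := C⁻¹ * (1 / 2) ^ ((p - 2) / 2) with hk
  have hk0 : 0 ≤ k := by positivity
  have hmono' : ∀ ζ₁ ζ₂ : H, k * ‖ζ₁ - ζ₂‖ ^ p ≤
      inner ℝ (gradient g ζ₁ - gradient g ζ₂) (ζ₁ - ζ₂) := by
    intro a b
    refine le_trans ?_ (hmono a b)
    have h1 : (1 / 2) * ‖a - b‖ ^ 2 ≤ μ ^ 2 + ‖a‖ ^ 2 + ‖b‖ ^ 2 := by
      have := norm_sub_le a b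
      nlinarith [sq_nonneg μ, sq_nonneg (‖a‖ - ‖b‖), norm_nonneg (a - b)]
    have h2 : ‖a - b‖ ^ p = (‖a - b‖ ^ 2) ^ ((p - 2) / 2) * ‖a - b‖ ^ 2 := by
      rcases eq_or_ne (‖a - b‖) 0 with h0 | h0
      · rw [h0]; simp [hp0.ne']
      · have h0' : 0 < ‖a - b‖ := lt_of_le_of_ne (norm_nonneg _) (Ne.symm h0)
        rw [← Real.rpow_natCast ‖a - b‖ 2, ← Real.rpow_mul h0'.le, ← Real.rpow_add h0']
        congr 1; push_cast; ring
    rw [h2, hk, ← mul_assoc]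
    refine mul_le_mul_of_nonneg_right ?_ (by positivity)
    rw [mul_assoc, ← Real.mul_rpow (by norm_num) (by positivity)]
    gcongr
  set Δ := ζ₁ - ζ₂
  -- The strong tangent inequality is φ(0) ≤ φ(1). The last term is chosen so that its derivative
  -- k|Δ|^p s^(p-1) is what monotonicity supplies at the points ζ₂ + sΔ and ζ₂, after division by s.
  let φ : ℝ → ℝ := fun s => g (ζ₂ + s • Δ) - s * inner ℝ (gradient g ζ₂) Δ - k / p * ‖Δ‖ ^ p * s ^ p
  have hφ : ∀ s : ℝ, HasDerivAt φ (inner ℝ (gradient g (ζ₂ + s • Δ)) Δ -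
      1 * inner ℝ (gradient g ζ₂) Δ - k / p * ‖Δ‖ ^ p * (p * s ^ (p - 1))) s := by
    intro s
    exact ((hasDerivAt_comp_segment hg ζ₂ Δ s).sub ((hasDerivAt_id s).mul_const _)).sub
      ((Real.hasDerivAt_rpow_const (Or.inr (by linarith))).const_mul _)
  have hm : MonotoneOn φ (Icc 0 1) := by
    refine monotoneOn_of_deriv_nonneg (convex_Icc 0 1)
      (fun s _ => (hφ s).continuousAt.continuousWithinAt)
      (fun s _ => (hφ s).differentiableAt.differentiableWithinAt) ?_
    intro s hs
    rw [interior_Icc] at hs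
    rw [(hφ s).deriv]
    have h3 := hmono' (ζ₂ + s • Δ) ζ₂
    rw [add_sub_cancel_left, norm_smul, inner_smul_right, inner_sub_left, Real.norm_of_nonneg hs.1.le,
      Real.mul_rpow hs.1.le (norm_nonneg _)] at h3
    have h4 : s ^ p = s * s ^ (p - 1) := by
      rw [← Real.rpow_one_add' hs.1.le (by linarith)]; congr 1; ring
    rw [h4] at h3
    have h5 : k / p * ‖Δ‖ ^ p * (p * s ^ (p - 1)) = k * ‖Δ‖ ^ p * s ^ (p - 1) := by
      field_simp
    rw [h5]
    have h6 : s * (k * ‖Δ‖ ^ p * s ^ (p - 1)) ≤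
        s * (inner ℝ (gradient g (ζ₂ + s • Δ)) Δ - inner ℝ (gradient g ζ₂) Δ) := by
      calc _ = k * (s * s ^ (p - 1) * ‖Δ‖ ^ p) := by ring
        _ ≤ _ := h3
    have := le_of_mul_le_mul_left h6 hs.1
    linarith
  have h01 := hm (left_mem_Icc.2 zero_le_one) (right_mem_Icc.2 zero_le_one) zero_le_one
  have e0 : φ 0 = g ζ₂ := by simp [φ, hp0.ne']
  have e1 : φ 1 = g ζ₁ - inner ℝ (gradient g ζ₂) Δ - k / p * ‖Δ‖ ^ p := by
    simp [φ, Δ]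
  rw [e0, e1] at h01
  linarith

/-- Integration of the gradient difference along the segment from 0 to ζ. The Hölder condition
compares only derivatives, so it says nothing about f(x,0) itself; for this reason energies are
normalized by their value at 0 from here on. -/
lemma norm_gradient_sub_le_increment {g₁ g₂ : H → ℝ} (h₁ : ContDiff ℝ 1 g₁) (h₂ : ContDiff ℝ 1 g₂)
    {K q : ℝ} (hK : 0 ≤ K) (hq : 1 ≤ q)
    (h : ∀ ζ, ‖gradient g₁ ζ - gradient g₂ ζ‖ ≤ K * (1 + ‖ζ‖ ^ (q - 1))) (ζ : H) :
    |(g₁ ζ - g₁ 0) - (g₂ ζ - g₂ 0)| ≤ K * (1 + ‖ζ‖ ^ (q - 1)) * ‖ζ‖ := by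
  have hd : ∀ s ∈ Icc (0:ℝ) 1, HasDerivWithinAt (fun s : ℝ => g₁ (0 + s • ζ) - g₂ (0 + s • ζ))
      (inner ℝ (gradient g₁ (0 + s • ζ)) ζ - inner ℝ (gradient g₂ (0 + s • ζ)) ζ) (Icc 0 1) s :=
    fun s _ => ((hasDerivAt_comp_segment h₁ 0 ζ s).sub
      (hasDerivAt_comp_segment h₂ 0 ζ s)).hasDerivWithinAt
  have hb : ∀ s ∈ Ico (0:ℝ) 1, ‖(inner ℝ (gradient g₁ (0 + s • ζ)) ζ -
      inner ℝ (gradient g₂ (0 + s • ζ)) ζ : ℝ)‖ ≤ K * (1 + ‖ζ‖ ^ (q - 1)) * ‖ζ‖ := by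
    intro s hs
    rw [← inner_sub_left]
    refine (norm_inner_le_norm _ _).trans ?_
    gcongr
    refine (h _).trans ?_
    gcongr
    rw [zero_add, norm_smul, Real.norm_of_nonneg hs.1]
    exact mul_le_of_le_one_left (norm_nonneg _) hs.2.le
  have := norm_image_sub_le_of_norm_deriv_le_segment_01' hd hb
  simp only [one_smul, zero_smul, zero_add, Real.norm_eq_abs] at this
  convert! this using 2
  ring

/-- A convex function of q-growth has gradient of (q-1)-growth: test the tangent inequality at
distance 1 + |ζ| in the direction of the gradient, where the function is still O((1+|ζ|)^q). -/
lemma norm_gradient_le {g : H → ℝ} {q C : ℝ} (hC : 1 ≤ C) (hq : 1 ≤ q)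
    (htan : ∀ ζ₁ ζ₂, g ζ₂ + inner ℝ (gradient g ζ₂) (ζ₁ - ζ₂) ≤ g ζ₁)
    (h0 : ∀ ζ, 0 ≤ g ζ) (hgr : ∀ ζ, g ζ ≤ C * (‖ζ‖ ^ q + 1)) (ζ : H) :
    ‖gradient g ζ‖ ≤ C * 2 ^ (q + 1) * (1 + ‖ζ‖) ^ (q - 1) := by
  rcases eq_or_ne (gradient g ζ) 0 with hz | hz
  · rw [hz, norm_zero]; positivity
  have hz' : 0 < ‖gradient g ζ‖ := norm_pos_iff.2 hz
  have h1 := htan (ζ + ((1 + ‖ζ‖) / ‖gradient g ζ‖) • gradient g ζ) ζ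
  rw [add_sub_cancel_left, inner_smul_right, real_inner_self_eq_norm_sq] at h1
  have h2 : (1 + ‖ζ‖) / ‖gradient g ζ‖ * ‖gradient g ζ‖ ^ 2 = (1 + ‖ζ‖) * ‖gradient g ζ‖ := by
    field_simp
  have h3 : ‖ζ + ((1 + ‖ζ‖) / ‖gradient g ζ‖) • gradient g ζ‖ ≤ 2 * (1 + ‖ζ‖) := by
    refine (norm_add_le _ _).trans ?_
    rw [norm_smul, norm_div, norm_norm, Real.norm_of_nonneg (by positivity : 0 ≤ 1 + ‖ζ‖),
      div_mul_cancel₀ _ hz'.ne']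
    linarith [norm_nonneg ζ]
  have h4 := hgr (ζ + ((1 + ‖ζ‖) / ‖gradient g ζ‖) • gradient g ζ)
  have h5 : ‖ζ + ((1 + ‖ζ‖) / ‖gradient g ζ‖) • gradient g ζ‖ ^ q ≤ (2 * (1 + ‖ζ‖)) ^ q := by
    gcongr
  have h6 : (1:ℝ) ≤ (2 * (1 + ‖ζ‖)) ^ q :=
    Real.one_le_rpow (by linarith [norm_nonneg ζ]) (by linarith)
  have h7 : (2 * (1 + ‖ζ‖)) ^ q = 2 ^ q * ((1 + ‖ζ‖) * (1 + ‖ζ‖) ^ (q - 1)) := by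
    rw [Real.mul_rpow (by norm_num) (by positivity),
      ← Real.rpow_one_add' (by positivity) (by linarith)]
    congr 2; ring
  have h8 : (2:ℝ) ^ (q + 1) = 2 * 2 ^ q := by
    rw [Real.rpow_add (by norm_num), Real.rpow_one, mul_comm]
  have h9 : (1 + ‖ζ‖) * ‖gradient g ζ‖ ≤
      (1 + ‖ζ‖) * (C * 2 ^ (q + 1) * (1 + ‖ζ‖) ^ (q - 1)) := by
    calc (1 + ‖ζ‖) * ‖gradient g ζ‖ ≤ C * ((2 * (1 + ‖ζ‖)) ^ q + 1) := by
          have := h0 ζ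
          have : C * (‖ζ + ((1 + ‖ζ‖) / ‖gradient g ζ‖) • gradient g ζ‖ ^ q + 1) ≤
            C * ((2 * (1 + ‖ζ‖)) ^ q + 1) := by gcongr
          linarith
      _ ≤ C * (2 * (2 * (1 + ‖ζ‖)) ^ q) := by gcongr; linarith
      _ = _ := by rw [h7, h8]; ring
  exact le_of_mul_le_mul_left h9 (by positivity)

end Convexity

/-! ### Mollification in `L¹` -/

section Mollification

open ContinuousLinearMap

variable {n : ℕ} {G : Type*} [NormedAddCommGroup G] [NormedSpace ℝ G]

/-- Mollification by a normalized bump function. -/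
def mollify (φ : ContDiffBump (0 : Vec n)) (g : Vec n → G) (x : Vec n) : G :=
  ∫ t, φ.normed volume t • g (x - t)

lemma mollify_eq_convolution (φ : ContDiffBump (0 : Vec n)) (g : Vec n → G) :
    mollify φ g = (convolution (φ.normed volume) g (lsmul ℝ ℝ) volume) := rfl

lemma integrable_mollify_integrand (φ : ContDiffBump (0 : Vec n)) {g : Vec n → G}
    (hg : LocallyIntegrable g) (x : Vec n) :
    Integrable fun t => φ.normed volume t • g (x - t) :=
  φ.hasCompactSupport_normed.convolutionExists_left (lsmul ℝ ℝ) φ.continuous_normed hg x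

lemma mollify_sub (φ : ContDiffBump (0 : Vec n)) {g h : Vec n → G}
    (hg : LocallyIntegrable g) (hh : LocallyIntegrable h) (x : Vec n) :
    mollify φ (fun y => g y - h y) x = mollify φ g x - mollify φ h x := by
  simp only [mollify, smul_sub]
  exact integral_sub (integrable_mollify_integrand φ hg x) (integrable_mollify_integrand φ hh x)

/-- Tonelli and translation invariance, the kernel having mass one. This uniform bound carries
convergence from continuous compactly supported functions to all integrable ones. -/
lemma lintegral_enorm_mollify_le (φ : ContDiffBump (0 : Vec n)) {g : Vec n → G}
    (hg : AEStronglyMeasurable g) : ∫⁻ x, ‖mollify φ g x‖ₑ ≤ ∫⁻ x, ‖g x‖ₑ := by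
  have hm : AEMeasurable (fun p : Vec n × Vec n => ‖φ.normed volume p.2‖ₑ * ‖g (p.1 - p.2)‖ₑ)
      (volume.prod volume) :=
    (φ.continuous_normed.measurable.comp measurable_snd).enorm.aemeasurable.mul
      (hg.comp_quasiMeasurePreserving
        (quasiMeasurePreserving_sub_of_right_invariant volume volume)).enorm
  calc ∫⁻ x, ‖mollify φ g x‖ₑ ≤ ∫⁻ x, ∫⁻ t, ‖φ.normed volume t‖ₑ * ‖g (x - t)‖ₑ := by
        refine lintegral_mono fun x => (enorm_integral_le_lintegral_enorm _).trans_eq ?_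
        simp [enorm_smul]
    _ = ∫⁻ t, ∫⁻ x, ‖φ.normed volume t‖ₑ * ‖g (x - t)‖ₑ := lintegral_lintegral_swap hm
    _ = ∫⁻ t, ‖φ.normed volume t‖ₑ * ∫⁻ x, ‖g x‖ₑ := by
        refine lintegral_congr fun t => ?_
        rw [lintegral_const_mul' _ _ enorm_ne_top, lintegral_sub_right_eq_self (fun x => ‖g x‖ₑ) t]
    _ = ∫⁻ x, ‖g x‖ₑ := by
        rw [lintegral_mul_const _ φ.continuous_normed.measurable.enorm,
          ← ofReal_integral_norm_eq_lintegral_enorm φ.integrable_normed]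
        simp [abs_of_nonneg (φ.nonneg_normed _), φ.integral_normed]

lemma tendsto_mollify_of_continuous [CompleteSpace G] {φ : ℕ → ContDiffBump (0 : Vec n)}
    (hφ : Tendsto (fun k => (φ k).rOut) atTop (𝓝 0)) {h : Vec n → G} (hc : Continuous h)
    (hs : HasCompactSupport h) :
    Tendsto (fun k => ∫⁻ x, ‖mollify (φ k) h x - h x‖ₑ) atTop (𝓝 0) := by
  obtain ⟨M, hM⟩ := hs.exists_bound_of_continuous hc
  have hM0 : 0 ≤ M := (norm_nonneg _).trans (hM 0)
  have hS : IsCompact (Metric.cthickening 1 (tsupport h)) := IsCompact.cthickening hs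
  have hcont : ∀ k, Continuous (mollify (φ k) h) := fun k =>
    ((φ k).hasCompactSupport_normed.contDiff_convolution_left (lsmul ℝ ℝ)
      (φ k).contDiff_normed (n := 0) hc.locallyIntegrable).continuous
  have h0 : (0 : ENNReal) = ∫⁻ _ : Vec n, 0 := by simp
  rw [h0]
  refine tendsto_lintegral_filter_of_dominated_convergence
    ((Metric.cthickening 1 (tsupport h)).indicator fun _ => ENNReal.ofReal (2 * M)) ?_ ?_ ?_ ?_
  · exact Eventually.of_forall fun k => ((hcont k).sub hc).enorm.measurable
  · filter_upwards [hφ.eventually_lt_const zero_lt_one] with k hk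
    refine Eventually.of_forall fun x => ?_
    by_cases hx : x ∈ Metric.cthickening 1 (tsupport h)
    · rw [indicator_of_mem hx, ← ofReal_norm, ← dist_eq_norm]
      refine ENNReal.ofReal_le_ofReal ((φ k).dist_normed_convolution_le
        hc.aestronglyMeasurable fun y _ => ?_)
      rw [dist_eq_norm]
      exact (norm_sub_le _ _).trans (by linarith [hM x, hM y])
    · have hz : ∀ y ∈ Metric.ball x (φ k).rOut, h y = 0 := by
        intro y hy
        by_contra hne
        refine hx (Metric.mem_cthickening_of_dist_le x y 1 _
          (subset_tsupport h hne) ?_)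
        rw [dist_comm]
        exact (Metric.mem_ball.1 hy).le.trans hk.le
      have hx0 := hz x (Metric.mem_ball_self (φ k).rOut_pos)
      have := (φ k).normed_convolution_eq_right (μ := volume) (x₀ := x) (g := h)
        (fun y hy => by rw [hz y hy, hx0])
      rw [mollify_eq_convolution, this]
      simp
  · rw [lintegral_indicator hS.isClosed.measurableSet, setLIntegral_const]
    exact ENNReal.mul_ne_top ENNReal.ofReal_ne_top hS.measure_lt_top.ne
  · refine Eventually.of_forall fun x => ?_
    have := ContDiffBump.convolution_tendsto_right_of_continuous (μ := volume) hφ hc x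
    have h2 := (this.sub_const (h x)).enorm
    simp only [sub_self, enorm_zero] at h2
    exact h2

lemma tendsto_mollify [CompleteSpace G] {φ : ℕ → ContDiffBump (0 : Vec n)}
    (hφ : Tendsto (fun k => (φ k).rOut) atTop (𝓝 0)) {g : Vec n → G} (hg : Integrable g) :
    Tendsto (fun k => ∫⁻ x, ‖mollify (φ k) g x - g x‖ₑ) atTop (𝓝 0) := by
  rw [ENNReal.tendsto_nhds_zero]
  intro ε hε
  obtain ⟨h, hs, hle, hc, hi⟩ := hg.exists_hasCompactSupport_lintegral_sub_le
    (ENNReal.div_ne_zero.2 ⟨hε.ne', (by norm_num : (3 : ENNReal) ≠ ⊤)⟩)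
  have hm : AEStronglyMeasurable (fun x => g x - h x) := hg.1.sub hi.1
  filter_upwards [ENNReal.tendsto_nhds_zero.1 (tendsto_mollify_of_continuous hφ hc hs) (ε / 3)
    (ENNReal.div_pos hε.ne' (by norm_num))] with k hk
  have hmes : ∀ g : Vec n → G, LocallyIntegrable g → Measurable fun x => ‖mollify (φ k) g x‖ₑ :=
    fun g hg => ((φ k).hasCompactSupport_normed.contDiff_convolution_left (lsmul ℝ ℝ)
      (φ k).contDiff_normed (n := 0) hg).continuous.enorm.measurable
  have hmes2 : AEMeasurable fun x => ‖mollify (φ k) h x - h x‖ₑ :=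
    (((φ k).hasCompactSupport_normed.contDiff_convolution_left (lsmul ℝ ℝ)
      (φ k).contDiff_normed (n := 0) hc.locallyIntegrable).continuous.sub hc).enorm.measurable.aemeasurable
  calc ∫⁻ x, ‖mollify (φ k) g x - g x‖ₑ
      ≤ ∫⁻ x, (‖mollify (φ k) (fun y => g y - h y) x‖ₑ + ‖mollify (φ k) h x - h x‖ₑ +
          ‖g x - h x‖ₑ) := by
        refine lintegral_mono fun x => ?_
        have : mollify (φ k) g x - g x = mollify (φ k) (fun y => g y - h y) x +
            (mollify (φ k) h x - h x) - (g x - h x) := by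
          rw [mollify_sub _ hg.locallyIntegrable hi.locallyIntegrable]; abel
        dsimp only
        rw [this]
        exact enorm_sub_le.trans (by gcongr; exact enorm_add_le _ _)
    _ = (∫⁻ x, ‖mollify (φ k) (fun y => g y - h y) x‖ₑ) + (∫⁻ x, ‖mollify (φ k) h x - h x‖ₑ) +
          ∫⁻ x, ‖g x - h x‖ₑ := by
        rw [lintegral_add_right' _ hm.enorm, lintegral_add_right' _ hmes2]
    _ ≤ ε / 3 + ε / 3 + ε / 3 := by
        gcongr
        exact (lintegral_enorm_mollify_le _ hm).trans hle
    _ = ε := ENNReal.add_thirds ε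

/-- Jensen's inequality, read off from the nonnegative variance of |g| under the kernel. It gives
the mollified gradients a majorant that converges to |Du|² in L¹, which is all that the Poincaré
inequality needs. -/
lemma norm_mollify_sq_le (φ : ContDiffBump (0 : Vec n)) {g : Vec n → G}
    (hg : LocallyIntegrable g) (hg2 : LocallyIntegrable fun x => ‖g x‖ ^ 2) (x : Vec n) :
    ‖mollify φ g x‖ ^ 2 ≤ mollify φ (fun y => ‖g y‖ ^ 2) x := by
  have i1 := integrable_mollify_integrand φ (fun y => (hg y).norm) x
  have i2 := integrable_mollify_integrand φ hg2 x
  set m := ∫ t, φ.normed volume t • ‖g (x - t)‖ with hm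
  have hle : ‖mollify φ g x‖ ≤ m := by
    refine (norm_integral_le_integral_norm _).trans_eq ?_
    simp [norm_smul, abs_of_nonneg (φ.nonneg_normed _), hm]
  have h0 : 0 ≤ ∫ t, φ.normed volume t * (‖g (x - t)‖ - m) ^ 2 :=
    integral_nonneg fun t => mul_nonneg (φ.nonneg_normed t) (sq_nonneg _)
  have h1 : ∫ t, φ.normed volume t * (‖g (x - t)‖ - m) ^ 2 =
      mollify φ (fun y => ‖g y‖ ^ 2) x - m ^ 2 := by
    have : (fun t => φ.normed volume t * (‖g (x - t)‖ - m) ^ 2) = fun t =>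
        φ.normed volume t • ‖g (x - t)‖ ^ 2 - (2 * m) * (φ.normed volume t • ‖g (x - t)‖) +
          m ^ 2 * φ.normed volume t := by
      ext t; simp only [smul_eq_mul]; ring
    have i3 : Integrable fun t => φ.normed volume t • ‖g (x - t)‖ ^ 2 -
        (2 * m) * (φ.normed volume t • ‖g (x - t)‖) := i2.sub (i1.const_mul _)
    rw [this, integral_add i3 (φ.integrable_normed.const_mul _),
      integral_sub i2 (i1.const_mul _), integral_const_mul, integral_const_mul, φ.integral_normed,
      ← hm, mollify]
    ring
  rw [h1] at h0
  calc ‖mollify φ g x‖ ^ 2 ≤ m ^ 2 := by gcongr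
    _ ≤ _ := by linarith

end Mollification

/-! ### Weak gradients and smooth approximation -/

section Weak

variable {N n : ℕ}

lemma continuous_jacobian {u : Vec n → Vec N} (hu : ContDiff ℝ 1 u) : Continuous (jacobian u) :=
  toMat.continuous.comp (hu.continuous_fderiv one_ne_zero)

lemma jacobian_apply (u : Vec n → Vec N) (x : Vec n) (i : Fin N) (j : Fin n) :
    jacobian u x (i, j) = fderiv ℝ u x (EuclideanSpace.single j 1) i := rfl

lemma IntegrableOn.apply_vec {d : Type*} [Fintype d] {U : Set (Vec n)}
    {D : Vec n → EuclideanSpace ℝ d} (hD : IntegrableOn D U) (i : d) :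
    IntegrableOn (fun x => D x i) U :=
  (EuclideanSpace.proj (𝕜 := ℝ) i).integrable_comp hD

lemma integrable_mul_test {U : Set (Vec n)} {g φ : Vec n → ℝ} (hg : IntegrableOn g U)
    (hφ : Continuous φ) (hc : HasCompactSupport φ) : IntegrableOn (fun x => g x * φ x) U := by
  obtain ⟨M, hM⟩ := hc.exists_bound_of_continuous hφ
  exact hg.mul_bdd hφ.aestronglyMeasurable (Eventually.of_forall hM)

lemma continuous_fderiv_apply {φ : Vec n → ℝ} (hφ : ContDiff ℝ ∞ φ) (h : Vec n) :
    Continuous fun x => fderiv ℝ φ x h :=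
  (hφ.continuous_fderiv (by simp)).clm_apply continuous_const

lemma hasCompactSupport_fderiv_apply {φ : Vec n → ℝ} (hc : HasCompactSupport φ) (h : Vec n) :
    HasCompactSupport fun x => fderiv ℝ φ x h :=
  (hc.fderiv ℝ).comp_left (g := fun A : Vec n →L[ℝ] ℝ => A h) rfl

/-- Weak gradients are unique. -/
lemma IsWeakGradient.ae_eq {U : Set (Vec n)} (hU : IsOpen U) {u : Vec n → Vec N}
    {D₁ D₂ : Vec n → Mat N n} (h₁ : IsWeakGradient U u D₁) (h₂ : IsWeakGradient U u D₂)
    (i₁ : IntegrableOn D₁ U) (i₂ : IntegrableOn D₂ U) :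
    ∀ᵐ x ∂(volume.restrict U), D₁ x = D₂ x := by
  have key : ∀ ij : Fin N × Fin n, ∀ᵐ x, x ∈ U → D₁ x ij - D₂ x ij = 0 := by
    rintro ⟨i, j⟩
    have hi : IntegrableOn (fun x => D₁ x (i, j) - D₂ x (i, j)) U :=
      (IntegrableOn.apply_vec i₁ _).sub (IntegrableOn.apply_vec i₂ _)
    refine hU.ae_eq_zero_of_integral_contDiff_smul_eq_zero hi.locallyIntegrableOn ?_
    intro φ hφ hc hs
    have e := (h₁.integral_eq φ hφ hc hs i j).symm.trans (h₂.integral_eq φ hφ hc hs i j)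
    rw [← setIntegral_eq_integral_of_forall_compl_eq_zero (s := U)
      (fun x hx => by rw [image_eq_zero_of_notMem_tsupport (fun h => hx (hs h)), zero_smul])]
    calc ∫ x in U, φ x • (D₁ x (i, j) - D₂ x (i, j))
        = ∫ x in U, (D₁ x (i, j) * φ x - D₂ x (i, j) * φ x) := by
          congr 1; ext x; simp only [smul_eq_mul]; ring
      _ = 0 := by
          rw [integral_sub (integrable_mul_test (IntegrableOn.apply_vec i₁ _) hφ.continuous hc)
            (integrable_mul_test (IntegrableOn.apply_vec i₂ _) hφ.continuous hc)]
          linarith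
  have key' := ae_all_iff.2 key
  rw [ae_restrict_iff' hU.measurableSet]
  filter_upwards [key'] with x hx hxU
  ext ij
  exact sub_eq_zero.1 (hx ij hxU)

lemma tendsto_setIntegral_mul {U : Set (Vec n)} {g : ℕ → Vec n → ℝ} {g₀ φ : Vec n → ℝ}
    (hg : ∀ k, IntegrableOn (g k) U) (h0 : IntegrableOn g₀ U)
    (hL : Tendsto (fun k => ∫⁻ x in U, ‖g k x - g₀ x‖ₑ) atTop (𝓝 0))
    (hφ : Continuous φ) (hc : HasCompactSupport φ) :
    Tendsto (fun k => ∫ x in U, g k x * φ x) atTop (𝓝 (∫ x in U, g₀ x * φ x)) := by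
  obtain ⟨M, hM⟩ := hc.exists_bound_of_continuous hφ
  refine tendsto_integral_of_L1 _ (integrable_mul_test h0 hφ hc).1
    (Eventually.of_forall fun k => integrable_mul_test (hg k) hφ hc) ?_
  have h2 : Tendsto (fun k => (∫⁻ x in U, ‖g k x - g₀ x‖ₑ) * ENNReal.ofReal M) atTop (𝓝 0) := by
    simpa using ENNReal.Tendsto.mul_const hL (Or.inr ENNReal.ofReal_ne_top)
  refine tendsto_of_tendsto_of_tendsto_of_le_of_le tendsto_const_nhds h2 (fun _ => zero_le) ?_
  intro k
  dsimp only
  rw [← lintegral_mul_const' _ _ ENNReal.ofReal_ne_top]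
  refine lintegral_mono fun x => ?_
  rw [← sub_mul, enorm_mul]
  gcongr
  rw [← ofReal_norm]
  exact ENNReal.ofReal_le_ofReal (hM x)

lemma tendsto_lintegral_apply {d : Type*} [Fintype d] {U : Set (Vec n)}
    {g : ℕ → Vec n → EuclideanSpace ℝ d} {g₀ : Vec n → EuclideanSpace ℝ d}
    (hL : Tendsto (fun k => ∫⁻ x in U, ‖g k x - g₀ x‖ₑ) atTop (𝓝 0)) (i : d) :
    Tendsto (fun k => ∫⁻ x in U, ‖g k x i - g₀ x i‖ₑ) atTop (𝓝 0) := by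
  refine tendsto_of_tendsto_of_tendsto_of_le_of_le tendsto_const_nhds hL (fun _ => zero_le) ?_
  intro k
  refine lintegral_mono fun x => ?_
  rw [← ofReal_norm, ← ofReal_norm]
  exact ENNReal.ofReal_le_ofReal (PiLp.norm_apply_le (g k x - g₀ x) i)

/-- An `L¹`-limit of smooth maps whose gradients converge in `L¹` is weakly differentiable. -/
lemma isWeakGradient_of_tendsto {U : Set (Vec n)} {v : ℕ → Vec n → Vec N} (hv : ∀ k, ContDiff ℝ 1 (v k))
    (hvi : ∀ k, IntegrableOn (v k) U) (hDi : ∀ k, IntegrableOn (jacobian (v k)) U)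
    {w : Vec n → Vec N} {Dw : Vec n → Mat N n} (hw : IntegrableOn w U) (hDw : IntegrableOn Dw U)
    (h₁ : Tendsto (fun k => ∫⁻ x in U, ‖v k x - w x‖ₑ) atTop (𝓝 0))
    (h₂ : Tendsto (fun k => ∫⁻ x in U, ‖jacobian (v k) x - Dw x‖ₑ) atTop (𝓝 0)) :
    IsWeakGradient U w Dw := by
  refine ⟨hw.locallyIntegrableOn, hDw.locallyIntegrableOn, ?_⟩
  intro φ hφ hc hs i j
  have hφ' := continuous_fderiv_apply hφ (EuclideanSpace.single j 1)
  have hc' := hasCompactSupport_fderiv_apply hc (EuclideanSpace.single j 1)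
  have t₁ := tendsto_setIntegral_mul (fun k => IntegrableOn.apply_vec (hvi k) i)
    (IntegrableOn.apply_vec hw i) (tendsto_lintegral_apply h₁ i) hφ' hc'
  have t₂ := (tendsto_setIntegral_mul (fun k => IntegrableOn.apply_vec (hDi k) (i, j))
    (IntegrableOn.apply_vec hDw (i, j)) (tendsto_lintegral_apply h₂ (i, j)) hφ.continuous hc).neg
  refine tendsto_nhds_unique (t₁.congr fun k => ?_) t₂
  have hz : ∀ x, x ∉ U → φ x = 0 := fun x hx =>
    image_eq_zero_of_notMem_tsupport (fun h => hx (hs h))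
  have hz' : ∀ x, x ∉ U → fderiv ℝ φ x (EuclideanSpace.single j 1) = 0 := fun x hx =>
    by rw [image_eq_zero_of_notMem_tsupport (f := fderiv ℝ φ)
      (fun h => hx (hs (tsupport_fderiv_subset ℝ h)))]; rfl
  rw [setIntegral_eq_integral_of_forall_compl_eq_zero (fun x hx => by rw [hz' x hx, mul_zero]),
    setIntegral_eq_integral_of_forall_compl_eq_zero (fun x hx => by rw [hz x hx, mul_zero])]
  have hd : ∀ x, HasFDerivAt (fun x => v k x i)
      ((EuclideanSpace.proj (𝕜 := ℝ) i) ∘L fderiv ℝ (v k) x) x := fun x =>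
    (EuclideanSpace.proj (𝕜 := ℝ) i).hasFDerivAt.comp x
      ((hv k).differentiable one_ne_zero x).hasFDerivAt
  have hf : ∀ x, fderiv ℝ (fun x => v k x i) x (EuclideanSpace.single j 1) =
      jacobian (v k) x (i, j) := fun x => by rw [(hd x).fderiv]; rfl
  have hcv : Continuous fun x => v k x i := (EuclideanSpace.proj (𝕜 := ℝ) i).continuous.comp (hv k).continuous
  have hcj : Continuous fun x => jacobian (v k) x (i, j) :=
    (EuclideanSpace.proj (𝕜 := ℝ) (i, j)).continuous.comp (continuous_jacobian (hv k))
  have := integral_mul_fderiv_eq_neg_fderiv_mul_of_integrable (μ := (volume : Measure (Vec n)))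
    (f := fun x => v k x i) (g := φ) (v := EuclideanSpace.single j 1)
    (by simp only [hf]; exact (hcj.mul hφ.continuous).integrable_of_hasCompactSupport hc.mul_left)
    ((hcv.mul hφ').integrable_of_hasCompactSupport hc'.mul_left)
    ((hcv.mul hφ.continuous).integrable_of_hasCompactSupport hc.mul_left)
    (fun x _ => (hd x).differentiableAt) (fun x _ => hφ.differentiable (by simp) x)
  simp only [hf] at this
  exact this

/-- The chain rule, for limits of smooth maps. -/
lemma tendsto_comp_of_tendsto {U : Set (Vec n)} {Ψ : Vec N → Vec N} (hΨ : ContDiff ℝ 1 Ψ) {K : NNReal}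
    (hK : ∀ y, ‖fderiv ℝ Ψ y‖ ≤ K) {v : ℕ → Vec n → Vec N} (hv : ∀ k, ContDiff ℝ 1 (v k))
    {w : Vec n → Vec N} {Dw : Vec n → Mat N n} (hw : IntegrableOn w U) (hDw : IntegrableOn Dw U)
    (hae : ∀ᵐ x ∂(volume.restrict U), Tendsto (fun k => v k x) atTop (𝓝 (w x)))
    (h₁ : Tendsto (fun k => ∫⁻ x in U, ‖v k x - w x‖ₑ) atTop (𝓝 0))
    (h₂ : Tendsto (fun k => ∫⁻ x in U, ‖jacobian (v k) x - Dw x‖ₑ) atTop (𝓝 0)) :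
    Tendsto (fun k => ∫⁻ x in U, ‖Ψ (v k x) - Ψ (w x)‖ₑ) atTop (𝓝 0) ∧
    Tendsto (fun k => ∫⁻ x in U, ‖jacobian (fun x => Ψ (v k x)) x -
      lmul (fderiv ℝ Ψ (w x)) (Dw x)‖ₑ) atTop (𝓝 0) := by
  have hlip : LipschitzWith K Ψ :=
    lipschitzWith_of_nnnorm_fderiv_le (hΨ.differentiable one_ne_zero) fun y => hK y
  have hcK : ∀ {g : ℕ → ENNReal}, Tendsto g atTop (𝓝 0) →
      Tendsto (fun k => (K : ENNReal) * g k) atTop (𝓝 0) := fun hg => by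
    simpa using ENNReal.Tendsto.const_mul hg (Or.inr ENNReal.coe_ne_top)
  constructor
  · refine tendsto_of_tendsto_of_tendsto_of_le_of_le tendsto_const_nhds (hcK h₁)
      (fun _ => zero_le) fun k => ?_
    dsimp only
    rw [← lintegral_const_mul' _ _ ENNReal.coe_ne_top]
    refine lintegral_mono fun x => ?_
    rw [← edist_eq_enorm_sub, ← edist_eq_enorm_sub]
    exact hlip _ _
  · have hjac : ∀ k x, jacobian (fun x => Ψ (v k x)) x =
        lmul (fderiv ℝ Ψ (v k x)) (jacobian (v k) x) := by
      intro k x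
      rw [jacobian_eq_toMat, jacobian_eq_toMat, ← toMat_comp_left]
      congr 1
      exact fderiv_comp x (hΨ.differentiable one_ne_zero _) ((hv k).differentiable one_ne_zero _)
    have hcΨ : Continuous (fderiv ℝ Ψ) := hΨ.continuous_fderiv one_ne_zero
    -- The error splits as dΨ(v_k)(Dv_k - Dw) + (dΨ(v_k) - dΨ(w))Dw. The first part is controlled by
    -- the L¹ convergence of gradients; this is the second part, where only a.e. convergence of
    -- dΨ(v_k) is available and dominated convergence applies.
    have hdom : Tendsto (fun k => ∫⁻ x in U, ‖lmul (fderiv ℝ Ψ (v k x)) (Dw x) -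
        lmul (fderiv ℝ Ψ (w x)) (Dw x)‖ₑ) atTop (𝓝 0) := by
      have h0 : (0 : ENNReal) = ∫⁻ _ in U, 0 := by simp
      rw [h0]
      refine tendsto_lintegral_filter_of_dominated_convergence'
        (fun x => ENNReal.ofReal (2 * K * ‖Dw x‖)) ?_ ?_ ?_ ?_
      · refine Eventually.of_forall fun k => ?_
        have m1 : AEStronglyMeasurable (fun x => lmulL (fderiv ℝ Ψ (v k x)) (Dw x)) (volume.restrict U) :=
          (lmulL (N := N) (n := n)).aestronglyMeasurable_comp₂
            (hcΨ.comp (hv k).continuous).aestronglyMeasurable hDw.1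
        have m2 : AEStronglyMeasurable (fun x => lmulL (fderiv ℝ Ψ (w x)) (Dw x)) (volume.restrict U) :=
          (lmulL (N := N) (n := n)).aestronglyMeasurable_comp₂
            (hcΨ.comp_aestronglyMeasurable hw.1) hDw.1
        exact (m1.sub m2).enorm
      · refine Eventually.of_forall fun k => Eventually.of_forall fun x => ?_
        rw [← ofReal_norm]
        refine ENNReal.ofReal_le_ofReal ((norm_sub_le _ _).trans ?_)
        have a := norm_lmul_le (fderiv ℝ Ψ (v k x)) (Dw x)
        have b := norm_lmul_le (fderiv ℝ Ψ (w x)) (Dw x)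
        have c := mul_le_mul_of_nonneg_right (hK (v k x)) (norm_nonneg (Dw x))
        have d := mul_le_mul_of_nonneg_right (hK (w x)) (norm_nonneg (Dw x))
        linarith
      · exact ((hDw.norm.const_mul (2 * K)).lintegral_lt_top).ne
      · filter_upwards [hae] with x hx
        have hcont : Continuous fun y => lmulL (fderiv ℝ Ψ y) (Dw x) :=
          (lmulL (N := N) (n := n)).continuous.comp hcΨ |>.clm_apply continuous_const
        have := (((hcont.tendsto (w x)).comp hx).sub_const (lmul (fderiv ℝ Ψ (w x)) (Dw x))).enorm
        simpa using this
    have hsum := (hcK h₂).add hdom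
    rw [add_zero] at hsum
    refine tendsto_of_tendsto_of_tendsto_of_le_of_le tendsto_const_nhds hsum
      (fun _ => zero_le) fun k => ?_
    dsimp only
    have hmes : AEMeasurable (fun x => (K : ENNReal) * ‖jacobian (v k) x - Dw x‖ₑ) (volume.restrict U) :=
      ((continuous_jacobian (hv k)).aestronglyMeasurable.sub hDw.1).enorm.const_mul _
    rw [← lintegral_const_mul' _ _ ENNReal.coe_ne_top, ← lintegral_add_left' hmes]
    refine lintegral_mono fun x => ?_
    rw [hjac]
    have e : lmul (fderiv ℝ Ψ (v k x)) (jacobian (v k) x) - lmul (fderiv ℝ Ψ (w x)) (Dw x) =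
        lmul (fderiv ℝ Ψ (v k x)) (jacobian (v k) x - Dw x) +
        (lmul (fderiv ℝ Ψ (v k x)) (Dw x) - lmul (fderiv ℝ Ψ (w x)) (Dw x)) := by
      have := (lmulL (fderiv ℝ Ψ (v k x))).map_sub (jacobian (v k) x) (Dw x)
      simp only [lmulL_apply] at this
      rw [this]; abel
    rw [e]
    refine (enorm_add_le _ _).trans ?_
    gcongr
    rw [← ofReal_norm, ← ofReal_norm, ← ENNReal.ofReal_coe_nnreal,
      ← ENNReal.ofReal_mul K.coe_nonneg]
    refine ENNReal.ofReal_le_ofReal ((norm_lmul_le _ _).trans ?_)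
    gcongr
    exact hK _

end Weak

/-! ### Mollified approximations of weakly differentiable maps. -/

section Approximation

variable {N n : ℕ}

/-- A sequence of smooth maps approximating a weakly differentiable map on `B`, with control of the
gradients in `L²`. -/
structure IsSmoothApprox (B : Set (Vec n)) (u : Vec n → Vec N) (Du : Vec n → Mat N n)
    (U : ℕ → Vec n → Vec N) (h : ℕ → Vec n → ℝ) : Prop where
  contDiff : ∀ k, ContDiff ℝ ∞ (U k)
  hasCompactSupport : ∀ k, HasCompactSupport (U k)
  ae_tendsto : ∀ᵐ x ∂(volume.restrict B), Tendsto (fun k => U k x) atTop (𝓝 (u x))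
  tendsto : Tendsto (fun k => ∫⁻ x in B, ‖U k x - u x‖ₑ) atTop (𝓝 0)
  tendsto_grad : Tendsto (fun k => ∫⁻ x in B, ‖jacobian (U k) x - Du x‖ₑ) atTop (𝓝 0)
  sq_le : ∀ k, ∀ x ∈ B, ‖jacobian (U k) x‖ ^ 2 ≤ h k x
  measurable_sq : ∀ k, Measurable (h k)
  tendsto_sq : Tendsto (fun k => ∫⁻ x in B, ‖h k x - ‖Du x‖ ^ 2‖ₑ) atTop (𝓝 0)

lemma contDiff_mollify {G : Type*} [NormedAddCommGroup G] [NormedSpace ℝ G]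
    (φ : ContDiffBump (0 : Vec n)) {g : Vec n → G} (hg : LocallyIntegrable g) :
    ContDiff ℝ ∞ (mollify φ g) :=
  φ.hasCompactSupport_normed.contDiff_convolution_left (ContinuousLinearMap.lsmul ℝ ℝ)
    φ.contDiff_normed hg

lemma hasCompactSupport_mollify {G : Type*} [NormedAddCommGroup G] [NormedSpace ℝ G]
    (φ : ContDiffBump (0 : Vec n)) {g : Vec n → G} (hg : HasCompactSupport g) :
    HasCompactSupport (mollify φ g) :=
  φ.hasCompactSupport_normed.convolution (ContinuousLinearMap.lsmul ℝ ℝ) hg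

/-- The derivative falls on the kernel, and y ↦ ψ(x - y) is an admissible test function in the
definition of the weak gradient because its support lies in `S`. -/
lemma jacobian_mollify {Ω S : Set (Vec n)} {u : Vec n → Vec N} {Du : Vec n → Mat N n}
    (hw : IsWeakGradient Ω u Du) (hS : MeasurableSet S) (hSΩ : S ⊆ Ω)
    (hu : IntegrableOn u S) (hDu : IntegrableOn Du S)
    (φ : ContDiffBump (0 : Vec n)) {x : Vec n} (hx : Metric.closedBall x φ.rOut ⊆ S) :
    jacobian (mollify φ (S.indicator u)) x = mollify φ (S.indicator Du) x := by
  have hu' : LocallyIntegrable (S.indicator u) := (hu.integrable_indicator hS).locallyIntegrable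
  have hD' : LocallyIntegrable (S.indicator Du) := (hDu.integrable_indicator hS).locallyIntegrable
  set ψ : Vec n → ℝ := φ.normed volume with hψ
  have hψd : ContDiff ℝ ∞ ψ := φ.contDiff_normed
  have hψc : HasCompactSupport ψ := φ.hasCompactSupport_normed
  ext ij
  obtain ⟨i, j⟩ := ij
  have h1 := hψc.hasFDerivAt_convolution_left (ContinuousLinearMap.lsmul ℝ ℝ) (hψd.of_le (by simp))
    hu' x
  have hint : Integrable fun t => ((ContinuousLinearMap.lsmul ℝ ℝ).precompL (Vec n) (fderiv ℝ ψ t))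
      (S.indicator u (x - t)) :=
    (hψc.fderiv ℝ).convolutionExists_left _ (hψd.continuous_fderiv (by simp)) hu' x
  have e1 : jacobian (mollify φ (S.indicator u)) x (i, j) =
      ∫ t, fderiv ℝ ψ t (EuclideanSpace.single j 1) * S.indicator u (x - t) i := by
    rw [jacobian_apply, mollify_eq_convolution, h1.fderiv, convolution,
      ContinuousLinearMap.integral_apply hint]
    have hint2 : Integrable fun t => (((ContinuousLinearMap.lsmul ℝ ℝ).precompL (Vec n) (fderiv ℝ ψ t))
      (S.indicator u (x - t))) (EuclideanSpace.single j 1) :=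
      (ContinuousLinearMap.apply ℝ (Vec N) (EuclideanSpace.single j (1 : ℝ) : Vec n)).integrable_comp hint
    exact ((EuclideanSpace.proj (𝕜 := ℝ) i).integral_comp_comm hint2).symm
  have e2 : mollify φ (S.indicator Du) x (i, j) = ∫ t, ψ t * S.indicator Du (x - t) (i, j) :=
    ((EuclideanSpace.proj (𝕜 := ℝ) (i, j)).integral_comp_comm
      (integrable_mollify_integrand φ hD' x)).symm
  rw [e1, e2, ← integral_sub_left_eq_self (fun t => fderiv ℝ ψ t (EuclideanSpace.single j 1) *
    S.indicator u (x - t) i) volume x, ← integral_sub_left_eq_self (fun t => ψ t *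
    S.indicator Du (x - t) (i, j)) volume x]
  simp only [sub_sub_cancel]
  set χ : Vec n → ℝ := fun y => ψ (x - y) with hχ
  have hχd : ContDiff ℝ ∞ χ := hψd.comp (contDiff_const.sub contDiff_id)
  have hsub : Function.support χ ⊆ Metric.ball x φ.rOut := by
    intro y hy
    have : x - y ∈ Function.support ψ := hy
    rw [hψ, φ.support_normed_eq, mem_ball_zero_iff] at this
    rwa [Metric.mem_ball, dist_comm, dist_eq_norm]
  have hts : tsupport χ ⊆ Metric.closedBall x φ.rOut :=
    closure_minimal (hsub.trans Metric.ball_subset_closedBall) Metric.isClosed_closedBall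
  have hχc : HasCompactSupport χ :=
    (isCompact_closedBall x φ.rOut).of_isClosed_subset (isClosed_tsupport _) hts
  have hχ' : ∀ y, fderiv ℝ χ y (EuclideanSpace.single j 1) =
      - fderiv ℝ ψ (x - y) (EuclideanSpace.single j 1) := by
    intro y
    have hd : HasFDerivAt χ (fderiv ℝ ψ (x - y) ∘L (-ContinuousLinearMap.id ℝ (Vec n))) y := by
      refine (hψd.differentiable (by simp) (x - y)).hasFDerivAt.comp y ?_
      exact (hasFDerivAt_id y).const_sub x
    rw [hd.fderiv]; simp
  have key := hw.integral_eq χ hχd hχc (hts.trans (hx.trans hSΩ)) i j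
  have hz : ∀ y, y ∉ S → χ y = 0 := fun y hy =>
    image_eq_zero_of_notMem_tsupport fun h => hy (hx (hts h))
  have hz' : ∀ y, y ∉ S → fderiv ℝ χ y (EuclideanSpace.single j 1) = 0 := fun y hy => by
    rw [image_eq_zero_of_notMem_tsupport (f := fderiv ℝ χ)
      (fun h => hy (hx (hts (tsupport_fderiv_subset ℝ h))))]; rfl
  rw [setIntegral_eq_integral_of_forall_compl_eq_zero
      (fun y hy => by rw [hz' y (fun h => hy (hSΩ h)), mul_zero]),
    setIntegral_eq_integral_of_forall_compl_eq_zero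
      (fun y hy => by rw [hz y (fun h => hy (hSΩ h)), mul_zero])] at key
  calc ∫ y, fderiv ℝ ψ (x - y) (EuclideanSpace.single j 1) * S.indicator u y i
      = -∫ y, u y i * fderiv ℝ χ y (EuclideanSpace.single j 1) := by
        rw [← integral_neg]
        congr 1; ext y
        by_cases hy : y ∈ S
        · rw [indicator_of_mem hy, hχ']; ring
        · have h3 := hz' y hy
          rw [h3, indicator_of_notMem hy]
          simp
    _ = ∫ y, Du y (i, j) * χ y := by rw [key, neg_neg]
    _ = ∫ y, ψ (x - y) * S.indicator Du y (i, j) := by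
        congr 1; ext y
        by_cases hy : y ∈ S
        · rw [indicator_of_mem hy]; ring
        · rw [hz y hy, indicator_of_notMem hy]; simp

/-- Cutting off u and Du by the indicator of a compact neighbourhood `S` of the closed ball makes
them integrable on the whole space. On the ball, mollification at radii at most δ does not see the
cutoff. -/
lemma exists_isSmoothApprox {Ω : Set (Vec n)} (hΩ : IsOpen Ω) {u : Vec n → Vec N} {Du : Vec n → Mat N n}
    (hw : IsWeakGradient Ω u Du) (h2 : LocallyIntegrableOn (fun x => ‖Du x‖ ^ 2) Ω)
    {x₀ : Vec n} {R : ℝ} (hR : Metric.closedBall x₀ R ⊆ Ω) :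
    ∃ U h, IsSmoothApprox (Metric.ball x₀ R) u Du U h := by
  obtain ⟨δ, hδ, hδΩ⟩ := (isCompact_closedBall x₀ R).exists_cthickening_subset_open hΩ hR
  set S := Metric.cthickening δ (Metric.closedBall x₀ R) with hS
  have hSc : IsCompact S := (isCompact_closedBall x₀ R).cthickening
  have hSm : MeasurableSet S := hSc.isClosed.measurableSet
  have hBS : Metric.ball x₀ R ⊆ S :=
    Metric.ball_subset_closedBall.trans (Metric.self_subset_cthickening _)
  have hu := hw.locallyIntegrable.integrableOn_compact_subset hδΩ hSc
  have hDu := hw.locallyIntegrable_grad.integrableOn_compact_subset hδΩ hSc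
  have hD2 := h2.integrableOn_compact_subset hδΩ hSc
  let φ : ℕ → ContDiffBump (0 : Vec n) := fun k =>
    ⟨δ / (2 * (k + 1)), δ / (k + 1), by positivity, by
      rw [mul_comm, ← div_div]; exact half_lt_self (by positivity)⟩
  have hφ : Tendsto (fun k => (φ k).rOut) atTop (𝓝 0) := by
    have := tendsto_one_div_add_atTop_nhds_zero_nat (𝕜 := ℝ)
    have := this.const_mul δ
    simpa [φ, div_eq_mul_inv] using this
  have hφδ : ∀ k, (φ k).rOut ≤ δ := fun k => by
    change δ / (k + 1) ≤ δ
    exact div_le_self hδ.le (by linarith [(Nat.cast_nonneg k : (0:ℝ) ≤ k)])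
  -- Comparable inner and outer radii make the kernels admissible for Lebesgue differentiation,
  -- hence the a.e. convergence.
  have hφ2 : ∀ᶠ k in atTop, (φ k).rOut ≤ 2 * (φ k).rIn := Eventually.of_forall fun k => by
    change δ / (k + 1) ≤ 2 * (δ / (2 * (k + 1)))
    refine le_of_eq ?_
    field_simp
  have hiu := hu.integrable_indicator hSm
  have hiD := hDu.integrable_indicator hSm
  have hi2 := hD2.integrable_indicator hSm
  have heq : ∀ {G : Type} [NormedAddCommGroup G] (g : Vec n → G), ∀ x ∈ Metric.ball x₀ R,
      S.indicator g x = g x := fun g x hx => indicator_of_mem (hBS hx) g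
  have hjac : ∀ k, ∀ x ∈ Metric.ball x₀ R, jacobian (mollify (φ k) (S.indicator u)) x =
      mollify (φ k) (S.indicator Du) x := fun k x hx => by
    refine jacobian_mollify hw hSm hδΩ hu hDu (φ k) ?_
    refine (Metric.closedBall_subset_closedBall (hφδ k)).trans ?_
    exact Metric.closedBall_subset_cthickening (Metric.ball_subset_closedBall hx) δ
  have hL : ∀ {G : Type} [NormedAddCommGroup G] [NormedSpace ℝ G] [CompleteSpace G] (g : Vec n → G),
      Integrable (S.indicator g) → Tendsto (fun k => ∫⁻ x in Metric.ball x₀ R,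
        ‖mollify (φ k) (S.indicator g) x - g x‖ₑ) atTop (𝓝 0) := by
    intro G _ _ _ g hg
    refine tendsto_of_tendsto_of_tendsto_of_le_of_le tendsto_const_nhds (tendsto_mollify hφ hg)
      (fun _ => zero_le) fun k => ?_
    refine le_trans (le_of_eq ?_) (setLIntegral_le_lintegral (Metric.ball x₀ R) _)
    exact setLIntegral_congr_fun Metric.isOpen_ball.measurableSet
      fun x hx => by rw [heq g x hx]
  refine ⟨fun k => mollify (φ k) (S.indicator u),
    fun k => mollify (φ k) (S.indicator fun x => ‖Du x‖ ^ 2), ?_, ?_, ?_, hL u hiu, ?_, ?_, ?_, hL _ hi2⟩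
  · exact fun k => contDiff_mollify (φ k) hiu.locallyIntegrable
  · exact fun k => hasCompactSupport_mollify (φ k)
      (HasCompactSupport.intro hSc fun x hx => indicator_of_notMem hx _)
  · rw [ae_restrict_iff' Metric.isOpen_ball.measurableSet]
    filter_upwards [ContDiffBump.ae_convolution_tendsto_right_of_locallyIntegrable (μ := volume)
      hφ hφ2 hiu.locallyIntegrable] with x hx hxB
    rw [heq u x hxB] at hx
    exact hx
  · refine (hL Du hiD).congr fun k => ?_
    exact setLIntegral_congr_fun Metric.isOpen_ball.measurableSet
      fun x hx => by rw [hjac k x hx]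
  · intro k x hx
    rw [hjac k x hx]
    have hsq : (fun y => ‖S.indicator Du y‖ ^ 2) = S.indicator fun x => ‖Du x‖ ^ 2 := by
      ext y
      by_cases hy : y ∈ S
      · simp [hy]
      · simp [hy]
    have := norm_mollify_sq_le (φ k) hiD.locallyIntegrable
      (by rw [hsq]; exact hi2.locallyIntegrable) x
    rwa [hsq] at this
  · exact fun k => (contDiff_mollify (φ k) hi2.locallyIntegrable).continuous.measurable

end Approximation

/-! ### Projection to the sphere -/

section Projection

variable {N n : ℕ}

/-- A smooth compactly supported map which is `y ↦ y / |y|` for `1 / 2 ≤ |y| ≤ 2`. -/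
def proj (y : Vec N) : Vec N :=
  ((1 - (⟨1 / 4, 1 / 2, by norm_num, by norm_num⟩ : ContDiffBump (0 : Vec N)) y) *
    (⟨2, 3, by norm_num, by norm_num⟩ : ContDiffBump (0 : Vec N)) y) • (‖y‖⁻¹ • y)

lemma proj_eq {y : Vec N} (h₁ : 1 / 2 ≤ ‖y‖) (h₂ : ‖y‖ ≤ 2) : proj y = ‖y‖⁻¹ • y := by
  rw [proj, ContDiffBump.zero_of_le_dist, ContDiffBump.one_of_mem_closedBall]
  · simp
  · simpa using h₂
  · simpa using h₁

lemma contDiff_proj : ContDiff ℝ ∞ (proj (N := N)) := by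
  rw [contDiff_iff_contDiffAt]
  intro y
  by_cases hy : y = 0
  · have : proj (N := N) =ᶠ[𝓝 y] fun _ => 0 := by
      rw [hy]
      filter_upwards [Metric.ball_mem_nhds (0 : Vec N) (by norm_num : (0:ℝ) < 1 / 4)] with z hz
      rw [proj, ContDiffBump.one_of_mem_closedBall _ (Metric.ball_subset_closedBall hz)]
      simp
    exact contDiffAt_const.congr_of_eventuallyEq this
  · have a : ContDiffAt ℝ ∞ (fun y : Vec N => ‖y‖⁻¹) y :=
      (contDiffAt_norm ℝ hy).inv (norm_ne_zero_iff.2 hy)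
    have b : ContDiffAt ℝ ∞ (fun y : Vec N =>
        (1 - (⟨1 / 4, 1 / 2, by norm_num, by norm_num⟩ : ContDiffBump (0 : Vec N)) y) *
        (⟨2, 3, by norm_num, by norm_num⟩ : ContDiffBump (0 : Vec N)) y) y :=
      (contDiffAt_const.sub (ContDiffBump.contDiff _).contDiffAt).mul
        (ContDiffBump.contDiff _).contDiffAt
    exact b.smul (a.smul contDiffAt_id)

lemma hasCompactSupport_proj : HasCompactSupport (proj (N := N)) := by
  refine HasCompactSupport.intro (isCompact_closedBall (0 : Vec N) 3) fun y hy => ?_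
  rw [proj, ContDiffBump.zero_of_le_dist (⟨2, 3, _, _⟩ : ContDiffBump (0 : Vec N))]
  · simp
  · simp only [Metric.mem_closedBall, not_le] at hy
    exact hy.le

lemma exists_bound_fderiv_proj (N : ℕ) : ∃ K : NNReal, ∀ y, ‖fderiv ℝ (proj (N := N)) y‖ ≤ K := by
  obtain ⟨M, hM⟩ := (hasCompactSupport_proj (N := N)).fderiv ℝ |>.exists_bound_of_continuous
    (contDiff_proj.continuous_fderiv (by simp))
  exact ⟨⟨M, (norm_nonneg _).trans (hM 0)⟩, hM⟩

lemma hasFDerivAt_normalize {y : Vec N} (hy : y ≠ 0) :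
    HasFDerivAt (fun y : Vec N => ‖y‖⁻¹ • y)
      (‖y‖⁻¹ • ContinuousLinearMap.id ℝ (Vec N) -
        (‖y‖⁻¹ ^ 3) • (innerSL ℝ y).smulRight y) y := by
  have hy' : ‖y‖ ≠ 0 := norm_ne_zero_iff.2 hy
  have h1 : HasFDerivAt (fun y : Vec N => ‖y‖) (‖y‖⁻¹ • innerSL ℝ y) y := by
    have h2 := (hasStrictFDerivAt_norm_sq y).hasFDerivAt.sqrt (pow_ne_zero 2 hy')
    simp only [Real.sqrt_sq (norm_nonneg _)] at h2
    convert! h2 using 1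
    ext h
    simp
    field_simp
  have h3 := (hasDerivAt_inv hy').comp_hasFDerivAt y h1
  have h4 := h3.smul (hasFDerivAt_id y)
  refine h4.congr_fderiv ?_
  ext1 h
  simp only [_root_.sub_apply, _root_.add_apply, _root_.smul_apply,
    ContinuousLinearMap.smulRight_apply, ContinuousLinearMap.id_apply, innerSL_apply_apply, smul_smul,
    Function.comp, id, smul_eq_mul]
  rw [sub_eq_add_neg, ← neg_smul]
  congr 2
  field_simp

lemma fderiv_proj {y : Vec N} (h₁ : 1 / 2 < ‖y‖) (h₂ : ‖y‖ < 2) :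
    fderiv ℝ proj y = ‖y‖⁻¹ • ContinuousLinearMap.id ℝ (Vec N) -
        (‖y‖⁻¹ ^ 3) • (innerSL ℝ y).smulRight y := by
  have : proj (N := N) =ᶠ[𝓝 y] fun y => ‖y‖⁻¹ • y := by
    filter_upwards [continuous_norm.continuousAt.eventually (lt_mem_nhds h₁),
      continuous_norm.continuousAt.eventually (gt_mem_nhds h₂)] with z hz hz'
    exact proj_eq hz.le hz'.le
  rw [this.fderiv_eq]
  exact (hasFDerivAt_normalize (norm_pos_iff.1 (by linarith))).fderiv

/-- Only the term with `coact y Z` is not a mere scaling of `Z`; it measures the normal part of the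
gradient and vanishes for tangential matrices. -/
lemma lmul_fderiv_proj {y : Vec N} (h₁ : 1 / 2 < ‖y‖) (h₂ : ‖y‖ < 2) (Z : Mat N n) :
    lmul (fderiv ℝ proj y) Z = ‖y‖⁻¹ • Z - (‖y‖⁻¹ ^ 3) • tens y (coact y Z) := by
  rw [fderiv_proj h₁ h₂]
  ext ij
  obtain ⟨i, j⟩ := ij
  simp only [lmul_apply, _root_.sub_apply, _root_.smul_apply, ContinuousLinearMap.id_apply,
    ContinuousLinearMap.smulRight_apply, innerSL_apply_apply, PiLp.sub_apply, PiLp.smul_apply,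
    smul_eq_mul, tens_apply, coact_apply, col_apply]
  ring

end Projection

/-! ### Averages over balls of variable radius -/

section Averages

variable {n : ℕ}

/-- The uniform probability measure on the unit ball. -/
def unitAvg (n : ℕ) : Measure (Vec n) :=
  (volume (Metric.ball (0 : Vec n) 1))⁻¹ • volume.restrict (Metric.ball 0 1)

lemma volume_unitBall_ne_zero : volume (Metric.ball (0 : Vec n) 1) ≠ 0 :=
  (Metric.measure_ball_pos volume 0 one_pos).ne'

lemma volume_unitBall_ne_top : volume (Metric.ball (0 : Vec n) 1) ≠ ⊤ := measure_ball_lt_top.ne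

instance : IsProbabilityMeasure (unitAvg n) :=
  ⟨by simp [unitAvg, ENNReal.inv_mul_cancel volume_unitBall_ne_zero volume_unitBall_ne_top]⟩

lemma ae_unitAvg_norm_lt : ∀ᵐ z ∂(unitAvg n), ‖z‖ < 1 := by
  refine Measure.ae_smul_measure ?_ _
  rw [ae_restrict_iff' Metric.isOpen_ball.measurableSet]
  exact Eventually.of_forall fun z hz => by simpa using hz

lemma map_unitAvg_le (x : Vec n) {r : ℝ} (hr : 0 < r) :
    (unitAvg n).map (fun z => x + r • z) ≤
      ((volume (Metric.ball (0 : Vec n) 1))⁻¹ * ENNReal.ofReal ((r ^ n)⁻¹)) •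
        volume.restrict (Metric.ball x r) := by
  have hm : Measurable fun z : Vec n => x + r • z := by fun_prop
  refine Measure.le_iff.2 fun A hA => ?_
  rw [Measure.map_apply hm hA, unitAvg, Measure.smul_apply, Measure.smul_apply,
    Measure.restrict_apply (hm hA), Measure.restrict_apply hA, smul_eq_mul, smul_eq_mul, mul_assoc]
  gcongr
  have hsub : (fun z => x + r • z) ⁻¹' A ∩ Metric.ball 0 1 ⊆
      (fun z : Vec n => r • z) ⁻¹' ((fun y => x + y) ⁻¹' (A ∩ Metric.ball x r)) := by
    rintro z ⟨hz, hz1⟩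
    refine ⟨hz, ?_⟩
    rw [mem_ball_zero_iff] at hz1
    rw [Metric.mem_ball, dist_eq_norm, add_sub_cancel_left, norm_smul, Real.norm_of_nonneg hr.le]
    nlinarith
  refine (measure_mono hsub).trans_eq ?_
  rw [Measure.addHaar_preimage_smul _ hr.ne', measure_preimage_add, finrank_euclideanSpace_fin,
    abs_of_pos (by positivity)]

lemma lintegral_unitAvg_le (x : Vec n) {r : ℝ} (hr : 0 < r) {U : Set (Vec n)}
    (hU : Metric.ball x r ⊆ U) (h : Vec n → ENNReal) :
    ∫⁻ z, h (x + r • z) ∂(unitAvg n) ≤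
      (volume (Metric.ball (0 : Vec n) 1))⁻¹ * ENNReal.ofReal ((r ^ n)⁻¹) * ∫⁻ y in U, h y := by
  have he : MeasurableEmbedding fun z : Vec n => x + r • z :=
    ((Homeomorph.smulOfNeZero r hr.ne').trans (Homeomorph.addLeft x)).measurableEmbedding
  rw [← he.lintegral_map]
  calc _ ≤ ∫⁻ y, h y ∂(((volume (Metric.ball (0 : Vec n) 1))⁻¹ * ENNReal.ofReal ((r ^ n)⁻¹)) •
        volume.restrict (Metric.ball x r)) := lintegral_mono' (map_unitAvg_le x hr) le_rfl
    _ = _ * ∫⁻ y in Metric.ball x r, h y := lintegral_smul_measure _ _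
    _ ≤ _ := by gcongr

lemma integrable_unitAvg {G : Type*} [NormedAddCommGroup G] (x : Vec n) {r : ℝ} (hr : 0 < r)
    {U : Set (Vec n)} (hU : Metric.ball x r ⊆ U) {h : Vec n → G} (hi : IntegrableOn h U) :
    Integrable (fun z => h (x + r • z)) (unitAvg n) := by
  have he : MeasurableEmbedding fun z : Vec n => x + r • z :=
    ((Homeomorph.smulOfNeZero r hr.ne').trans (Homeomorph.addLeft x)).measurableEmbedding
  have h2 : Integrable h ((unitAvg n).map (fun z => x + r • z)) :=
    ((hi.mono_set hU).smul_measure (ENNReal.mul_ne_top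
      (ENNReal.inv_ne_top.2 volume_unitBall_ne_zero) ENNReal.ofReal_ne_top)).mono_measure
      (map_unitAvg_le x hr)
  exact he.integrable_map_iff.1 h2

lemma ae_unitAvg_of_ae (x : Vec n) {r : ℝ} (hr : 0 < r)
    {U : Set (Vec n)} (hU : Metric.ball x r ⊆ U) {P : Vec n → Prop}
    (hP : ∀ᵐ y ∂(volume.restrict U), P y) : ∀ᵐ z ∂(unitAvg n), P (x + r • z) := by
  have hm : Measurable fun z : Vec n => x + r • z := by fun_prop
  refine ae_of_ae_map hm.aemeasurable ?_
  have h1 : ∀ᵐ y ∂(volume.restrict (Metric.ball x r)), P y :=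
    ae_mono (Measure.restrict_mono hU le_rfl) hP
  have h2 := Measure.ae_smul_measure h1
    ((volume (Metric.ball (0 : Vec n) 1))⁻¹ * ENNReal.ofReal ((r ^ n)⁻¹))
  exact ae_mono (map_unitAvg_le x hr) h2

/-- A smooth radius function supported in a smaller concentric ball. -/
structure IsRadius (x₀ : Vec n) (R R' l : ℝ) (τ : Vec n → ℝ) : Prop where
  contDiff : ContDiff ℝ ∞ τ
  nonneg : ∀ x, 0 ≤ τ x
  le : ∀ x, τ x ≤ R - R'
  lt : R' < R
  tsupport_subset : tsupport τ ⊆ Metric.closedBall x₀ R'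
  norm_gradient_le : ∀ x, ‖gradient τ x‖ ≤ l
  le_half : l ≤ 1 / 2

namespace IsRadius

variable {x₀ : Vec n} {R R' l : ℝ} {τ : Vec n → ℝ} (hτ : IsRadius x₀ R R' l τ)
include hτ

lemma l_nonneg : 0 ≤ l := (norm_nonneg _).trans (hτ.norm_gradient_le 0)

lemma ball_subset (x : Vec n) (hx : 0 < τ x) : Metric.ball x (τ x) ⊆ Metric.ball x₀ R := by
  have h1 : x ∈ Metric.closedBall x₀ R' := hτ.tsupport_subset (subset_tsupport τ hx.ne')
  refine Metric.ball_subset_ball' ?_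
  have := hτ.le x
  rw [Metric.mem_closedBall] at h1
  linarith

lemma add_mem_ball {x z : Vec n} (hx : x ∈ Metric.ball x₀ R) (hz : ‖z‖ < 1) :
    x + τ x • z ∈ Metric.ball x₀ R := by
  rcases (hτ.nonneg x).eq_or_lt with h | h
  · rw [← h]; simpa using hx
  · refine hτ.ball_subset x h ?_
    rw [Metric.mem_ball, dist_eq_norm, add_sub_cancel_left, norm_smul, Real.norm_of_nonneg h.le]
    nlinarith

lemma hasFDerivAt (x : Vec n) : HasFDerivAt τ (innerSL ℝ (gradient τ x)) x := by
  have := ((hτ.contDiff.differentiable (by simp)) x).hasGradientAt.hasFDerivAt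
  exact this

lemma hasFDerivAt_add (x z : Vec n) : HasFDerivAt (fun x => x + τ x • z)
    (ContinuousLinearMap.id ℝ (Vec n) + (innerSL ℝ (gradient τ x)).smulRight z) x :=
  (hasFDerivAt_id x).add ((hτ.hasFDerivAt x).smul_const z)

lemma continuous_gradient : Continuous (gradient τ) :=
  (InnerProductSpace.toDual ℝ (Vec n)).symm.continuous.comp
    (hτ.contDiff.continuous_fderiv (by simp))

lemma lipschitz (x y : Vec n) : |τ x - τ y| ≤ l * ‖x - y‖ := by
  have := (convex_univ (𝕜 := ℝ) (E := Vec n)).norm_image_sub_le_of_norm_hasFDerivWithin_le (f := τ)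
    (fun z _ => (hτ.hasFDerivAt z).hasFDerivWithinAt)
    (fun z _ => by rw [innerSL_apply_norm]; exact hτ.norm_gradient_le z)
    (mem_univ y) (mem_univ x)
  simpa using this

/-- The map is the identity plus a map with Lipschitz constant at most 1/2. -/
lemma injective {z : Vec n} (hz : ‖z‖ ≤ 1) : Function.Injective fun x => x + τ x • z := by
  intro x y hxy
  have h1 : x - y = (τ y - τ x) • z := by
    have : x + τ x • z = y + τ y • z := hxy
    rw [sub_smul, sub_eq_sub_iff_add_eq_add, this]; abel
  have h2 : ‖x - y‖ ≤ 1 / 2 * ‖x - y‖ := by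
    conv_lhs => rw [h1, norm_smul, Real.norm_eq_abs, abs_sub_comm]
    have := hτ.lipschitz x y
    have h3 := hτ.le_half
    calc |τ x - τ y| * ‖z‖ ≤ |τ x - τ y| * 1 := by gcongr
      _ ≤ l * ‖x - y‖ := by linarith
      _ ≤ _ := by gcongr
  have h3 : ‖x - y‖ = 0 := by linarith [norm_nonneg (x - y)]
  exact sub_eq_zero.1 (norm_eq_zero.1 h3)

/-- Change of variables under x ↦ x + τ(x)z, which is injective and maps the ball into itself. Its
derivative is a transvection-like perturbation of the identity with determinant 1 + ⟨∇τ,z⟩ ≥ 1 - l.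
The factor tends to 1 with l, which is essential: minimality must cancel the full energy. -/
lemma lintegral_comp_le {z : Vec n} (hz : ‖z‖ < 1) (h : Vec n → ENNReal) :
    ∫⁻ x in Metric.ball x₀ R, h (x + τ x • z) ≤
      ENNReal.ofReal (1 - l)⁻¹ * ∫⁻ x in Metric.ball x₀ R, h x := by
  have hl := hτ.le_half
  have hl0 : 0 < 1 - l := by linarith
  have hdet : ∀ x, 1 - l ≤ |(ContinuousLinearMap.id ℝ (Vec n) +
      (innerSL ℝ (gradient τ x)).smulRight z).det| := by
    intro x
    have e : (ContinuousLinearMap.id ℝ (Vec n) + (innerSL ℝ (gradient τ x)).smulRight z).det =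
        1 + inner ℝ (gradient τ x) z := by
      rw [ContinuousLinearMap.det]
      have : ((ContinuousLinearMap.id ℝ (Vec n) + (innerSL ℝ (gradient τ x)).smulRight z :
          Vec n →L[ℝ] Vec n) : Vec n →ₗ[ℝ] Vec n) =
          LinearMap.transvection ((innerSL ℝ (gradient τ x) : Vec n →L[ℝ] ℝ) : Vec n →ₗ[ℝ] ℝ) z := by
        ext; rfl
      rw [this, LinearMap.transvection.det]
      rfl
    rw [e]
    refine le_trans ?_ (le_abs_self _)
    have h1 := abs_real_inner_le_norm (gradient τ x) z
    have h2 := hτ.norm_gradient_le x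
    have h3 : ‖gradient τ x‖ * ‖z‖ ≤ l := by nlinarith [norm_nonneg (gradient τ x), norm_nonneg z]
    linarith [neg_abs_le (inner ℝ (gradient τ x) z)]
  have hcv := lintegral_image_eq_lintegral_abs_det_fderiv_mul (volume : Measure (Vec n))
    (s := Metric.ball x₀ R) Metric.isOpen_ball.measurableSet
    (fun x _ => (hτ.hasFDerivAt_add x z).hasFDerivWithinAt) (hτ.injective hz.le).injOn h
  have himg : (fun x => x + τ x • z) '' Metric.ball x₀ R ⊆ Metric.ball x₀ R := by
    rintro _ ⟨x, hx, rfl⟩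
    exact hτ.add_mem_ball hx hz
  calc ∫⁻ x in Metric.ball x₀ R, h (x + τ x • z)
      = ∫⁻ x in Metric.ball x₀ R, ENNReal.ofReal (1 - l)⁻¹ * (ENNReal.ofReal (1 - l) *
          h (x + τ x • z)) := by
        refine lintegral_congr fun x => ?_
        rw [← mul_assoc, ← ENNReal.ofReal_mul (by positivity), inv_mul_cancel₀ hl0.ne']
        simp
    _ ≤ ENNReal.ofReal (1 - l)⁻¹ * ∫⁻ x in Metric.ball x₀ R,
          ENNReal.ofReal |(ContinuousLinearMap.id ℝ (Vec n) +
            (innerSL ℝ (gradient τ x)).smulRight z).det| * h (x + τ x • z) := by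
        rw [lintegral_const_mul' _ _ ENNReal.ofReal_ne_top]
        gcongr with x
        exact hdet x
    _ ≤ _ := by
        rw [← hcv]
        gcongr

lemma lintegral_avg_le {h : Vec n → ENNReal} (hh : Measurable h) :
    ∫⁻ x in Metric.ball x₀ R, ∫⁻ z, h (x + τ x • z) ∂(unitAvg n) ≤
      ENNReal.ofReal (1 - l)⁻¹ * ∫⁻ x in Metric.ball x₀ R, h x := by
  have hc : Continuous τ := hτ.contDiff.continuous
  have hm : Measurable fun p : Vec n × Vec n => p.1 + τ p.1 • p.2 := by fun_prop
  rw [lintegral_lintegral_swap (f := fun x z => h (x + τ x • z)) (hh.comp hm).aemeasurable]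
  calc _ ≤ ∫⁻ _, ENNReal.ofReal (1 - l)⁻¹ * (∫⁻ x in Metric.ball x₀ R, h x) ∂(unitAvg n) := by
        refine lintegral_mono_ae ?_
        filter_upwards [ae_unitAvg_norm_lt] with z hz
        exact hτ.lintegral_comp_le hz h
    _ = _ := by simp

lemma lintegral_avg_le_two {h : Vec n → ENNReal} (hh : Measurable h) :
    ∫⁻ x in Metric.ball x₀ R, ∫⁻ z, h (x + τ x • z) ∂(unitAvg n) ≤
      2 * ∫⁻ x in Metric.ball x₀ R, h x := by
  refine (hτ.lintegral_avg_le hh).trans ?_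
  gcongr
  rw [← ENNReal.ofReal_ofNat 2]
  refine ENNReal.ofReal_le_ofReal ?_
  have := hτ.le_half
  rw [inv_le_comm₀ (by linarith) (by norm_num)]
  norm_num; linarith

lemma integrable_add {G : Type*} [NormedAddCommGroup G] (x : Vec n)
    {h : Vec n → G} (hi : IntegrableOn h (Metric.ball x₀ R)) :
    Integrable (fun z => h (x + τ x • z)) (unitAvg n) := by
  rcases (hτ.nonneg x).eq_or_lt with h0 | h0
  · rw [← h0]; simp
  · exact integrable_unitAvg x h0 (hτ.ball_subset x h0) hi

end IsRadius

end Averages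

/-! ### Gradients and L¹ continuity of averages of variable radius. -/

section AveragedMaps

variable {N n : ℕ}

/-- The average of `u` over the ball of radius `τ x` around `x`. -/
def avg (τ : Vec n → ℝ) (u : Vec n → Vec N) (x : Vec n) : Vec N :=
  ∫ z, u (x + τ x • z) ∂(unitAvg n)

/-- The gradient of `avg τ u`. -/
def avgGrad (τ : Vec n → ℝ) (Du : Vec n → Mat N n) (x : Vec n) : Mat N n :=
  ∫ z, shear (Du (x + τ x • z)) z (gradient τ x) ∂(unitAvg n)

/-- `shear` as a linear map in the matrix. -/
def shearL (z g : Vec n) : Mat N n →L[ℝ] Mat N n :=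
  ContinuousLinearMap.id ℝ _ + (tensL.flip g) ∘L (actL.flip z)

@[simp] lemma shearL_apply (Z : Mat N n) (z g : Vec n) : shearL z g Z = shear Z z g := rfl

lemma continuous_shear : Continuous fun p : Mat N n × Vec n × Vec n => shear p.1 p.2.1 p.2.2 := by
  have h1 : Continuous fun p : Mat N n × Vec n × Vec n => actL p.1 p.2.1 := by fun_prop
  have h2 : Continuous fun p : Mat N n × Vec n × Vec n => tensL (actL p.1 p.2.1) p.2.2 :=
    (tensL.continuous.comp h1).clm_apply (by fun_prop)
  exact continuous_fst.add h2

variable {x₀ : Vec n} {R R' l : ℝ} {τ : Vec n → ℝ}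

/-- Differentiating a change of variables would fail where τ = 0. Instead the average is written as
a parametric convolution, evaluated at 0, of the normalized indicator of the unit ball with y ↦
χ(y)u(x - τ(x)y); the cutoff χ only provides compact support in y. -/
lemma contDiff_avg (hτ : ContDiff ℝ ∞ τ) {u : Vec n → Vec N} (hu : ContDiff ℝ ∞ u) :
    ContDiff ℝ ∞ (avg τ u) := by
  let χ : ContDiffBump (0 : Vec n) := ⟨1, 2, by norm_num, by norm_num⟩
  let c : ℝ := (volume (Metric.ball (0 : Vec n) 1))⁻¹.toReal
  let f : Vec n → ℝ := (Metric.ball 0 1).indicator fun _ => c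
  let g : Vec n → Vec n → Vec N := fun p y => χ y • u (p - τ p • y)
  have hf : LocallyIntegrable f :=
    ((integrableOn_const measure_ball_lt_top.ne).integrable_indicator
      Metric.isOpen_ball.measurableSet).locallyIntegrable
  have hg : ContDiff ℝ ∞ (Function.uncurry g) := by
    have h1 : ContDiff ℝ ∞ fun p : Vec n × Vec n => χ p.2 := χ.contDiff.comp contDiff_snd
    have h2 : ContDiff ℝ ∞ fun p : Vec n × Vec n => u (p.1 - τ p.1 • p.2) :=
      hu.comp (contDiff_fst.sub ((hτ.comp contDiff_fst).smul contDiff_snd))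
    exact h1.smul h2
  have key := contDiffOn_convolution_right_with_param_comp (μ := (volume : Measure (Vec n)))
    (ContinuousLinearMap.lsmul ℝ ℝ) (n := ⊤)
    (contDiffOn_const (c := (0 : Vec n))) isOpen_univ (isCompact_closedBall (0 : Vec n) 2)
    (f := f) (g := g) (fun p x _ hx => by
      have : χ x = 0 := χ.zero_of_le_dist (by
        simp only [Metric.mem_closedBall, not_le] at hx; exact hx.le)
      simp [g, this]) hf hg.contDiffOn
  rw [contDiffOn_univ] at key
  have e : avg τ u = fun x => (convolution f (g x) (ContinuousLinearMap.lsmul ℝ ℝ) volume) 0 := by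
    ext1 x
    rw [avg, unitAvg, integral_smul_measure, ← integral_indicator Metric.isOpen_ball.measurableSet,
      ← integral_smul, convolution]
    congr 1; ext1 t
    by_cases ht : t ∈ Metric.ball (0 : Vec n) 1
    · have : χ (-t) = 1 := χ.one_of_mem_closedBall (by
        rw [mem_closedBall_zero_iff, norm_neg]; exact (mem_ball_zero_iff.1 ht).le)
      simp [f, g, indicator_of_mem ht, this, c]
    · simp [f, g, indicator_of_notMem ht]
  rw [e]; exact key

/-- Differentiation under the integral sign. The integrand has gradient at most 2 sup|Du|, since |z|
< 1 and |∇τ| ≤ 1/2. -/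
lemma jacobian_avg (hτ : IsRadius x₀ R R' l τ) {u : Vec n → Vec N} (hu : ContDiff ℝ ∞ u)
    (hc : HasCompactSupport u) (x : Vec n) :
    jacobian (avg τ u) x = avgGrad τ (jacobian u) x := by
  have hcτ : Continuous τ := hτ.contDiff.continuous
  obtain ⟨M, hM⟩ := (hc.fderiv ℝ).exists_bound_of_continuous (hu.continuous_fderiv (by simp))
  have hM0 : 0 ≤ M := (norm_nonneg _).trans (hM 0)
  obtain ⟨M', hM'⟩ := hc.exists_bound_of_continuous hu.continuous
  have hcu := hu.continuous
  have hcu' := hu.continuous_fderiv (by simp)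
  let A : Vec n → Vec n → Vec n →L[ℝ] Vec n := fun y z =>
    ContinuousLinearMap.id ℝ (Vec n) + (innerSL ℝ (gradient τ y)).smulRight z
  have hcA : ∀ y, Continuous (A y) := fun y => by
    have : Continuous fun z => ContinuousLinearMap.smulRightL ℝ (Vec n) (Vec n)
      (innerSL ℝ (gradient τ y)) z := by fun_prop
    exact continuous_const.add this
  have hcF : ∀ y, Continuous fun z => fderiv ℝ u (y + τ y • z) ∘L A y z := fun y =>
    (hcu'.comp (by fun_prop)).clm_comp (hcA y)
  have key := hasFDerivAt_integral_of_dominated_of_fderiv_le (μ := unitAvg n) (𝕜 := ℝ)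
    (F := fun y z => u (y + τ y • z)) (F' := fun y z => fderiv ℝ u (y + τ y • z) ∘L A y z)
    (bound := fun _ => M * 2) (s := univ) (x₀ := x) univ_mem
    (Eventually.of_forall fun y => (hcu.comp (by fun_prop)).aestronglyMeasurable)
    (Integrable.of_bound (hcu.comp (by fun_prop)).aestronglyMeasurable M'
      (Eventually.of_forall fun z => hM' _))
    (hcF x).aestronglyMeasurable
    (by
      filter_upwards [ae_unitAvg_norm_lt] with z hz y _
      refine (ContinuousLinearMap.opNorm_comp_le _ _).trans ?_
      refine mul_le_mul (hM _) ?_ (norm_nonneg _) hM0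
      refine (norm_add_le _ _).trans ?_
      rw [ContinuousLinearMap.norm_smulRight_apply, innerSL_apply_norm]
      have h1 := ContinuousLinearMap.norm_id_le (𝕜 := ℝ) (E := Vec n)
      have h2 := hτ.norm_gradient_le y
      have h3 := hτ.le_half
      nlinarith [norm_nonneg (gradient τ y), norm_nonneg z])
    (integrable_const _)
    (Eventually.of_forall fun z y _ =>
      ((hu.differentiable (by simp)) _).hasFDerivAt.comp y (hτ.hasFDerivAt_add y z))
  have hint : Integrable (fun z => fderiv ℝ u (x + τ x • z) ∘L A x z) (unitAvg n) := by
    refine Integrable.of_bound (hcF x).aestronglyMeasurable (M * 2) ?_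
    filter_upwards [ae_unitAvg_norm_lt] with z hz
    refine (ContinuousLinearMap.opNorm_comp_le _ _).trans ?_
    refine mul_le_mul (hM _) ?_ (norm_nonneg _) hM0
    refine (norm_add_le _ _).trans ?_
    rw [ContinuousLinearMap.norm_smulRight_apply, innerSL_apply_norm]
    have h1 := ContinuousLinearMap.norm_id_le (𝕜 := ℝ) (E := Vec n)
    have h2 := hτ.norm_gradient_le x
    have h3 := hτ.le_half
    nlinarith [norm_nonneg (gradient τ x), norm_nonneg z]
  rw [jacobian_eq_toMat]
  have e : avg τ u = fun y => ∫ z, u (y + τ y • z) ∂(unitAvg n) := rfl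
  rw [e, key.fderiv, ← toMat.integral_comp_comm hint, avgGrad]
  congr 1; ext1 z
  exact toMat_comp_shear _ z _

lemma stronglyMeasurable_avg (hτ : Continuous τ) {u : Vec n → Vec N} (hu : StronglyMeasurable u) :
    StronglyMeasurable (avg τ u) := by
  have hm : Measurable fun p : Vec n × Vec n => p.1 + τ p.1 • p.2 := by fun_prop
  exact (hu.comp_measurable hm).integral_prod_right'

lemma stronglyMeasurable_avgGrad (hτ : IsRadius x₀ R R' l τ) {Du : Vec n → Mat N n}
    (hu : StronglyMeasurable Du) : StronglyMeasurable (avgGrad τ Du) := by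
  have hc := hτ.contDiff.continuous
  have hg := hτ.continuous_gradient
  have hm : Measurable fun p : Vec n × Vec n => p.1 + τ p.1 • p.2 := by fun_prop
  have h2 : StronglyMeasurable fun p : Vec n × Vec n =>
      shear (Du (p.1 + τ p.1 • p.2)) p.2 (gradient τ p.1) :=
    continuous_shear.comp_stronglyMeasurable ((hu.comp_measurable hm).prodMk
      (measurable_snd.stronglyMeasurable.prodMk (hg.stronglyMeasurable.comp_measurable measurable_fst)))
  exact h2.integral_prod_right'

lemma enorm_avg_sub_le {u w : Vec n → Vec N} (x : Vec n)
    (hu : Integrable (fun z => u (x + τ x • z)) (unitAvg n))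
    (hw : Integrable (fun z => w (x + τ x • z)) (unitAvg n)) :
    ‖avg τ u x - avg τ w x‖ₑ ≤ ∫⁻ z, ‖u (x + τ x • z) - w (x + τ x • z)‖ₑ ∂(unitAvg n) := by
  rw [avg, avg, ← integral_sub hu hw]
  exact enorm_integral_le_lintegral_enorm _

lemma enorm_shear_le (hτ : IsRadius x₀ R R' l τ) (x : Vec n) {z : Vec n} (hz : ‖z‖ < 1) (Z : Mat N n) :
    ‖shear Z z (gradient τ x)‖ₑ ≤ 2 * ‖Z‖ₑ := by
  have h2 : (2 : ENNReal) * ‖Z‖ₑ = ENNReal.ofReal (2 * ‖Z‖) := by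
    rw [ENNReal.ofReal_mul (by norm_num), ofReal_norm]; simp
  rw [h2, ← ofReal_norm]
  refine ENNReal.ofReal_le_ofReal ((norm_shear_le _ _ _).trans ?_)
  rw [mul_comm]
  gcongr
  have h2 := hτ.norm_gradient_le x
  have h3 := hτ.le_half
  nlinarith [norm_nonneg (gradient τ x), norm_nonneg z]

lemma integrable_shear (hτ : IsRadius x₀ R R' l τ) (x : Vec n) {D : Vec n → Mat N n}
    (hD : Integrable D (unitAvg n)) :
    Integrable (fun z => shear (D z) z (gradient τ x)) (unitAvg n) := by
  refine (hD.norm.const_mul 2).mono' ?_ ?_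
  · exact continuous_shear.comp_aestronglyMeasurable
      (hD.1.prodMk (continuous_id.aestronglyMeasurable.prodMk aestronglyMeasurable_const))
  · filter_upwards [ae_unitAvg_norm_lt] with z hz
    refine (norm_shear_le _ _ _).trans ?_
    rw [mul_comm]
    gcongr
    have h2 := hτ.norm_gradient_le x
    have h3 := hτ.le_half
    nlinarith [norm_nonneg (gradient τ x), norm_nonneg z]

lemma enorm_avgGrad_sub_le (hτ : IsRadius x₀ R R' l τ) {D E : Vec n → Mat N n} (x : Vec n)
    (hD : Integrable (fun z => D (x + τ x • z)) (unitAvg n))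
    (hE : Integrable (fun z => E (x + τ x • z)) (unitAvg n)) :
    ‖avgGrad τ D x - avgGrad τ E x‖ₑ ≤
      2 * ∫⁻ z, ‖D (x + τ x • z) - E (x + τ x • z)‖ₑ ∂(unitAvg n) := by
  rw [avgGrad, avgGrad, ← integral_sub (integrable_shear hτ x hD) (integrable_shear hτ x hE),
    ← lintegral_const_mul' _ _ (by norm_num)]
  refine (enorm_integral_le_lintegral_enorm _).trans (lintegral_mono_ae ?_)
  filter_upwards [ae_unitAvg_norm_lt] with z hz
  have := (shearL z (gradient τ x)).map_sub (D (x + τ x • z)) (E (x + τ x • z))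
  simp only [shearL_apply] at this
  rw [← this]
  exact enorm_shear_le hτ x hz _

/-- Averaging is bounded on L¹ of the ball, by the change of variables bound with factor 2. -/
lemma tendsto_avg (hτ : IsRadius x₀ R R' l τ) {U : ℕ → Vec n → Vec N} {u : Vec n → Vec N}
    (hU : ∀ k, Continuous (U k)) (hu : StronglyMeasurable u) (hui : IntegrableOn u (Metric.ball x₀ R))
    (hUi : ∀ k, IntegrableOn (U k) (Metric.ball x₀ R))
    (h : Tendsto (fun k => ∫⁻ x in Metric.ball x₀ R, ‖U k x - u x‖ₑ) atTop (𝓝 0)) :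
    Tendsto (fun k => ∫⁻ x in Metric.ball x₀ R, ‖avg τ (U k) x - avg τ u x‖ₑ) atTop (𝓝 0) := by
  have h2 := ENNReal.Tendsto.const_mul (a := 2) h (Or.inr (by norm_num))
  rw [mul_zero] at h2
  refine tendsto_of_tendsto_of_tendsto_of_le_of_le tendsto_const_nhds h2 (fun _ => zero_le) fun k => ?_
  refine le_trans (lintegral_mono fun x => enorm_avg_sub_le x (hτ.integrable_add x (hUi k))
    (hτ.integrable_add x hui)) ?_
  exact hτ.lintegral_avg_le_two (h := fun y => ‖U k y - u y‖ₑ)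
    ((hU k).stronglyMeasurable.sub hu).enorm

lemma tendsto_avgGrad (hτ : IsRadius x₀ R R' l τ) {D : ℕ → Vec n → Mat N n} {E : Vec n → Mat N n}
    (hD : ∀ k, Continuous (D k)) (hE : StronglyMeasurable E) (hEi : IntegrableOn E (Metric.ball x₀ R))
    (hDi : ∀ k, IntegrableOn (D k) (Metric.ball x₀ R))
    (h : Tendsto (fun k => ∫⁻ x in Metric.ball x₀ R, ‖D k x - E x‖ₑ) atTop (𝓝 0)) :
    Tendsto (fun k => ∫⁻ x in Metric.ball x₀ R, ‖avgGrad τ (D k) x - avgGrad τ E x‖ₑ) atTop (𝓝 0) := by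
  have h2 := ENNReal.Tendsto.const_mul (a := 4) h (Or.inr (by norm_num))
  rw [mul_zero] at h2
  refine tendsto_of_tendsto_of_tendsto_of_le_of_le tendsto_const_nhds h2 (fun _ => zero_le) fun k => ?_
  refine le_trans (lintegral_mono fun x => enorm_avgGrad_sub_le hτ x (hτ.integrable_add x (hDi k))
    (hτ.integrable_add x hEi)) ?_
  rw [lintegral_const_mul' _ _ (by norm_num)]
  refine (mul_le_mul_right (hτ.lintegral_avg_le_two (h := fun y => ‖D k y - E y‖ₑ)
    ((hD k).stronglyMeasurable.sub hE).enorm) 2).trans_eq ?_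
  rw [← mul_assoc]; norm_num

lemma integrableOn_avg (hτ : IsRadius x₀ R R' l τ) {u : Vec n → Vec N} (hu : StronglyMeasurable u)
    (hui : IntegrableOn u (Metric.ball x₀ R)) : IntegrableOn (avg τ u) (Metric.ball x₀ R) := by
  refine ⟨(stronglyMeasurable_avg hτ.contDiff.continuous hu).aestronglyMeasurable, ?_⟩
  refine lt_of_le_of_lt (lintegral_mono fun x => enorm_integral_le_lintegral_enorm _) ?_
  refine (hτ.lintegral_avg_le_two (h := fun y => ‖u y‖ₑ) hu.enorm).trans_lt ?_
  exact ENNReal.mul_lt_top (by norm_num) hui.2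

lemma integrableOn_avgGrad (hτ : IsRadius x₀ R R' l τ) {D : Vec n → Mat N n} (hD : StronglyMeasurable D)
    (hDi : IntegrableOn D (Metric.ball x₀ R)) : IntegrableOn (avgGrad τ D) (Metric.ball x₀ R) := by
  refine ⟨(stronglyMeasurable_avgGrad hτ hD).aestronglyMeasurable, ?_⟩
  refine lt_of_le_of_lt (lintegral_mono fun x => (enorm_integral_le_lintegral_enorm _).trans
    (lintegral_mono_ae (g := fun z => 2 * ‖D (x + τ x • z)‖ₑ) ?_)) ?_
  · filter_upwards [ae_unitAvg_norm_lt] with z hz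
    exact enorm_shear_le hτ x hz _
  · simp_rw [lintegral_const_mul' _ _ (by norm_num : (2 : ENNReal) ≠ ⊤)]
    refine ENNReal.mul_lt_top (by norm_num) ?_
    refine (hτ.lintegral_avg_le_two (h := fun y => ‖D y‖ₑ) hD.enorm).trans_lt ?_
    exact ENNReal.mul_lt_top (by norm_num) hDi.2

end AveragedMaps

/-! ### The Poincaré inequality on balls -/

section Poincare

variable {N n : ℕ}

lemma lintegral_rpow_le {α : Type*} [MeasurableSpace α] {μ : Measure α} [IsProbabilityMeasure μ]
    {h : α → ENNReal} (hh : AEMeasurable h μ) {s t : ℝ} (hs : 0 < s) (hst : s ≤ t) :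
    (∫⁻ x, h x ^ s ∂μ) ^ (1 / s) ≤ (∫⁻ x, h x ^ t ∂μ) ^ (1 / t) := by
  have := eLpNorm'_le_eLpNorm'_of_exponent_le hs hst μ hh.aestronglyMeasurable
  simpa [eLpNorm'] using this

lemma lintegral_sq_le {α : Type*} [MeasurableSpace α] {μ : Measure α} [IsProbabilityMeasure μ]
    {h : α → ENNReal} (hh : AEMeasurable h μ) : (∫⁻ x, h x ∂μ) ^ 2 ≤ ∫⁻ x, h x ^ 2 ∂μ := by
  have h1 := lintegral_rpow_le hh one_pos (one_le_two (α := ℝ))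
  simp only [ENNReal.rpow_one, div_one, one_div] at h1
  calc (∫⁻ x, h x ∂μ) ^ 2 ≤ ((∫⁻ x, h x ^ (2:ℝ) ∂μ) ^ (2⁻¹:ℝ)) ^ 2 := by gcongr
    _ = ∫⁻ x, h x ^ (2:ℝ) ∂μ := by
      rw [← ENNReal.rpow_natCast, ← ENNReal.rpow_mul]; norm_num
    _ = _ := by norm_cast

/-- Fundamental theorem of calculus on the segment and Cauchy–Schwarz; 4 bounds |z - z'|². -/
lemma enorm_sub_sq_le {g : Vec n → Vec N} (hg : ContDiff ℝ 1 g) {z z' : Vec n} (hz : ‖z‖ < 1)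
    (hz' : ‖z'‖ < 1) :
    ‖g z - g z'‖ₑ ^ 2 ≤ 4 * ∫⁻ s in Icc (0:ℝ) 1, ‖fderiv ℝ g (z' + s • (z - z'))‖ₑ ^ 2 := by
  have : IsProbabilityMeasure (volume.restrict (Icc (0:ℝ) 1)) := ⟨by simp⟩
  have hc : Continuous fun s : ℝ => fderiv ℝ g (z' + s • (z - z')) :=
    (hg.continuous_fderiv one_ne_zero).comp (by fun_prop)
  have hd : ∀ s : ℝ, HasDerivAt (fun s : ℝ => g (z' + s • (z - z')))
      (fderiv ℝ g (z' + s • (z - z')) (z - z')) s := fun s => by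
    have h2 : HasDerivAt (fun s : ℝ => z' + s • (z - z')) (z - z') s := by
      simpa using ((hasDerivAt_id s).smul_const (z - z')).const_add z'
    exact (hg.differentiable one_ne_zero _).hasFDerivAt.comp_hasDerivAt s h2
  have ftc := intervalIntegral.integral_eq_sub_of_hasDerivAt (a := 0) (b := 1) (fun s _ => hd s)
    ((hc.clm_apply continuous_const).intervalIntegrable _ _)
  simp only [one_smul, zero_smul, add_zero, add_sub_cancel] at ftc
  rw [intervalIntegral.integral_of_le zero_le_one, ← integral_Icc_eq_integral_Ioc] at ftc
  have h1 : ‖g z - g z'‖ₑ ≤ 2 * ∫⁻ s in Icc (0:ℝ) 1, ‖fderiv ℝ g (z' + s • (z - z'))‖ₑ := by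
    rw [← ftc, ← lintegral_const_mul' _ _ (by norm_num)]
    refine (enorm_integral_le_lintegral_enorm _).trans (lintegral_mono fun s => ?_)
    refine (ContinuousLinearMap.le_opENorm _ _).trans ?_
    rw [mul_comm]
    gcongr
    have : ‖z - z'‖ ≤ 2 := (norm_sub_le _ _).trans (by linarith)
    rw [← ofReal_norm]
    calc ENNReal.ofReal ‖z - z'‖ ≤ ENNReal.ofReal 2 := ENNReal.ofReal_le_ofReal this
      _ = 2 := by simp
  calc ‖g z - g z'‖ₑ ^ 2 ≤ (2 * ∫⁻ s in Icc (0:ℝ) 1, ‖fderiv ℝ g (z' + s • (z - z'))‖ₑ) ^ 2 := by gcongr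
    _ = 4 * (∫⁻ s in Icc (0:ℝ) 1, ‖fderiv ℝ g (z' + s • (z - z'))‖ₑ) ^ 2 := by
      rw [mul_pow]; norm_num
    _ ≤ _ := by
      gcongr
      exact lintegral_sq_le hc.enorm.measurable.aemeasurable

/-- For fixed z' the point (1-s)z' + sz runs over a ball of radius s inside the unit ball, so the
substitution costs s^(-n) ≤ 2^n. -/
lemma lintegral_segment_le {H : Vec n → ENNReal} {s : ℝ} (hs : 1 / 2 ≤ s) (hs1 : s ≤ 1)
    {z' : Vec n} (hz' : ‖z'‖ < 1) :
    ∫⁻ z, H ((1 - s) • z' + s • z) ∂(unitAvg n) ≤ 2 ^ n * ∫⁻ z, H z ∂(unitAvg n) := by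
  have hs0 : 0 < s := by linarith
  have hsub : Metric.ball ((1 - s) • z') s ⊆ Metric.ball 0 1 := by
    refine Metric.ball_subset_ball' ?_
    rw [dist_zero_right, norm_smul, Real.norm_of_nonneg (by linarith)]
    nlinarith [norm_nonneg z']
  refine (lintegral_unitAvg_le _ hs0 hsub H).trans ?_
  rw [unitAvg, lintegral_smul_measure, smul_eq_mul, mul_comm _ (ENNReal.ofReal _), mul_assoc]
  gcongr
  have : ((2:ENNReal)) ^ n = ENNReal.ofReal (2 ^ n) := by
    rw [ENNReal.ofReal_pow (by norm_num)]; simp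
  rw [this]
  refine ENNReal.ofReal_le_ofReal ?_
  rw [← inv_pow]
  gcongr
  rw [inv_le_comm₀ hs0 (by norm_num)]
  linarith

/-- Integrate the segment estimate in both endpoints. For s ≥ 1/2 substitute in z and for s ≤ 1/2 in
z', so that the coefficient of the substituted variable is never below 1/2. -/
lemma poincare_smooth {g : Vec n → Vec N} (hg : ContDiff ℝ 1 g) :
    ∫⁻ z', ∫⁻ z, ‖g z - g z'‖ₑ ^ 2 ∂(unitAvg n) ∂(unitAvg n) ≤
      4 * (2 ^ n * ∫⁻ z, ‖fderiv ℝ g z‖ₑ ^ 2 ∂(unitAvg n)) := by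
  have : IsProbabilityMeasure (volume.restrict (Icc (0:ℝ) 1)) := ⟨by simp⟩
  set H : Vec n → ENNReal := fun z => ‖fderiv ℝ g z‖ₑ ^ 2 with hH
  have hHm : Measurable H := (hg.continuous_fderiv one_ne_zero).enorm.measurable.pow_const 2
  have hm1 : Measurable fun p : (Vec n × Vec n) × ℝ => H (p.1.1 + p.2 • (p.1.2 - p.1.1)) :=
    hHm.comp (by fun_prop)
  calc ∫⁻ z', ∫⁻ z, ‖g z - g z'‖ₑ ^ 2 ∂(unitAvg n) ∂(unitAvg n)
      ≤ ∫⁻ z', ∫⁻ z, 4 * (∫⁻ s in Icc (0:ℝ) 1, H (z' + s • (z - z'))) ∂(unitAvg n) ∂(unitAvg n) := by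
        refine lintegral_mono_ae ?_
        filter_upwards [ae_unitAvg_norm_lt] with z' hz'
        refine lintegral_mono_ae ?_
        filter_upwards [ae_unitAvg_norm_lt] with z hz
        exact enorm_sub_sq_le hg hz hz'
    _ = 4 * ∫⁻ z', ∫⁻ z, (∫⁻ s in Icc (0:ℝ) 1, H (z' + s • (z - z'))) ∂(unitAvg n) ∂(unitAvg n) := by
        simp_rw [lintegral_const_mul' _ _ (by norm_num : (4 : ENNReal) ≠ ⊤)]
    _ = 4 * ∫⁻ s in Icc (0:ℝ) 1, ∫⁻ z', ∫⁻ z, H (z' + s • (z - z')) ∂(unitAvg n) ∂(unitAvg n) := by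
        congr 1
        have e1 : ∀ z', ∫⁻ z, (∫⁻ s in Icc (0:ℝ) 1, H (z' + s • (z - z'))) ∂(unitAvg n) =
            ∫⁻ s in Icc (0:ℝ) 1, ∫⁻ z, H (z' + s • (z - z')) ∂(unitAvg n) := fun z' =>
          lintegral_lintegral_swap (f := fun z s => H (z' + s • (z - z')))
            (hm1.comp (f := fun q : Vec n × ℝ => ((z', q.1), q.2)) (by fun_prop)).aemeasurable
        simp_rw [e1]
        refine lintegral_lintegral_swap (f := fun z' (s : ℝ) => ∫⁻ z, H (z' + s • (z - z')) ∂(unitAvg n)) ?_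
        have : Measurable fun q : (Vec n × ℝ) × Vec n => H (q.1.1 + q.1.2 • (q.2 - q.1.1)) :=
          hHm.comp (by fun_prop)
        exact this.lintegral_prod_right'.aemeasurable
    _ ≤ 4 * ∫⁻ s in Icc (0:ℝ) 1, 2 ^ n * ∫⁻ z, H z ∂(unitAvg n) := by
        gcongr 4 * ?_
        refine setLIntegral_mono_ae' measurableSet_Icc (Eventually.of_forall fun s hs => ?_)
        have bound : ∀ c : ENNReal, ∫⁻ _ : Vec n, c ∂(unitAvg n) = c := fun c => by simp
        rw [← bound (2 ^ n * _)]
        rcases le_total (1 / 2) s with h | h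
        · refine lintegral_mono_ae ?_
          filter_upwards [ae_unitAvg_norm_lt] with z' hz'
          refine le_trans (le_of_eq ?_) (lintegral_segment_le h hs.2 hz')
          refine lintegral_congr fun z => ?_
          congr 1; module
        · rw [lintegral_lintegral_swap (f := fun z' z => H (z' + s • (z - z')))
            (hm1.comp (f := fun q : Vec n × Vec n => (q, s)) (by fun_prop)).aemeasurable]
          refine lintegral_mono_ae ?_
          filter_upwards [ae_unitAvg_norm_lt] with z hz
          refine le_trans (le_of_eq ?_) (lintegral_segment_le (s := 1 - s)
            (by linarith) (by linarith [hs.1]) hz)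
          refine lintegral_congr fun z => ?_
          congr 1; module
    _ = _ := by simp

/-- The Poincaré inequality in `L²` for weakly differentiable maps. -/
lemma IsSmoothApprox.poincare {B : Set (Vec n)} {u : Vec n → Vec N} {Du : Vec n → Mat N n}
    {U : ℕ → Vec n → Vec N} {h : ℕ → Vec n → ℝ} (ha : IsSmoothApprox B u Du U h)
    (hDu : StronglyMeasurable Du)
    {x : Vec n} {r : ℝ} (hr : 0 < r) (hB : Metric.ball x r ⊆ B) :
    ∫⁻ z', ∫⁻ z, ‖u (x + r • z) - u (x + r • z')‖ₑ ^ 2 ∂(unitAvg n) ∂(unitAvg n) ≤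
      ENNReal.ofReal (2 ^ (n + 2) * r ^ 2) * ∫⁻ z, ‖Du (x + r • z)‖ₑ ^ 2 ∂(unitAvg n) := by
  have hconv := ae_unitAvg_of_ae x hr hB ha.ae_tendsto
  have step : ∀ k, ∫⁻ z', ∫⁻ z, ‖U k (x + r • z) - U k (x + r • z')‖ₑ ^ 2 ∂(unitAvg n) ∂(unitAvg n) ≤
      ENNReal.ofReal (2 ^ (n + 2) * r ^ 2) * (∫⁻ z, ‖Du (x + r • z)‖ₑ ^ 2 ∂(unitAvg n) +
        ∫⁻ z, ‖h k (x + r • z) - ‖Du (x + r • z)‖ ^ 2‖ₑ ∂(unitAvg n)) := by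
    intro k
    have hUk : ContDiff ℝ 1 (U k) := (ha.contDiff k).of_le (by simp)
    have hg : ContDiff ℝ 1 fun z => U k (x + r • z) :=
      hUk.comp (contDiff_const.add (contDiff_id.const_smul r))
    have hfd : ∀ z, fderiv ℝ (fun z => U k (x + r • z)) z = r • fderiv ℝ (U k) (x + r • z) := by
      intro z
      have h1 : HasFDerivAt (fun z : Vec n => x + r • z) (r • ContinuousLinearMap.id ℝ (Vec n)) z :=
        ((hasFDerivAt_id z).const_smul r).const_add x
      have h2 := (hUk.differentiable one_ne_zero (x + r • z)).hasFDerivAt.comp z h1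
      refine h2.fderiv.trans ?_
      ext v; simp
    refine (poincare_smooth hg).trans ?_
    have e4 : ENNReal.ofReal (2 ^ (n + 2) * r ^ 2) = 4 * (2 ^ n * ENNReal.ofReal (r ^ 2)) := by
      rw [ENNReal.ofReal_mul (by positivity), ENNReal.ofReal_pow (by norm_num), pow_add]
      simp only [ENNReal.ofReal_ofNat]
      norm_num; ring
    rw [e4, mul_assoc, mul_assoc]
    gcongr
    have hm2 : AEMeasurable (fun z => ‖Du (x + r • z)‖ₑ ^ 2) (unitAvg n) :=
      ((hDu.comp_measurable (by fun_prop : Measurable fun z : Vec n => x + r • z)).enorm.pow_const 2).aemeasurable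
    rw [← lintegral_add_left' hm2, ← lintegral_const_mul' _ _ ENNReal.ofReal_ne_top]
    refine lintegral_mono_ae ?_
    filter_upwards [ae_unitAvg_norm_lt] with z hz
    have hxz : x + r • z ∈ B := hB (by
      rw [Metric.mem_ball, dist_eq_norm, add_sub_cancel_left, norm_smul, Real.norm_of_nonneg hr.le]
      nlinarith)
    have h3 := ha.sq_le k _ hxz
    rw [hfd, enorm_smul, mul_pow]
    have e5 : ‖r‖ₑ ^ 2 = ENNReal.ofReal (r ^ 2) := by
      rw [Real.enorm_of_nonneg hr.le, ENNReal.ofReal_pow hr.le]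
    rw [e5]
    gcongr
    rw [← ofReal_norm, ← ofReal_norm, ← ofReal_norm, ← ENNReal.ofReal_pow (norm_nonneg _),
      ← ENNReal.ofReal_pow (norm_nonneg _), ← ENNReal.ofReal_add (by positivity) (norm_nonneg _)]
    refine ENNReal.ofReal_le_ofReal ?_
    have h4 : ‖fderiv ℝ (U k) (x + r • z)‖ ^ 2 ≤ ‖jacobian (U k) (x + r • z)‖ ^ 2 := by
      gcongr; exact norm_le_norm_toMat _
    have h5 := le_abs_self (h k (x + r • z) - ‖Du (x + r • z)‖ ^ 2)
    rw [Real.norm_eq_abs]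
    linarith
  have hlim : Tendsto (fun k => ENNReal.ofReal (2 ^ (n + 2) * r ^ 2) *
      (∫⁻ z, ‖Du (x + r • z)‖ₑ ^ 2 ∂(unitAvg n) +
        ∫⁻ z, ‖h k (x + r • z) - ‖Du (x + r • z)‖ ^ 2‖ₑ ∂(unitAvg n))) atTop
      (𝓝 (ENNReal.ofReal (2 ^ (n + 2) * r ^ 2) * (∫⁻ z, ‖Du (x + r • z)‖ₑ ^ 2 ∂(unitAvg n) + 0))) := by
    refine ENNReal.Tendsto.const_mul ?_ (Or.inr ENNReal.ofReal_ne_top)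
    refine Tendsto.add tendsto_const_nhds ?_
    have h2 := ENNReal.Tendsto.const_mul (a := (volume (Metric.ball (0 : Vec n) 1))⁻¹ *
      ENNReal.ofReal ((r ^ n)⁻¹)) ha.tendsto_sq (Or.inr (ENNReal.mul_ne_top
      (ENNReal.inv_ne_top.2 volume_unitBall_ne_zero) ENNReal.ofReal_ne_top))
    rw [mul_zero] at h2
    exact tendsto_of_tendsto_of_tendsto_of_le_of_le tendsto_const_nhds h2 (fun _ => zero_le)
      fun k => lintegral_unitAvg_le x hr hB (fun y => ‖h k y - ‖Du y‖ ^ 2‖ₑ)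
  rw [add_zero] at hlim
  have hmU : ∀ k, Measurable fun p : Vec n × Vec n => ‖U k (x + r • p.2) - U k (x + r • p.1)‖ₑ ^ 2 :=
    fun k => by
      have hc := (ha.contDiff k).continuous
      have : Continuous fun p : Vec n × Vec n => U k (x + r • p.2) - U k (x + r • p.1) := by fun_prop
      exact this.enorm.measurable.pow_const 2
  -- Fatou's lemma, applied in each variable, passes the smooth inequality to the limit; on the
  -- right only the L¹ convergence of the majorants of |∇U_k|² is used.
  calc ∫⁻ z', ∫⁻ z, ‖u (x + r • z) - u (x + r • z')‖ₑ ^ 2 ∂(unitAvg n) ∂(unitAvg n)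
      = ∫⁻ z', ∫⁻ z, liminf (fun k => ‖U k (x + r • z) - U k (x + r • z')‖ₑ ^ 2) atTop
          ∂(unitAvg n) ∂(unitAvg n) := by
        refine lintegral_congr_ae ?_
        filter_upwards [hconv] with z' hz'
        refine lintegral_congr_ae ?_
        filter_upwards [hconv] with z hz
        exact (((ENNReal.continuous_pow 2).tendsto _).comp (hz.sub hz').enorm).liminf_eq.symm
    _ ≤ ∫⁻ z', liminf (fun k => ∫⁻ z, ‖U k (x + r • z) - U k (x + r • z')‖ₑ ^ 2 ∂(unitAvg n)) atTop
          ∂(unitAvg n) := by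
        refine lintegral_mono fun z' => lintegral_liminf_le fun k => ?_
        exact (hmU k).comp (f := fun z => (z', z)) (by fun_prop)
    _ ≤ liminf (fun k => ∫⁻ z', ∫⁻ z, ‖U k (x + r • z) - U k (x + r • z')‖ₑ ^ 2
          ∂(unitAvg n) ∂(unitAvg n)) atTop :=
        lintegral_liminf_le fun k => (hmU k).lintegral_prod_right'
    _ ≤ liminf (fun k => ENNReal.ofReal (2 ^ (n + 2) * r ^ 2) *
      (∫⁻ z, ‖Du (x + r • z)‖ₑ ^ 2 ∂(unitAvg n) +
        ∫⁻ z, ‖h k (x + r • z) - ‖Du (x + r • z)‖ ^ 2‖ₑ ∂(unitAvg n))) atTop :=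
        liminf_le_liminf (Eventually.of_forall step)
    _ = _ := hlim.liminf_eq

end Poincare

/-! ### Sphere-valued competitors -/

section Competitor

variable {N n : ℕ}

lemma tendstoInMeasure_of_lintegral {B : Set (Vec n)} {v : ℕ → Vec n → Vec N} {w : Vec n → Vec N}
    (hv : ∀ k, AEStronglyMeasurable (v k) (volume.restrict B))
    (hw : AEStronglyMeasurable w (volume.restrict B))
    (h : Tendsto (fun k => ∫⁻ x in B, ‖v k x - w x‖ₑ) atTop (𝓝 0)) :
    TendstoInMeasure (volume.restrict B) v atTop w := by
  refine tendstoInMeasure_of_tendsto_eLpNorm one_ne_zero hv hw ?_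
  simpa only [eLpNorm_one_eq_lintegral_enorm, Pi.sub_apply] using h

lemma tendsto_lintegral_of_sub {G : Type*} [NormedAddCommGroup G] {μ : Measure (Vec n)}
    {a b c : ℕ → Vec n → G} {a₀ b₀ c₀ : Vec n → G}
    (ha : ∀ k, AEStronglyMeasurable (fun x => a k x - a₀ x) μ)
    (h₁ : Tendsto (fun k => ∫⁻ x, ‖a k x - a₀ x‖ₑ ∂μ) atTop (𝓝 0))
    (h₂ : Tendsto (fun k => ∫⁻ x, ‖b k x - b₀ x‖ₑ ∂μ) atTop (𝓝 0))
    (h : ∀ k, ∀ᵐ x ∂μ, c k x - c₀ x = (a k x - a₀ x) - (b k x - b₀ x)) :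
    Tendsto (fun k => ∫⁻ x, ‖c k x - c₀ x‖ₑ ∂μ) atTop (𝓝 0) := by
  have := h₁.add h₂
  rw [add_zero] at this
  refine tendsto_of_tendsto_of_tendsto_of_le_of_le tendsto_const_nhds this (fun _ => zero_le)
    fun k => ?_
  dsimp only
  rw [← lintegral_add_left' (ha k).enorm]
  refine lintegral_mono_ae ?_
  filter_upwards [h k] with x hx
  rw [hx]
  exact enorm_sub_le

variable {B : Set (Vec n)} {u : Vec n → Vec N} {Du : Vec n → Mat N n}
  {U : ℕ → Vec n → Vec N} {h : ℕ → Vec n → ℝ}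

lemma IsSmoothApprox.integrableOn (ha : IsSmoothApprox B u Du U h) (k : ℕ) :
    IntegrableOn (U k) B :=
  ((ha.contDiff k).continuous.integrable_of_hasCompactSupport (ha.hasCompactSupport k)).integrableOn

lemma IsSmoothApprox.continuous_jacobian (ha : IsSmoothApprox B u Du U h) (k : ℕ) :
    Continuous (jacobian (U k)) :=
  SphereMin.continuous_jacobian ((ha.contDiff k).of_le (by simp))

lemma IsSmoothApprox.integrableOn_jacobian (ha : IsSmoothApprox B u Du U h) (k : ℕ) :
    IntegrableOn (jacobian (U k)) B :=
  ((ha.continuous_jacobian k).integrable_of_hasCompactSupport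
    (((ha.hasCompactSupport k).fderiv ℝ).comp_left (g := toMat) (map_zero _))).integrableOn

lemma integrableOn_proj_comp (hB : volume B ≠ ⊤) {v : Vec n → Vec N}
    (hv : AEStronglyMeasurable v (volume.restrict B)) :
    IntegrableOn (fun x => proj (v x)) B := by
  obtain ⟨M, hM⟩ := (hasCompactSupport_proj (N := N)).exists_bound_of_continuous
    contDiff_proj.continuous
  have : IsFiniteMeasure (volume.restrict B) := ⟨by simpa using hB.lt_top⟩
  exact Integrable.of_bound (contDiff_proj.continuous.comp_aestronglyMeasurable hv) M
    (Eventually.of_forall fun x => hM _)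

lemma integrableOn_lmul_proj {v : Vec n → Vec N} (hv : AEStronglyMeasurable v (volume.restrict B))
    {D : Vec n → Mat N n} (hD : IntegrableOn D B) :
    IntegrableOn (fun x => lmul (fderiv ℝ proj (v x)) (D x)) B := by
  obtain ⟨K, hK⟩ := exists_bound_fderiv_proj N
  refine (hD.norm.const_mul (K : ℝ)).mono' ?_ (Eventually.of_forall fun x => ?_)
  · exact (lmulL (N := N) (n := n)).aestronglyMeasurable_comp₂
      ((contDiff_proj.continuous_fderiv (by simp)).comp_aestronglyMeasurable hv) hD.1
  · exact (norm_lmul_le _ _).trans (by gcongr; exact hK _)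

lemma jacobian_proj_comp {v : Vec n → Vec N} (hv : ContDiff ℝ 1 v) (x : Vec n) :
    jacobian (fun x => proj (v x)) x = lmul (fderiv ℝ proj (v x)) (jacobian v x) := by
  rw [jacobian_eq_toMat, jacobian_eq_toMat, ← toMat_comp_left]
  congr 1
  exact fderiv_comp x (contDiff_proj.differentiable (by simp) _) (hv.differentiable one_ne_zero _)

/-- A sphere-valued weakly differentiable map is orthogonal to its derivative. -/
lemma IsSmoothApprox.coact_eq_zero (ha : IsSmoothApprox B u Du U h) (hB : IsOpen B)
    (hBt : volume B ≠ ⊤) (hu : IntegrableOn u B) (hDu : IntegrableOn Du B)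
    (hs : ∀ᵐ x ∂(volume.restrict B), ‖u x‖ = 1) :
    ∀ᵐ x ∂(volume.restrict B), coact (u x) (Du x) = 0 := by
  obtain ⟨K, hK⟩ := exists_bound_fderiv_proj N
  have hU1 : ∀ k, ContDiff ℝ 1 (U k) := fun k => (ha.contDiff k).of_le (by simp)
  have hp1 : ContDiff ℝ 1 (proj (N := N)) := contDiff_proj.of_le (by simp)
  obtain ⟨t1, t2⟩ := tendsto_comp_of_tendsto hp1 hK hU1 hu hDu ha.ae_tendsto ha.tendsto ha.tendsto_grad
  have t1' : Tendsto (fun k => ∫⁻ x in B, ‖proj (U k x) - u x‖ₑ) atTop (𝓝 0) := by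
    refine t1.congr fun k => lintegral_congr_ae ?_
    filter_upwards [hs] with x hx
    rw [proj_eq (y := u x) (by rw [hx]; norm_num) (by rw [hx]; norm_num), hx]
    simp
  -- Since proj(u) = u a.e., both Du and d proj(u) Du are weak gradients of u. Uniqueness makes them
  -- equal, and their difference is exactly the normal part.
  have w1 := isWeakGradient_of_tendsto hU1 ha.integrableOn ha.integrableOn_jacobian hu hDu
    ha.tendsto ha.tendsto_grad
  have i2 := integrableOn_lmul_proj hu.1 hDu
  have w2 := isWeakGradient_of_tendsto (fun k => hp1.comp (hU1 k))
    (fun k => integrableOn_proj_comp hBt (ha.contDiff k).continuous.aestronglyMeasurable)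
    (fun k => by
      refine (integrableOn_lmul_proj (ha.contDiff k).continuous.aestronglyMeasurable
        (ha.integrableOn_jacobian k)).congr ?_
      exact Eventually.of_forall fun x => (jacobian_proj_comp (hU1 k) x).symm) hu i2 t1' t2
  filter_upwards [hs, w1.ae_eq hB w2 hDu i2] with x hx he
  rw [lmul_fderiv_proj (by rw [hx]; norm_num) (by rw [hx]; norm_num), hx] at he
  have h0 : tens (u x) (coact (u x) (Du x)) = 0 := by
    simp only [inv_one, one_pow, one_smul] at he
    exact sub_eq_self.1 he.symm
  have h1 := norm_tens (u x) (coact (u x) (Du x))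
  rw [h0, hx, norm_zero, one_mul] at h1
  exact norm_eq_zero.1 h1.symm

lemma lmul_fderiv_proj_of_coact_eq_zero {y : Vec N} (hy : ‖y‖ = 1) {Z : Mat N n}
    (hZ : coact y Z = 0) : lmul (fderiv ℝ proj y) Z = Z := by
  rw [lmul_fderiv_proj (by rw [hy]; norm_num) (by rw [hy]; norm_num), hy, hZ]
  have : tens y (0 : Vec n) = 0 := by ext ij; simp [tens]
  simp [this]

variable {x₀ : Vec n} {R R' l : ℝ} {τ : Vec n → ℝ}

lemma ae_ae_unitAvg (hτ : IsRadius x₀ R R' l τ) {P : Vec n → Prop}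
    (hP : ∀ᵐ x ∂(volume.restrict (Metric.ball x₀ R)), P x) :
    ∀ᵐ x ∂(volume.restrict (Metric.ball x₀ R)), ∀ᵐ z ∂(unitAvg n), P (x + τ x • z) := by
  filter_upwards [hP] with x hx
  rcases (hτ.nonneg x).eq_or_lt with h0 | h0
  · rw [← h0]; simpa using hx
  · exact ae_unitAvg_of_ae x h0 (hτ.ball_subset x h0) hP

lemma ae_norm_avg_le (hτ : IsRadius x₀ R R' l τ)
    (hs : ∀ᵐ x ∂(volume.restrict (Metric.ball x₀ R)), ‖u x‖ = 1) :
    ∀ᵐ x ∂(volume.restrict (Metric.ball x₀ R)), ‖avg τ u x‖ ≤ 1 := by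
  filter_upwards [ae_ae_unitAvg hτ hs] with x hx
  refine (norm_integral_le_of_norm_le_const (hx.mono fun z hz => hz.le)).trans ?_
  simp

lemma memW1_one_iff {v : Vec n → Vec N} {Dv : Vec n → Mat N n} :
    MemW1 B 1 v Dv ↔ IsWeakGradient B v Dv ∧ IntegrableOn v B ∧ IntegrableOn Dv B := by
  constructor
  · rintro ⟨h1, h2, h3⟩
    rw [ENNReal.ofReal_one, memLp_one_iff_integrable] at h2 h3
    exact ⟨h1, h2, h3⟩
  · rintro ⟨h1, h2, h3⟩
    refine ⟨h1, ?_, ?_⟩ <;> rwa [ENNReal.ofReal_one, memLp_one_iff_integrable]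

/-- The projected average of a sphere-valued map, over balls whose radius vanishes near the
boundary, has the same boundary values. -/
lemma IsSmoothApprox.competitor (ha : IsSmoothApprox (Metric.ball x₀ R) u Du U h)
    (hτ : IsRadius x₀ R R' l τ) (hum : StronglyMeasurable u) (hDm : StronglyMeasurable Du)
    (hu : IntegrableOn u (Metric.ball x₀ R)) (hDu : IntegrableOn Du (Metric.ball x₀ R))
    (hs : ∀ᵐ x ∂(volume.restrict (Metric.ball x₀ R)), ‖u x‖ = 1)
    (hv : ∀ᵐ x ∂(volume.restrict (Metric.ball x₀ R)), 1 / 2 < ‖avg τ u x‖) :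
    MemW1Sphere (Metric.ball x₀ R) 1 (fun x => proj (avg τ u x))
      (fun x => lmul (fderiv ℝ proj (avg τ u x)) (avgGrad τ Du x)) ∧
    MemW1Zero (Metric.ball x₀ R) (fun x => proj (avg τ u x) - u x)
      (fun x => lmul (fderiv ℝ proj (avg τ u x)) (avgGrad τ Du x) - Du x) := by
  obtain ⟨K, hK⟩ := exists_bound_fderiv_proj N
  have hBt : volume (Metric.ball x₀ R) ≠ ⊤ := measure_ball_lt_top.ne
  have hp1 : ContDiff ℝ 1 (proj (N := N)) := contDiff_proj.of_le (by simp)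
  have hU1 : ∀ k, ContDiff ℝ 1 (U k) := fun k => (ha.contDiff k).of_le (by simp)
  have hV : ∀ k, ContDiff ℝ ∞ (avg τ (U k)) := fun k => contDiff_avg hτ.contDiff (ha.contDiff k)
  have hV1 : ∀ k, ContDiff ℝ 1 (avg τ (U k)) := fun k => (hV k).of_le (by simp)
  have hJ : ∀ k x, jacobian (avg τ (U k)) x = avgGrad τ (jacobian (U k)) x := fun k x =>
    jacobian_avg hτ (ha.contDiff k) (ha.hasCompactSupport k) x
  have tV := tendsto_avg hτ (fun k => (ha.contDiff k).continuous) hum hu ha.integrableOn ha.tendsto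
  have tJ := tendsto_avgGrad hτ ha.continuous_jacobian hDm hDu ha.integrableOn_jacobian ha.tendsto_grad
  simp_rw [← hJ] at tJ
  have iv := integrableOn_avg hτ hum hu
  have iDv := integrableOn_avgGrad hτ hDm hDu
  -- The chain rule needs a.e. convergence of the averages, which L¹ convergence supplies only along
  -- a subsequence.
  obtain ⟨ns, hns, hae⟩ := (tendstoInMeasure_of_lintegral
    (fun k => (hV k).continuous.aestronglyMeasurable) iv.1 tV).exists_seq_tendsto_ae
  have hns' := hns.tendsto_atTop
  obtain ⟨t1, t2⟩ := tendsto_comp_of_tendsto hp1 hK (fun k => hV1 (ns k)) iv iDv hae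
    (tV.comp hns') (tJ.comp hns')
  obtain ⟨s1, s2⟩ := tendsto_comp_of_tendsto hp1 hK (fun k => hU1 (ns k)) hu hDu
    (ha.ae_tendsto.mono fun x hx => hx.comp hns') (ha.tendsto.comp hns') (ha.tendsto_grad.comp hns')
  have iw := integrableOn_proj_comp hBt iv.1
  have iDw := integrableOn_lmul_proj iv.1 iDv
  have hcoact := ha.coact_eq_zero Metric.isOpen_ball hBt hu hDu hs
  have iVk : ∀ k, IntegrableOn (avg τ (U k)) (Metric.ball x₀ R) := fun k =>
    integrableOn_avg hτ (ha.contDiff k).continuous.stronglyMeasurable (ha.integrableOn k)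
  have iJk : ∀ k, IntegrableOn (jacobian (avg τ (U k))) (Metric.ball x₀ R) := fun k => by
    simp_rw [funext (hJ k)]
    exact integrableOn_avgGrad hτ (ha.continuous_jacobian k).stronglyMeasurable
      (ha.integrableOn_jacobian k)
  have iP : ∀ {v : Vec n → Vec N}, ContDiff ℝ 1 v → IntegrableOn (jacobian v) (Metric.ball x₀ R) →
      IntegrableOn (jacobian fun x => proj (v x)) (Metric.ball x₀ R) := fun {v} hv hi =>
    (integrableOn_lmul_proj hv.continuous.aestronglyMeasurable hi).congr
      (Eventually.of_forall fun x => (jacobian_proj_comp hv x).symm)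
  have wg := isWeakGradient_of_tendsto (fun k => hp1.comp (hV1 (ns k)))
    (fun k => integrableOn_proj_comp hBt (hV (ns k)).continuous.aestronglyMeasurable)
    (fun k => iP (hV1 _) (iJk _)) iw iDw t1 t2
  have hmw : MemW1 (Metric.ball x₀ R) 1 (fun x => proj (avg τ u x))
      (fun x => lmul (fderiv ℝ proj (avg τ u x)) (avgGrad τ Du x)) := memW1_one_iff.2 ⟨wg, iw, iDw⟩
  -- Test maps for zero boundary values. Where τ = 0 the average of U_k is U_k itself, so the
  -- difference is supported in the support of τ, compactly inside the ball. The limit is the right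
  -- one because proj(u) = u and d proj(u)Du = Du.
  let φ : ℕ → Vec n → Vec N := fun k x => proj (avg τ (U (ns k)) x) - proj (U (ns k) x)
  have hφ : ∀ k, ContDiff ℝ ∞ (φ k) := fun k =>
    (contDiff_proj.comp (hV (ns k))).sub (contDiff_proj.comp (ha.contDiff (ns k)))
  have hφ1 : ∀ k, ContDiff ℝ 1 (φ k) := fun k => (hφ k).of_le (by simp)
  have hφJ : ∀ k x, jacobian (φ k) x = jacobian (fun x => proj (avg τ (U (ns k)) x)) x -
      jacobian (fun x => proj (U (ns k) x)) x := by
    intro k x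
    rw [jacobian_eq_toMat, jacobian_eq_toMat, jacobian_eq_toMat, ← map_sub]
    congr 1
    exact fderiv_fun_sub ((hp1.comp (hV1 (ns k))).differentiable one_ne_zero x)
      ((hp1.comp (hU1 (ns k))).differentiable one_ne_zero x)
  have hsupp : ∀ k, tsupport (φ k) ⊆ tsupport τ := by
    intro k
    refine closure_mono fun x hx => ?_
    by_contra h0
    have h0' : τ x = 0 := by simpa using h0
    refine hx ?_
    simp [φ, avg, h0']
  have hcpt : IsCompact (tsupport τ) :=
    (isCompact_closedBall x₀ R').of_isClosed_subset (isClosed_tsupport _) hτ.tsupport_subset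
  have T1 : Tendsto (fun k => ∫⁻ x in Metric.ball x₀ R, ‖φ k x - (proj (avg τ u x) - u x)‖ₑ)
      atTop (𝓝 0) := by
    refine tendsto_lintegral_of_sub (fun k =>
      (contDiff_proj.comp (hV (ns k))).continuous.aestronglyMeasurable.sub iw.1) t1 s1 fun k => ?_
    filter_upwards [hs] with x hx
    rw [proj_eq (y := u x) (by rw [hx]; norm_num) (by rw [hx]; norm_num), hx]
    simp only [φ, inv_one, one_smul, Function.comp]; abel
  have T2 : Tendsto (fun k => ∫⁻ x in Metric.ball x₀ R, ‖jacobian (φ k) x -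
      (lmul (fderiv ℝ proj (avg τ u x)) (avgGrad τ Du x) - Du x)‖ₑ) atTop (𝓝 0) := by
    refine tendsto_lintegral_of_sub (fun k => (iP (hV1 (ns k)) (iJk _)).1.sub iDw.1) t2 s2 fun k => ?_
    filter_upwards [hs, hcoact] with x hx hx0
    rw [lmul_fderiv_proj_of_coact_eq_zero hx hx0, hφJ]; abel
  refine ⟨⟨hmw, ?_⟩, ?_, φ, fun k => ⟨hφ k, hcpt.of_isClosed_subset (isClosed_tsupport _) (hsupp k),
    (hsupp k).trans (hτ.tsupport_subset.trans (Metric.closedBall_subset_ball hτ.lt))⟩, ?_, ?_⟩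
  · filter_upwards [hv, ae_norm_avg_le hτ hs] with x hx hx'
    rw [proj_eq hx.le (by linarith), norm_smul, norm_inv, norm_norm]
    exact inv_mul_cancel₀ (by linarith)
  · refine memW1_one_iff.2 ⟨?_, iw.sub hu, iDw.sub hDu⟩
    refine isWeakGradient_of_tendsto hφ1 (fun k => ?_) (fun k => ?_) (iw.sub hu) (iDw.sub hDu) T1 T2
    · exact ((hφ k).continuous.integrable_of_hasCompactSupport
        (hcpt.of_isClosed_subset (isClosed_tsupport _) (hsupp k))).integrableOn
    · rw [funext (hφJ k)]
      exact (iP (hV1 _) (iJk _)).sub (iP (hU1 _) (ha.integrableOn_jacobian _))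
  · simpa only [eLpNorm_one_eq_lintegral_enorm] using T1
  · simpa only [eLpNorm_one_eq_lintegral_enorm] using T2

end Competitor

/-! ### Averages of sphere-valued maps -/

section AverageEstimate

variable {N n : ℕ}

lemma coact_sub_left (v w : Vec N) (Z : Mat N n) : coact (v - w) Z = coact v Z - coact w Z := by
  rw [← coactL_apply, map_sub]; rfl

variable {V : Vec n → Vec N} {D : Vec n → Mat N n} {P A : ℝ}

/-- Expand the square with |V| = 1. The defect 1 - |v|² of the mean is therefore exactly the
variance, quadratic in the oscillation. -/
lemma integral_sq_sub_mean (hVm : AEStronglyMeasurable V (unitAvg n))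
    (hs : ∀ᵐ z ∂(unitAvg n), ‖V z‖ = 1) :
    Integrable (fun z => ‖V z - ∫ z, V z ∂(unitAvg n)‖ ^ 2) (unitAvg n) ∧
    ∫ z, ‖V z - ∫ z, V z ∂(unitAvg n)‖ ^ 2 ∂(unitAvg n) = 1 - ‖∫ z, V z ∂(unitAvg n)‖ ^ 2 := by
  set v := ∫ z, V z ∂(unitAvg n) with hv
  have hVi : Integrable V (unitAvg n) := Integrable.of_bound hVm 1 (hs.mono fun z hz => hz.le)
  have e : ∀ᵐ z ∂(unitAvg n), ‖V z - v‖ ^ 2 = (1 + ‖v‖ ^ 2) - 2 * inner ℝ v (V z) := by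
    filter_upwards [hs] with z hz
    rw [norm_sub_sq_real, hz, real_inner_comm]; ring
  have hi : Integrable (fun z => inner ℝ v (V z)) (unitAvg n) := hVi.const_inner v
  have hi2 : Integrable (fun z => (1 + ‖v‖ ^ 2) - 2 * inner ℝ v (V z)) (unitAvg n) :=
    (integrable_const _).sub (hi.const_mul 2)
  refine ⟨hi2.congr (e.mono fun z hz => hz.symm), ?_⟩
  rw [integral_congr_ae e, integral_sub (integrable_const _) (hi.const_mul 2),
    integral_const_mul, integral_inner hVi, real_inner_self_eq_norm_sq]
  simp; ring

/-- V(z') - v is the mean of V(z') - V(z) over z, so Jensen bounds the variance by the double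
integral that the Poincaré inequality controls. -/
lemma integral_sq_sub_mean_le (hVm : AEStronglyMeasurable V (unitAvg n))
    (hs : ∀ᵐ z ∂(unitAvg n), ‖V z‖ = 1)
    (hP : ∫⁻ z', ∫⁻ z, ‖V z - V z'‖ₑ ^ 2 ∂(unitAvg n) ∂(unitAvg n) ≤ ENNReal.ofReal (P ^ 2)) :
    ∫ z, ‖V z - ∫ z, V z ∂(unitAvg n)‖ ^ 2 ∂(unitAvg n) ≤ P ^ 2 := by
  set v := ∫ z, V z ∂(unitAvg n) with hv
  have hVi : Integrable V (unitAvg n) := Integrable.of_bound hVm 1 (hs.mono fun z hz => hz.le)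
  have h1 : ∫⁻ z', ‖V z' - v‖ₑ ^ 2 ∂(unitAvg n) ≤ ENNReal.ofReal (P ^ 2) := by
    refine le_trans (lintegral_mono fun z' => ?_) hP
    refine le_trans ?_ (lintegral_sq_le (hVm.sub aestronglyMeasurable_const).enorm)
    gcongr
    have : V z' - v = -∫ z, (V z - V z') ∂(unitAvg n) := by
      rw [integral_sub hVi (integrable_const _)]; simp [hv]
    rw [this, enorm_neg]
    exact enorm_integral_le_lintegral_enorm _
  have h2 := (integral_sq_sub_mean hVm hs).1
  rw [integral_eq_lintegral_of_nonneg_ae (Eventually.of_forall fun z => by positivity) h2.1]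
  refine ENNReal.toReal_le_of_le_ofReal (by positivity) ?_
  convert h1 using 4 with z
  rw [ENNReal.ofReal_pow (norm_nonneg _), ofReal_norm]

lemma integral_norm_le_of_sq (hD : MemLp D 2 (unitAvg n)) (hA0 : 0 ≤ A)
    (hA : ∫ z, ‖D z‖ ^ 2 ∂(unitAvg n) ≤ A ^ 2) : ∫ z, ‖D z‖ ∂(unitAvg n) ≤ A := by
  have hDi : Integrable D (unitAvg n) := hD.integrable one_le_two
  have h2 : Integrable (fun z => ‖D z‖ ^ 2) (unitAvg n) := hD.integrable_norm_pow two_ne_zero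
  have hm : ∀ m : ℝ, m = ∫ z, ‖D z‖ ∂(unitAvg n) → m ^ 2 ≤ A ^ 2 := by
    intro m hm
    have : 0 ≤ ∫ z, (‖D z‖ - m) ^ 2 ∂(unitAvg n) := integral_nonneg fun z => by positivity
    have e : ∫ z, (‖D z‖ - m) ^ 2 ∂(unitAvg n) =
        ∫ z, (‖D z‖ ^ 2 - 2 * m * ‖D z‖ + m ^ 2) ∂(unitAvg n) := by
      congr 1; ext z; ring
    have i1 : Integrable (fun z => ‖D z‖ ^ 2 - 2 * m * ‖D z‖) (unitAvg n) :=
      h2.sub (hDi.norm.const_mul _)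
    rw [e, integral_add i1 (integrable_const _), integral_sub h2 (hDi.norm.const_mul _),
      integral_const_mul, ← hm] at this
    simp only [integral_const, probReal_univ, smul_eq_mul, one_mul] at this
    nlinarith
  exact abs_le_of_sq_le_sq' (hm _ rfl) hA0 |>.2

lemma integral_norm_mul_le (hVm : AEStronglyMeasurable V (unitAvg n))
    (hs : ∀ᵐ z ∂(unitAvg n), ‖V z‖ = 1) (hD : MemLp D 2 (unitAvg n)) (hA0 : 0 ≤ A) (hP0 : 0 ≤ P)
    (hA : ∫ z, ‖D z‖ ^ 2 ∂(unitAvg n) ≤ A ^ 2)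
    (hP : ∫⁻ z', ∫⁻ z, ‖V z - V z'‖ₑ ^ 2 ∂(unitAvg n) ∂(unitAvg n) ≤ ENNReal.ofReal (P ^ 2)) :
    ∫ z, ‖V z - ∫ z, V z ∂(unitAvg n)‖ * ‖D z‖ ∂(unitAvg n) ≤ P * A := by
  set v := ∫ z, V z ∂(unitAvg n) with hv
  have h1 := integral_sq_sub_mean_le hVm hs hP
  have hVm2 : MemLp (fun z => ‖V z - v‖) (ENNReal.ofReal 2) (unitAvg n) := by
    refine MemLp.of_bound (hVm.sub aestronglyMeasurable_const).norm (1 + ‖v‖) ?_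
    filter_upwards [hs] with z hz
    rw [norm_norm, ← hz]
    exact norm_sub_le _ _
  have hD2 : MemLp (fun z => ‖D z‖) (ENNReal.ofReal 2) (unitAvg n) := by
    rw [ENNReal.ofReal_ofNat]; exact hD.norm
  have := integral_mul_le_Lp_mul_Lq_of_nonneg (μ := unitAvg n) Real.HolderConjugate.two_two
    (Eventually.of_forall fun z => norm_nonneg (V z - v)) (Eventually.of_forall fun z => norm_nonneg (D z))
    hVm2 hD2
  refine this.trans ?_
  simp only [Real.rpow_ofNat, ← Real.sqrt_eq_rpow]
  gcongr
  · exact Real.sqrt_le_iff.2 ⟨hP0, h1⟩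
  · exact Real.sqrt_le_iff.2 ⟨hA0, hA⟩

/-- Projecting the mean of a sphere-valued map to the sphere changes the mean gradient by a
controlled amount. -/
lemma norm_lmul_proj_mean_sub_le (hVm : AEStronglyMeasurable V (unitAvg n))
    (hs : ∀ᵐ z ∂(unitAvg n), ‖V z‖ = 1) (hco : ∀ᵐ z ∂(unitAvg n), coact (V z) (D z) = 0)
    (hD : MemLp D 2 (unitAvg n)) (hA0 : 0 ≤ A) (hP0 : 0 ≤ P) (hP1 : P ≤ 1 / 2)
    (hA : ∫ z, ‖D z‖ ^ 2 ∂(unitAvg n) ≤ A ^ 2)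
    (hP : ∫⁻ z', ∫⁻ z, ‖V z - V z'‖ₑ ^ 2 ∂(unitAvg n) ∂(unitAvg n) ≤ ENNReal.ofReal (P ^ 2))
    {g : Vec n} (hg : ‖g‖ ≤ 1 / 2) :
    1 / 2 < ‖∫ z, V z ∂(unitAvg n)‖ ∧
    ‖lmul (fderiv ℝ proj (∫ z, V z ∂(unitAvg n))) (∫ z, shear (D z) z g ∂(unitAvg n)) -
      ∫ z, D z ∂(unitAvg n)‖ ≤ (8 * P + ‖g‖) * A := by
  have hDi : Integrable D (unitAvg n) := hD.integrable one_le_two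
  have hVi : Integrable V (unitAvg n) := Integrable.of_bound hVm 1 (hs.mono fun z hz => hz.le)
  have h1 := integral_sq_sub_mean_le hVm hs hP
  rw [(integral_sq_sub_mean hVm hs).2] at h1
  have h2 := integral_norm_mul_le hVm hs hD hA0 hP0 hA hP
  have h3 := integral_norm_le_of_sq hD hA0 hA
  have hv1 : ‖∫ z, V z ∂(unitAvg n)‖ ≤ 1 := by
    refine (norm_integral_le_of_norm_le_const (hs.mono fun z hz => hz.le)).trans ?_
    simp
  set v := ∫ z, V z ∂(unitAvg n) with hv
  have hvl : 1 / 2 < ‖v‖ := by nlinarith [norm_nonneg v]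
  refine ⟨hvl, ?_⟩
  have hsi : Integrable (fun z => shear (D z) z g) (unitAvg n) := by
    refine (hDi.norm.const_mul 2).mono' ?_ ?_
    · exact continuous_shear.comp_aestronglyMeasurable
        (hDi.1.prodMk (continuous_id.aestronglyMeasurable.prodMk aestronglyMeasurable_const))
    · filter_upwards [ae_unitAvg_norm_lt] with z hz
      refine (norm_shear_le _ _ _).trans ?_
      rw [mul_comm]
      gcongr
      nlinarith [norm_nonneg z, norm_nonneg g]
  set Z' := ∫ z, shear (D z) z g ∂(unitAvg n) with hZ'
  set Z := ∫ z, D z ∂(unitAvg n) with hZ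
  have hsn : ∀ᵐ z ∂(unitAvg n), ‖shear (D z) z g‖ ≤ 3 / 2 * ‖D z‖ := by
    filter_upwards [ae_unitAvg_norm_lt] with z hz
    refine (norm_shear_le _ _ _).trans ?_
    rw [mul_comm]
    gcongr
    nlinarith [norm_nonneg z, norm_nonneg g]
  have hZn : ‖Z' - Z‖ ≤ ‖g‖ * A := by
    rw [hZ', hZ, ← integral_sub hsi hDi]
    refine (norm_integral_le_of_norm_le (g := fun z => ‖g‖ * ‖D z‖) (hDi.norm.const_mul _) ?_).trans ?_
    · filter_upwards [ae_unitAvg_norm_lt] with z hz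
      refine (norm_shear_sub_le _ _ _).trans ?_
      have := mul_le_mul_of_nonneg_left hz.le (norm_nonneg (D z))
      nlinarith [norm_nonneg g]
    · rw [integral_const_mul]; gcongr
  have hZ'n : ‖Z'‖ ≤ 3 / 2 * A := by
    refine (norm_integral_le_of_norm_le (hDi.norm.const_mul (3 / 2)) hsn).trans ?_
    rw [integral_const_mul]; gcongr
  -- At each z the sheared gradient is orthogonal to V(z), so pairing it with v sees only v - V(z).
  -- Hölder turns this product of two small-scale quantities into O(PA).
  have hc : ‖coact v Z'‖ ≤ 3 / 2 * (P * A) := by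
    have e : coact v Z' = ∫ z, coact v (shear (D z) z g) ∂(unitAvg n) :=
      ((coactL v).integral_comp_comm hsi).symm
    rw [e]
    have hint : Integrable (fun z => ‖V z - v‖ * ‖D z‖) (unitAvg n) := by
      refine (hDi.norm.const_mul (1 + ‖v‖)).mono' ?_ ?_
      · exact (hVm.sub aestronglyMeasurable_const).norm.mul hDi.1.norm
      · filter_upwards [hs] with z hz
        rw [norm_mul, norm_norm, norm_norm, ← hz]
        gcongr
        exact norm_sub_le _ _
    refine (norm_integral_le_of_norm_le (hint.const_mul (3 / 2)) ?_).trans ?_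
    · filter_upwards [hsn, hco] with z hz hz0
      have : coact v (shear (D z) z g) = -coact (V z - v) (shear (D z) z g) := by
        rw [coact_sub_left, coact_shear_eq_zero hz0]; simp
      rw [this, norm_neg]
      refine (norm_coact_le _ _).trans ?_
      nlinarith [norm_nonneg (V z - v)]
    · rw [integral_const_mul]; gcongr
  rw [lmul_fderiv_proj hvl (by linarith)]
  have hi2 : ‖v‖⁻¹ ≤ 2 := by
    rw [inv_le_comm₀ (by linarith) (by norm_num)]; linarith
  have hi0 : 0 ≤ ‖v‖⁻¹ := by positivity
  have hiv : ‖v‖⁻¹ * ‖v‖ = 1 := inv_mul_cancel₀ (by linarith)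
  have hi1 : 1 ≤ ‖v‖⁻¹ := by
    rw [one_le_inv₀ (by linarith)]; exact hv1
  have hii : ‖v‖⁻¹ - 1 ≤ P := by nlinarith [norm_nonneg v]
  have e : ‖v‖⁻¹ • Z' - ‖v‖⁻¹ ^ 3 • tens v (coact v Z') - Z =
      (Z' - Z) + ((‖v‖⁻¹ - 1) • Z' - ‖v‖⁻¹ ^ 3 • tens v (coact v Z')) := by
    rw [sub_smul, one_smul]; abel
  rw [e]
  have b1 : ‖(‖v‖⁻¹ - 1) • Z'‖ ≤ P * (3 / 2 * A) := by
    rw [norm_smul, Real.norm_of_nonneg (by linarith)]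
    gcongr
  have b2 : ‖‖v‖⁻¹ ^ 3 • tens v (coact v Z')‖ ≤ 4 * (3 / 2 * (P * A)) := by
    rw [norm_smul, norm_tens, Real.norm_of_nonneg (by positivity)]
    have : ‖v‖⁻¹ ^ 3 * (‖v‖ * ‖coact v Z'‖) = ‖v‖⁻¹ ^ 2 * ‖coact v Z'‖ := by
      linear_combination ‖v‖⁻¹ ^ 2 * ‖coact v Z'‖ * hiv
    rw [this]
    gcongr
    nlinarith
  calc _ ≤ ‖Z' - Z‖ + (‖(‖v‖⁻¹ - 1) • Z'‖ + ‖‖v‖⁻¹ ^ 3 • tens v (coact v Z')‖) :=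
        (norm_add_le _ _).trans (by gcongr; exact norm_sub_le _ _)
    _ ≤ ‖g‖ * A + (P * (3 / 2 * A) + 4 * (3 / 2 * (P * A))) := by gcongr
    -- The scaling error 3/2 and the normal part 4 · 3/2 add up to 15/2, which is at most 8.
    _ ≤ _ := by nlinarith [mul_nonneg hP0 hA0]

end AverageEstimate

/-! ### Energy estimates at a point -/

section Energy

variable {N n : ℕ} {p q σ C μ : ℝ} {Ω : Set (Vec n)} {f : Vec n → Mat N n → ℝ}

/-- The constant of strong convexity. -/
def convexConst (p C : ℝ) : ℝ := C⁻¹ * (1 / 2) ^ ((p - 2) / 2) / p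

lemma convexConst_pos (hp : 2 ≤ p) (hC : 1 ≤ C) : 0 < convexConst p C := by
  unfold convexConst; positivity

lemma IsAdmissible.tangent (hf : IsAdmissible p q σ C μ Ω f) (hp : 2 ≤ p) (hC : 1 ≤ C) {x : Vec n}
    (hx : x ∈ Ω) (W Z : Mat N n) :
    f x Z + inner ℝ (gradient (f x) Z) (W - Z) + convexConst p C * ‖W - Z‖ ^ p ≤ f x W :=
  tangent_inequality (hf.contDiff x hx) hp hC (hf.monotone x hx) W Z

lemma IsAdmissible.nonneg (hf : IsAdmissible p q σ C μ Ω f) {x : Vec n} (hx : x ∈ Ω) (Z : Mat N n) :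
    0 ≤ f x Z := le_trans (by positivity) (hf.growth x hx Z).1

lemma IsAdmissible.apply_zero_le (hf : IsAdmissible p q σ C μ Ω f) (hq : 0 < q) {x : Vec n}
    (hx : x ∈ Ω) : f x 0 ≤ C := by
  simpa [Real.zero_rpow hq.ne'] using (hf.growth x hx 0).2

/-- The tangent inequality is taken at `W` and evaluated at `Z`, so only the gradient at `W` has to
be bounded. -/
lemma IsAdmissible.le_add (hf : IsAdmissible p q σ C μ Ω f) (hp : 2 ≤ p) (hpq : p ≤ q) (hC : 1 ≤ C)
    {x : Vec n} (hx : x ∈ Ω) (W Z : Mat N n) :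
    f x W ≤ f x Z + C * 2 ^ (q + 1) * (1 + ‖W‖) ^ (q - 1) * ‖W - Z‖ := by
  have hk := convexConst_pos hp hC
  have htan : ∀ W Z, f x Z + inner ℝ (gradient (f x) Z) (W - Z) ≤ f x W := fun W Z => by
    have := hf.tangent hp hC hx W Z
    have : 0 ≤ convexConst p C * ‖W - Z‖ ^ p := by positivity
    linarith
  have h1 := norm_gradient_le hC (by linarith) htan (hf.nonneg hx) (fun Z => (hf.growth x hx Z).2) W
  have h2 := htan Z W
  have h3 := abs_real_inner_le_norm (gradient (f x) W) (Z - W)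
  rw [norm_sub_rev] at h3
  have h4 : ‖gradient (f x) W‖ * ‖W - Z‖ ≤ C * 2 ^ (q + 1) * (1 + ‖W‖) ^ (q - 1) * ‖W - Z‖ := by
    gcongr
  linarith [neg_abs_le (inner ℝ (gradient (f x) W) (Z - W))]

/-- The strong tangent inequality at y, with f(y,Z) - f(y,0) and f'(y,Z) replaced by their values at
x through the Hölder condition. The linear term now has coefficients frozen at x and can vanish on
averaging. -/
lemma IsAdmissible.lower_bound (hf : IsAdmissible p q σ C μ Ω f) (hp : 2 ≤ p) (hpq : p ≤ q)
    (hC : 1 ≤ C) (hσ : 0 ≤ σ) {x y : Vec n} (hx : x ∈ Ω) (hy : y ∈ Ω) {r : ℝ} (hr : ‖y - x‖ ≤ r)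
    (W Z : Mat N n) :
    f x Z - f x 0 + inner ℝ (gradient (f x) Z) (W - Z) + convexConst p C * ‖W - Z‖ ^ p ≤
      f y W - f y 0 + C * r ^ σ * (1 + ‖Z‖ ^ (q - 1)) * (‖Z‖ + ‖W - Z‖) := by
  have h1 := hf.tangent hp hC hy W Z
  have hr' : C * ‖y - x‖ ^ σ ≤ C * r ^ σ := by gcongr
  have hg : ∀ ζ, ‖gradient (f y) ζ - gradient (f x) ζ‖ ≤ C * r ^ σ * (1 + ‖ζ‖ ^ (q - 1)) := fun ζ =>
    (hf.holder y hy x hx ζ).trans (by gcongr)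
  have h2 := norm_gradient_sub_le_increment (hf.contDiff y hy) (hf.contDiff x hx)
    (K := C * r ^ σ) (by have := (norm_nonneg _).trans hr; positivity) (by linarith) hg Z
  have h3 : |inner ℝ (gradient (f y) Z - gradient (f x) Z) (W - Z)| ≤
      C * r ^ σ * (1 + ‖Z‖ ^ (q - 1)) * ‖W - Z‖ :=
    (abs_real_inner_le_norm _ _).trans (by gcongr; exact hg Z)
  rw [inner_sub_left] at h3
  have h4 := neg_abs_le (f y Z - f y 0 - (f x Z - f x 0))
  have h5 := neg_abs_le (inner ℝ (gradient (f y) Z) (W - Z) - inner ℝ (gradient (f x) Z) (W - Z))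
  linarith

lemma rpow_norm_le_sub {W Z : Mat N n} {l : ℝ} (hp : 0 ≤ p) (hZ : ‖Z‖ ≤ l / 2) (hW : l < ‖W‖) :
    2⁻¹ ^ p * ‖W‖ ^ p ≤ ‖W - Z‖ ^ p := by
  rw [← Real.mul_rpow (by norm_num) (norm_nonneg _)]
  have := norm_sub_norm_le W Z
  gcongr
  linarith

/-- The energy of the projected average is at most the averaged energy, up to an error, with a
gain controlled by the large values of the gradient. -/
lemma IsAdmissible.energy_mean_le (hf : IsAdmissible p q σ C μ Ω f) (hp : 2 ≤ p) (hpq : p ≤ q)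
    (hC : 1 ≤ C) (hσ : 0 ≤ σ) {x : Vec n} {r : ℝ} (hx : x ∈ Ω) (hr : 0 ≤ r)
    {D : Vec n → Mat N n} (hD : Integrable D (unitAvg n)) {A θ : ℝ}
    (hA : ∫ z, ‖D z‖ ∂(unitAvg n) ≤ A)
    (hy : ∀ᵐ z ∂(unitAvg n), x + r • z ∈ Ω)
    (hG : Integrable (fun z => f (x + r • z) (D z) - f (x + r • z) 0) (unitAvg n))
    {ζ : Mat N n} (hθ0 : 0 ≤ θ) (hθ : θ ≤ 8) (hζ : ‖ζ - ∫ z, D z ∂(unitAvg n)‖ ≤ θ * A)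
    {H : Vec n → ℝ} (hH : Integrable H (unitAvg n))
    (hHle : ∀ᵐ z ∂(unitAvg n), H z ≤ ‖D z - ∫ z, D z ∂(unitAvg n)‖ ^ p) :
    f x ζ - f x 0 + convexConst p C * ∫ z, H z ∂(unitAvg n) ≤
      ∫ z, (f (x + r • z) (D z) - f (x + r • z) 0) ∂(unitAvg n) +
        C * 20 ^ (q + 1) * (θ + r ^ σ) * (1 + A) ^ q := by
  have hk := convexConst_pos hp hC
  have hA0 : 0 ≤ A := (integral_nonneg fun z => norm_nonneg _).trans hA
  set Z := ∫ z, D z ∂(unitAvg n) with hZ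
  have hZA : ‖Z‖ ≤ A := (norm_integral_le_integral_norm _).trans hA
  have hθA : 0 ≤ θ * A := (norm_nonneg _).trans hζ
  have hζA : ‖ζ‖ ≤ 9 * A := by
    have := norm_le_norm_add_norm_sub' ζ Z
    nlinarith
  have h1 := hf.le_add hp hpq hC hx ζ Z
  set E : ℝ := C * r ^ σ * (1 + ‖Z‖ ^ (q - 1)) with hE
  have hrσ : 0 ≤ r ^ σ := by positivity
  have hE0 : 0 ≤ E := by positivity
  have hDZ : Integrable (fun z => ‖D z - Z‖) (unitAvg n) := (hD.sub (integrable_const _)).norm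
  have hin : Integrable (fun z => inner ℝ (gradient (f x) Z) (D z - Z)) (unitAvg n) :=
    (hD.sub (integrable_const _)).const_inner _
  have i1 : Integrable (fun z => f x Z - f x 0 + inner ℝ (gradient (f x) Z) (D z - Z)) (unitAvg n) :=
    (integrable_const _).add hin
  have i2 : Integrable (fun z => f x Z - f x 0 + inner ℝ (gradient (f x) Z) (D z - Z) +
      convexConst p C * H z) (unitAvg n) := i1.add (hH.const_mul _)
  have i3 : Integrable (fun z => E * (‖Z‖ + ‖D z - Z‖)) (unitAvg n) :=
    ((integrable_const _).add hDZ).const_mul _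
  have h2 : ∫ z, (f x Z - f x 0 + inner ℝ (gradient (f x) Z) (D z - Z) + convexConst p C * H z)
      ∂(unitAvg n) ≤ ∫ z, ((f (x + r • z) (D z) - f (x + r • z) 0) + E * (‖Z‖ + ‖D z - Z‖))
        ∂(unitAvg n) := by
    refine integral_mono_ae i2 (hG.add i3) ?_
    filter_upwards [hy, hHle, ae_unitAvg_norm_lt] with z hz hz2 hz3
    have h3 : ‖x + r • z - x‖ ≤ r := by
      rw [add_sub_cancel_left, norm_smul, Real.norm_of_nonneg hr]
      nlinarith
    have h4 := hf.lower_bound hp hpq hC hσ hx hz h3 (D z) Z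
    have h5 : convexConst p C * H z ≤ convexConst p C * ‖D z - Z‖ ^ p := by gcongr
    linarith
  have hDZi : Integrable (fun z => D z - Z) (unitAvg n) := hD.sub (integrable_const _)
  -- The linear term disappears because Z is the mean of D; what is left of the tangent inequality
  -- is the gain.
  have hin0 : ∫ z, inner ℝ (gradient (f x) Z) (D z - Z) ∂(unitAvg n) = 0 := by
    rw [integral_inner hDZi, integral_sub hD (integrable_const _)]
    simp [hZ]
  rw [integral_add i1 (hH.const_mul _), integral_add (integrable_const _) hin, integral_add hG i3,
    hin0, integral_const_mul, integral_const_mul, integral_add (integrable_const _) hDZ] at h2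
  simp only [integral_const, probReal_univ, one_smul, add_zero] at h2
  have h3 : ∫ z, ‖D z - Z‖ ∂(unitAvg n) ≤ 2 * A := by
    calc ∫ z, ‖D z - Z‖ ∂(unitAvg n) ≤ ∫ z, (‖D z‖ + ‖Z‖) ∂(unitAvg n) :=
          integral_mono hDZ (hD.norm.add (integrable_const _)) fun z => norm_sub_le _ _
      _ = ∫ z, ‖D z‖ ∂(unitAvg n) + ‖Z‖ := by
          rw [integral_add hD.norm (integrable_const _)]; simp
      _ ≤ _ := by linarith
  have hq1 : 0 ≤ q - 1 := by linarith
  have hpow : (1 + A) ^ q = (1 + A) ^ (q - 1) * (1 + A) := by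
    rw [← Real.rpow_add_one (by linarith)]; ring_nf
  have h1A : 1 ≤ (1 + A) ^ (q - 1) := Real.one_le_rpow (by linarith) hq1
  have hX0 : 0 ≤ (1 + A) ^ q := by positivity
  have b1 : E * (‖Z‖ + ∫ z, ‖D z - Z‖ ∂(unitAvg n)) ≤ C * r ^ σ * (6 * (1 + A) ^ q) := by
    have : ‖Z‖ ^ (q - 1) ≤ (1 + A) ^ (q - 1) := by gcongr; linarith
    calc E * (‖Z‖ + ∫ z, ‖D z - Z‖ ∂(unitAvg n)) ≤
          (C * r ^ σ * (2 * (1 + A) ^ (q - 1))) * (3 * (1 + A)) := by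
            rw [hE]; gcongr <;> linarith
      _ = _ := by rw [hpow]; ring
  have b2 : C * 2 ^ (q + 1) * (1 + ‖ζ‖) ^ (q - 1) * ‖ζ - Z‖ ≤
      C * 20 ^ (q + 1) * (θ * (1 + A) ^ q) := by
    calc C * 2 ^ (q + 1) * (1 + ‖ζ‖) ^ (q - 1) * ‖ζ - Z‖
        ≤ C * 2 ^ (q + 1) * (10 * (1 + A)) ^ (q - 1) * (θ * (1 + A)) := by
          gcongr
          · linarith
          · nlinarith
      _ = C * (2 ^ (q + 1) * 10 ^ (q - 1)) * (θ * (1 + A) ^ q) := by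
          rw [Real.mul_rpow (by norm_num) (by linarith), hpow]; ring
      -- θ ≤ 8 gives |ζ| ≤ 9A, hence 1 + |ζ| ≤ 10(1 + A); the base 20 is the 2 of the gradient bound
      -- times this 10.
      _ ≤ C * (2 ^ (q + 1) * 10 ^ (q + 1)) * (θ * (1 + A) ^ q) := by
          gcongr
          · norm_num
          · linarith
      _ = _ := by rw [← Real.mul_rpow (by norm_num) (by norm_num)]; norm_num
  have b3 : C * r ^ σ * (6 * (1 + A) ^ q) ≤ C * 20 ^ (q + 1) * (r ^ σ * (1 + A) ^ q) := by
    have : (6:ℝ) ≤ 20 ^ (q + 1) := by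
      calc (6:ℝ) ≤ 20 ^ (1:ℝ) := by norm_num
        _ ≤ _ := Real.rpow_le_rpow_of_exponent_le (by norm_num) (by linarith)
    nlinarith [mul_nonneg (mul_nonneg (by linarith : 0 ≤ C) hrσ) hX0]
  linarith [h2, b1, b2, b3, h1]

end Energy

/-! ### Cutoff functions -/

section Cutoff

variable {n : ℕ}

lemma exists_bound_deriv_smoothTransition :
    ∃ M : ℝ, 0 < M ∧ ∀ x, |deriv Real.smoothTransition x| ≤ M := by
  have hc : Continuous (deriv Real.smoothTransition) :=
    (Real.smoothTransition.contDiff (n := 1)).continuous_deriv le_rfl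
  obtain ⟨M, hM⟩ := (isCompact_Icc (a := (0:ℝ)) (b := 1)).exists_bound_of_continuousOn hc.continuousOn
  refine ⟨max M 1, by positivity, fun x => ?_⟩
  by_cases h0 : x ∈ Icc (0:ℝ) 1
  · exact (hM x h0).trans (le_max_left _ _)
  · have : deriv Real.smoothTransition x = 0 := by
      rw [mem_Icc, not_and_or, not_le, not_le] at h0
      rcases h0 with h0 | h0
      · have : Real.smoothTransition =ᶠ[𝓝 x] fun _ => 0 := by
          filter_upwards [gt_mem_nhds h0] with y hy
          exact Real.smoothTransition.zero_of_nonpos hy.le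
        rw [this.deriv_eq]; simp
      · have : Real.smoothTransition =ᶠ[𝓝 x] fun _ => 1 := by
          filter_upwards [lt_mem_nhds h0] with y hy
          exact Real.smoothTransition.one_of_one_le hy.le
        rw [this.deriv_eq]; simp
    rw [this, abs_zero]; positivity

/-- Cutoff functions whose gradient is controlled by a power of the function. -/
lemma exists_cutoff {α : ℝ} (hα : α < 1) : ∃ K : ℝ, 0 < K ∧
    ∀ (n : ℕ) (x₀ : Vec n) (ρ R : ℝ), 0 < ρ → ρ < R →
      ∃ η : Vec n → ℝ, ContDiff ℝ ∞ η ∧ (∀ x, 0 ≤ η x ∧ η x ≤ 1) ∧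
        (∀ x ∈ Metric.ball x₀ ρ, η x = 1) ∧ tsupport η ⊆ Metric.closedBall x₀ R ∧
        ∀ x, ‖gradient η x‖ ≤ K / (R - ρ) * η x ^ α := by
  obtain ⟨M, hM0, hM⟩ := exists_bound_deriv_smoothTransition
  -- The cutoff is b^k for a smooth b with values in [0,1]. Its gradient carries b^(k-1), which is
  -- at most (b^k)^α as soon as αk ≤ k - 1; this is why α < 1 is required.
  obtain ⟨k, hk⟩ := exists_nat_ge (max 2 (1 / (1 - α)))
  have hk2 : 2 ≤ k := by exact_mod_cast (le_max_left _ _).trans hk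
  have hkα : α * k ≤ (k - 1 : ℕ) := by
    have h1 : 1 / (1 - α) ≤ k := (le_max_right _ _).trans hk
    rw [div_le_iff₀ (by linarith)] at h1
    rw [Nat.cast_sub (by omega)]
    push_cast
    linarith
  refine ⟨k * (M * 2), by positivity, fun n x₀ ρ R hρ hR => ?_⟩
  -- The profile is a function of |x - x₀|², which is smooth at the centre.
  set Δ := R ^ 2 - ρ ^ 2 with hΔ
  have hΔ1 : (R - ρ) * R ≤ Δ := by nlinarith
  have hRρ : 0 < R - ρ := by linarith
  have hR0 : 0 < R := by linarith
  have hΔ0 : 0 < Δ := lt_of_lt_of_le (by positivity) hΔ1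
  set h : Vec n → ℝ := fun x => (R ^ 2 - ‖x - x₀‖ ^ 2) / Δ with hh
  set b : Vec n → ℝ := fun x => Real.smoothTransition (h x) with hb
  have hhd : ContDiff ℝ ∞ h :=
    (contDiff_const.sub ((contDiff_id.sub contDiff_const).norm_sq ℝ)).div_const _
  have hbd : ContDiff ℝ ∞ b := Real.smoothTransition.contDiff.comp hhd
  have hb0 : ∀ x, 0 ≤ b x := fun x => Real.smoothTransition.nonneg _
  have hb1 : ∀ x, b x ≤ 1 := fun x => Real.smoothTransition.le_one _
  have hbz : ∀ x, R ≤ ‖x - x₀‖ → b x = 0 := fun x hx => by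
    refine Real.smoothTransition.zero_of_nonpos (div_nonpos_of_nonpos_of_nonneg ?_ hΔ0.le)
    nlinarith
  refine ⟨fun x => b x ^ k, hbd.pow k, fun x => ⟨by have := hb0 x; positivity,
    pow_le_one₀ (hb0 x) (hb1 x)⟩, fun x hx => ?_, ?_, fun x => ?_⟩
  · have : b x = 1 := by
      refine Real.smoothTransition.one_of_one_le ?_
      rw [mem_ball_iff_norm] at hx
      rw [hh, le_div_iff₀ hΔ0]
      nlinarith [norm_nonneg (x - x₀)]
    simp [this]
  · refine closure_minimal (fun x hx => ?_) Metric.isClosed_closedBall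
    rw [mem_closedBall_iff_norm]
    by_contra! h0
    refine hx ?_
    simp only
    rw [hbz x h0.le, zero_pow (by omega)]
  · have d1 : HasFDerivAt h ((-(2 / Δ)) • innerSL ℝ (x - x₀)) x := by
      have := ((((hasFDerivAt_id x).sub_const x₀).norm_sq).const_sub (R ^ 2)).mul_const (Δ⁻¹)
      refine HasFDerivAt.congr_fderiv (f := h) this ?_
      ext y
      simp [div_eq_mul_inv]
      ring
    have d2 : HasDerivAt Real.smoothTransition (deriv Real.smoothTransition (h x)) (h x) :=
      ((Real.smoothTransition.contDiff (n := 1)).differentiable one_ne_zero _).hasDerivAt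
    have d3 : HasFDerivAt (fun x => b x ^ k) _ x := (d2.comp_hasFDerivAt x d1).pow k
    have e : ‖gradient (fun x => b x ^ k) x‖ = ‖fderiv ℝ (fun x => b x ^ k) x‖ := by
      rw [gradient]; exact LinearIsometryEquiv.norm_map _ _
    rw [e, d3.fderiv]
    have e2 : b x ^ (k - 1) ≤ (b x ^ k) ^ α := by
      rw [← Real.rpow_natCast (b x) k, ← Real.rpow_mul (hb0 x), ← Real.rpow_natCast (b x) (k - 1)]
      rcases (hb0 x).eq_or_lt with h0 | h0
      · rw [← h0, Real.zero_rpow (by norm_cast; omega)]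
        positivity
      · exact Real.rpow_le_rpow_of_exponent_ge h0 (hb1 x) (by rw [mul_comm]; exact hkα)
    rcases le_or_gt R ‖x - x₀‖ with hx | hx
    · have hz := hbz x hx
      have : b x ^ (k - 1) = 0 := by rw [hz, zero_pow (by omega)]
      have h4 : (Real.smoothTransition ∘ h) x ^ (k - 1) = 0 := this
      simp only [h4]
      simp
      positivity
    · have h4 : (Real.smoothTransition ∘ h) x ^ (k - 1) = b x ^ (k - 1) := rfl
      simp only [h4, norm_smul, innerSL_apply_norm, nsmul_eq_mul, norm_mul, norm_neg, norm_div,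
        Real.norm_eq_abs, abs_of_pos hΔ0, abs_pow, Nat.abs_cast, abs_of_nonneg (hb0 x), abs_two]
      have h5 : 2 / Δ * ‖x - x₀‖ ≤ 2 / (R - ρ) := by
        rw [div_mul_eq_mul_div, div_le_div_iff₀ hΔ0 hRρ]
        nlinarith
      calc _ ≤ (k * b x ^ (k - 1)) * (M * (2 / (R - ρ))) := by
            have h6 : 0 ≤ b x ^ (k - 1) := pow_nonneg (hb0 x) _
            gcongr
            exact hM _
        _ ≤ (k * (b x ^ k) ^ α) * (M * (2 / (R - ρ))) := by gcongr
        _ = _ := by ring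

/-- Scaling by ε ≤ 1 keeps the constant K in |∇τ| ≤ Kτ^α, because ε ≤ ε^α. The shear error is thus
of order τ^α uniformly in ε, while the global Lipschitz constant is εK. -/
lemma isRadius_smul {x₀ : Vec n} {R R' K α : ℝ} {η : Vec n → ℝ} (hη : ContDiff ℝ ∞ η)
    (h01 : ∀ x, 0 ≤ η x ∧ η x ≤ 1) (hsupp : tsupport η ⊆ Metric.closedBall x₀ R') (hα : 0 ≤ α)
    (hα1 : α ≤ 1) (hK : 0 ≤ K)
    (hg : ∀ x, ‖gradient η x‖ ≤ K * η x ^ α) {ε : ℝ} (hε : 0 < ε) (hε1 : ε ≤ 1) (hεR : ε ≤ R - R')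
    (hεK : ε * K ≤ 1 / 2) :
    IsRadius x₀ R R' (ε * K) (fun x => ε * η x) ∧
      ∀ x, ‖gradient (fun x => ε * η x) x‖ ≤ K * (ε * η x) ^ α := by
  have hgr : ∀ x, ‖gradient (fun x => ε * η x) x‖ = ε * ‖gradient η x‖ := fun x => by
    have : gradient (fun x => ε * η x) x = ε • gradient η x := by
      rw [gradient, gradient, fderiv_const_mul (hη.differentiable (by simp) x)]
      exact (InnerProductSpace.toDual ℝ (Vec n)).symm.map_smul ε _
    rw [this, norm_smul, Real.norm_of_nonneg hε.le]
  refine ⟨⟨contDiff_const.mul hη, fun x => mul_nonneg hε.le (h01 x).1, fun x => ?_, by linarith,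
    ?_, fun x => ?_, hεK⟩, fun x => ?_⟩
  · nlinarith [h01 x]
  · refine Subset.trans (closure_mono fun x hx => ?_) hsupp
    simp only [Function.mem_support] at hx ⊢
    exact right_ne_zero_of_mul hx
  · rw [hgr]
    have : η x ^ α ≤ 1 := Real.rpow_le_one (h01 x).1 (h01 x).2 hα
    have h2 := hg x
    gcongr
    nlinarith
  · rw [hgr, Real.mul_rpow hε.le (h01 x).1]
    have h1 : ε ≤ ε ^ α := by
      conv_lhs => rw [← Real.rpow_one ε]
      exact Real.rpow_le_rpow_of_exponent_ge hε hε1 hα1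
    have h0 : 0 ≤ η x ^ α := Real.rpow_nonneg (h01 x).1 _
    calc ε * ‖gradient η x‖ ≤ ε ^ α * (K * η x ^ α) := by gcongr; exact hg x
      _ = _ := by ring

end Cutoff

/-! ### The energy inequality at a point -/

section PowerMeans

variable {n : ℕ}

/-- The reciprocal of the volume of the unit ball. -/
def unitVolInv (n : ℕ) : ℝ := ((volume (Metric.ball (0 : Vec n) 1))⁻¹).toReal

lemma unitVolInv_nonneg : 0 ≤ unitVolInv n := ENNReal.toReal_nonneg

lemma integral_unitAvg_le {h : Vec n → ℝ} (h0 : ∀ y, 0 ≤ h y) (x : Vec n) {r : ℝ} (hr : 0 < r)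
    {U : Set (Vec n)} (hU : Metric.ball x r ⊆ U) (hi : IntegrableOn h U) :
    ∫ z, h (x + r • z) ∂(unitAvg n) ≤ unitVolInv n * (r ^ n)⁻¹ * ∫ y in U, h y := by
  have h1 := lintegral_unitAvg_le x hr hU fun y => ENNReal.ofReal (h y)
  have hi2 := integrable_unitAvg x hr hU hi
  rw [integral_eq_lintegral_of_nonneg_ae (Eventually.of_forall fun z => h0 _) hi2.1,
    integral_eq_lintegral_of_nonneg_ae (Eventually.of_forall h0) hi.1]
  refine (ENNReal.toReal_mono ?_ h1).trans_eq ?_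
  · refine ENNReal.mul_ne_top (ENNReal.mul_ne_top
      (ENNReal.inv_ne_top.2 volume_unitBall_ne_zero) ENNReal.ofReal_ne_top) ?_
    rw [← ofReal_integral_eq_lintegral_ofReal hi (Eventually.of_forall h0)]
    exact ENNReal.ofReal_ne_top
  · rw [ENNReal.toReal_mul, ENNReal.toReal_mul, ENNReal.toReal_ofReal (by positivity), unitVolInv]

lemma memLp_of_integrable_rpow {α G : Type*} [MeasurableSpace α] [NormedAddCommGroup G]
    {ν : Measure α} {D : α → G} (hD : AEStronglyMeasurable D ν) {s : ℝ} (hs : 0 < s)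
    (hi : Integrable (fun z => ‖D z‖ ^ s) ν) : MemLp D (ENNReal.ofReal s) ν := by
  rw [← integrable_norm_rpow_iff hD (by simpa using hs) ENNReal.ofReal_ne_top,
    ENNReal.toReal_ofReal hs.le]
  exact hi

lemma integral_rpow_mean_mono {α G : Type*} [MeasurableSpace α] [NormedAddCommGroup G]
    {ν : Measure α} [IsProbabilityMeasure ν] {D : α → G} (hD : AEStronglyMeasurable D ν)
    {t s : ℝ} (ht : 0 < t) (hts : t ≤ s) (hi : Integrable (fun z => ‖D z‖ ^ s) ν) :
    (∫ z, ‖D z‖ ^ t ∂ν) ^ (1 / t) ≤ (∫ z, ‖D z‖ ^ s ∂ν) ^ (1 / s) := by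
  have hs : 0 < s := ht.trans_le hts
  have h1 := memLp_of_integrable_rpow hD hs hi
  have hle : ENNReal.ofReal t ≤ ENNReal.ofReal s := ENNReal.ofReal_le_ofReal hts
  have h2 := eLpNorm_le_eLpNorm_of_exponent_le hle hD
  rw [(h1.mono_exponent hle).eLpNorm_eq_integral_rpow_norm (by simpa using ht) ENNReal.ofReal_ne_top,
    h1.eLpNorm_eq_integral_rpow_norm (by simpa using hs) ENNReal.ofReal_ne_top,
    ENNReal.toReal_ofReal ht.le, ENNReal.toReal_ofReal hs.le,
    ENNReal.ofReal_le_ofReal_iff (by positivity)] at h2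
  simpa only [one_div] using h2

lemma integral_norm_le_rpow_mean {α G : Type*} [MeasurableSpace α] [NormedAddCommGroup G]
    {ν : Measure α} [IsProbabilityMeasure ν] {D : α → G} (hD : AEStronglyMeasurable D ν)
    {s : ℝ} (hs : 1 ≤ s) (hi : Integrable (fun z => ‖D z‖ ^ s) ν) :
    ∫ z, ‖D z‖ ∂ν ≤ (∫ z, ‖D z‖ ^ s ∂ν) ^ (1 / s) := by
  simpa using integral_rpow_mean_mono hD one_pos hs hi

lemma integral_sq_le_rpow_mean {α G : Type*} [MeasurableSpace α] [NormedAddCommGroup G]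
    {ν : Measure α} [IsProbabilityMeasure ν] {D : α → G} (hD : AEStronglyMeasurable D ν)
    {s : ℝ} (hs : 2 ≤ s) (hi : Integrable (fun z => ‖D z‖ ^ s) ν) :
    ∫ z, ‖D z‖ ^ 2 ∂ν ≤ ((∫ z, ‖D z‖ ^ s ∂ν) ^ (1 / s)) ^ 2 := by
  have h1 := integral_rpow_mean_mono hD two_pos hs hi
  simp only [Real.rpow_ofNat] at h1
  have h0 : 0 ≤ ∫ z, ‖D z‖ ^ 2 ∂ν := integral_nonneg fun z => by positivity
  calc ∫ z, ‖D z‖ ^ 2 ∂ν = ((∫ z, ‖D z‖ ^ 2 ∂ν) ^ (1 / 2 : ℝ)) ^ 2 := by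
        rw [← Real.sqrt_eq_rpow, Real.sq_sqrt h0]
    _ ≤ _ := by gcongr

/-- Superlinear powers of a mean, in terms of a lower power and the size of the mean. -/
lemma one_add_rpow_le {M Y q s : ℝ} (hM : 0 ≤ M) (hY : 1 ≤ Y) (hMY : M ≤ Y) (hs : 0 < s)
    (hsq : s ≤ q) : (1 + M ^ (1 / s)) ^ q ≤ 2 ^ q * (Y ^ ((q - s) / s) * (1 + M)) := by
  have hY1 : 1 ≤ Y ^ ((q - s) / s) := Real.one_le_rpow hY (div_nonneg (by linarith) hs.le)
  have hq : 0 ≤ q := by linarith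
  have key : max 1 (M ^ (1 / s)) ^ q ≤ Y ^ ((q - s) / s) * (1 + M) := by
    rcases le_total (M ^ (1 / s)) 1 with h | h
    · rw [max_eq_left h, Real.one_rpow]
      nlinarith
    · rw [max_eq_right h, ← Real.rpow_mul hM]
      have hM0 : 0 < M := by
        rcases hM.eq_or_lt with h0 | h0
        · rw [← h0, Real.zero_rpow (by positivity)] at h; norm_num at h
        · exact h0
      have : M ^ (1 / s * q) = M ^ ((q - s) / s) * M := by
        rw [← Real.rpow_add_one hM0.ne']; congr 1; field_simp; ring
      rw [this]
      have : M ^ ((q - s) / s) ≤ Y ^ ((q - s) / s) :=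
        Real.rpow_le_rpow hM hMY (div_nonneg (by linarith) hs.le)
      calc M ^ ((q - s) / s) * M ≤ Y ^ ((q - s) / s) * M := by gcongr
        _ ≤ _ := by gcongr; linarith
  have h0 : 0 ≤ M ^ (1 / s) := by positivity
  calc (1 + M ^ (1 / s)) ^ q ≤ (2 * max 1 (M ^ (1 / s))) ^ q := by
        gcongr
        linarith [le_max_left 1 (M ^ (1 / s)), le_max_right 1 (M ^ (1 / s))]
    _ = 2 ^ q * max 1 (M ^ (1 / s)) ^ q := Real.mul_rpow (by norm_num) (by positivity)
    _ ≤ _ := by gcongr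

end PowerMeans

/-! ### Error terms of the pointwise inequality as powers of the radius. -/

section PointEnergy

variable {N n : ℕ} {p q σ C μ α : ℝ} {Ω B : Set (Vec n)} {f : Vec n → Mat N n → ℝ}
  {u : Vec n → Vec N} {Du : Vec n → Mat N n} {U : ℕ → Vec n → Vec N} {h : ℕ → Vec n → ℝ}

/-- The factor in the error term of the pointwise energy inequality. -/
def errorConst (n : ℕ) (p q s C L W : ℝ) : ℝ :=
  C * 20 ^ (q + 1) * 2 ^ q * (8 * 2 ^ (n + 2) * W ^ (1 / p) + L + 1) * W ^ ((q - s) / s)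

lemma errorConst_nonneg {s L W : ℝ} (hC : 1 ≤ C) (hL : 0 ≤ L) (hW : 1 ≤ W) :
    0 ≤ errorConst n p q s C L W := by
  unfold errorConst; positivity

/-- The exponent of the radius in the error term. -/
def errorExp (n : ℕ) (q s α : ℝ) : ℝ := α - n * ((q - s) / s)

/-- Morrey scaling: the mean of |Du|^s over a ball of radius r is at most W r^(-n). Since W r^(-n) ≥
1, the root 1/s may be replaced by 1/p, which leaves r^(1-n/p) ≤ r^α. -/
lemma mean_radius_le {r W s : ℝ} (hn : (n : ℝ) < p) (hr : 0 < r) (hr1 : r ≤ 1) (hW : 1 ≤ W)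
    (hps : p ≤ s) (hα : α ≤ 1 - n / p) {M : ℝ} (hM : 0 ≤ M) (hMW : M ≤ W * (r ^ n)⁻¹) :
    r * M ^ (1 / s) ≤ W ^ (1 / p) * r ^ α := by
  have hp : 0 < p := lt_of_le_of_lt (Nat.cast_nonneg n) hn
  have hs : 0 < s := by linarith
  have h1 : 1 ≤ W * (r ^ n)⁻¹ := by
    have : 1 ≤ (r ^ n)⁻¹ := (one_le_inv₀ (by positivity)).2 (pow_le_one₀ hr.le hr1)
    nlinarith
  calc r * M ^ (1 / s) ≤ r * (W * (r ^ n)⁻¹) ^ (1 / s) := by gcongr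
    _ ≤ r * (W * (r ^ n)⁻¹) ^ (1 / p) := by
        gcongr
    _ = W ^ (1 / p) * r ^ (1 - n / p) := by
        rw [Real.mul_rpow (by linarith) (by positivity), Real.inv_rpow (by positivity),
          ← Real.rpow_natCast, ← Real.rpow_mul hr.le, ← Real.rpow_neg hr.le,
          mul_left_comm]
        congr 1
        rw [← Real.rpow_one_add' hr.le]
        · congr 1; ring
        · have : (n : ℝ) / p < 1 := by rw [div_lt_one hp]; exact hn
          have e : (1 : ℝ) + -(n * (1 / p)) = 1 - n / p := by ring
          rw [e]; linarith
    _ ≤ _ := by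
        gcongr ?_ * ?_
        exact Real.rpow_le_rpow_of_exponent_ge hr hr1 hα

/-- The projection, the shear and the Hölder dependence on x all contribute O(r^α). The factor (1 +
M^(1/s))^q is traded for 1 + M by `one_add_rpow_le` with Y = W r^(-n), at the cost of r^(-n(q-s)/s).
-/
lemma error_le {r W s L M P G : ℝ} (hC : 1 ≤ C) (hr : 0 < r) (hr1 : r ≤ 1) (hασ : α ≤ σ)
    (hW1 : 1 ≤ W) (hs0 : 0 < s) (hsq : s ≤ q) (hM0 : 0 ≤ M) (hMW : M ≤ W * (r ^ n)⁻¹)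
    (hG : 0 ≤ G) (hgL : G ≤ L * r ^ α) (hP0 : 0 ≤ P)
    (hPle : P ≤ 2 ^ (n + 2) * (W ^ (1 / p) * r ^ α)) :
    C * 20 ^ (q + 1) * (8 * P + G + r ^ σ) * (1 + M ^ (1 / s)) ^ q ≤
      errorConst n p q s C L W * r ^ errorExp n q s α * (1 + M) := by
  have hrα : r ^ σ ≤ r ^ α := Real.rpow_le_rpow_of_exponent_ge hr hr1 hασ
  have hrα0 : 0 < r ^ α := by positivity
  have hθ : 8 * P + G + r ^ σ ≤ (8 * 2 ^ (n + 2) * W ^ (1 / p) + L + 1) * r ^ α := by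
    linarith
  have hY1 : 1 ≤ W * (r ^ n)⁻¹ := by
    have : 1 ≤ (r ^ n)⁻¹ := (one_le_inv₀ (by positivity)).2 (pow_le_one₀ hr.le hr1)
    nlinarith
  have hpow := one_add_rpow_le hM0 hY1 hMW hs0 hsq
  rw [Real.mul_rpow (by linarith) (by positivity), Real.inv_rpow (by positivity),
    ← Real.rpow_natCast, ← Real.rpow_mul hr.le, ← Real.rpow_neg hr.le] at hpow
  have e : r ^ errorExp n q s α = r ^ α * r ^ (-(n * ((q - s) / s))) := by
    rw [← Real.rpow_add hr]; rfl
  have hrσ : 0 ≤ r ^ σ := by positivity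
  calc C * 20 ^ (q + 1) * (8 * P + G + r ^ σ) * (1 + M ^ (1 / s)) ^ q
      ≤ C * 20 ^ (q + 1) * ((8 * 2 ^ (n + 2) * W ^ (1 / p) + L + 1) * r ^ α) *
        (2 ^ q * (W ^ ((q - s) / s) * r ^ (-(n * ((q - s) / s))) * (1 + M))) := by
        apply mul_le_mul _ hpow (by positivity)
        · have : 0 ≤ 8 * P + G + r ^ σ := by positivity
          exact mul_nonneg (by positivity) (this.trans hθ)
        · exact mul_le_mul_of_nonneg_left hθ (by positivity)
    _ = _ := by rw [e, errorConst]; ring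

/-- A = M^(1/s) dominates the first and second moments of |Du|, and P = 2^(n+2) rA bounds the
oscillation of u. The number `b` switches the gain on where the mean gradient is at most half the
threshold: there |Du| > lam forces |Du - mean| ≥ |Du|/2. -/
lemma IsAdmissible.energy_proj_avg_le (hf : IsAdmissible p q σ C μ Ω f) (hp : 2 ≤ p) (hnp : (n:ℝ) < p)
    (hpq : p ≤ q) (hC : 1 ≤ C) (hσ : 0 ≤ σ) (hασ : α ≤ σ) (hαp : α ≤ 1 - n / p) (hBΩ : B ⊆ Ω)
    (ha : IsSmoothApprox B u Du U h) (hum : StronglyMeasurable u) (hDm : StronglyMeasurable Du)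
    (hs : ∀ᵐ y ∂(volume.restrict B), ‖u y‖ = 1)
    (hco : ∀ᵐ y ∂(volume.restrict B), coact (u y) (Du y) = 0)
    (hG : IntegrableOn (fun y => f y (Du y) - f y 0) B)
    {s W L lam : ℝ} (hps : p ≤ s) (hsq : s ≤ q) (hDs : IntegrableOn (fun y => ‖Du y‖ ^ s) B)
    (hDp : IntegrableOn (fun y => ‖Du y‖ ^ p) B)
    (hW1 : 1 ≤ W) (hW : unitVolInv n * ∫ y in B, ‖Du y‖ ^ s ≤ W)
    {x : Vec n} {r : ℝ} (hr : 0 < r) (hr1 : r ≤ 1) (hxB : Metric.ball x r ⊆ B)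
    (hrW : 2 ^ (n + 3) * (W ^ (1 / p) * r ^ α) ≤ 1)
    {g : Vec n} (hg : ‖g‖ ≤ 1 / 2) (hgL : ‖g‖ ≤ L * r ^ α)
    {b : ℝ} (hb : b = 0 ∨ b = 1 ∧ ‖∫ z, Du (x + r • z) ∂(unitAvg n)‖ ≤ lam / 2) :
    1 / 2 < ‖∫ z, u (x + r • z) ∂(unitAvg n)‖ ∧
    f x (lmul (fderiv ℝ proj (∫ z, u (x + r • z) ∂(unitAvg n)))
      (∫ z, shear (Du (x + r • z)) z g ∂(unitAvg n))) - f x 0 +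
      convexConst p C * 2⁻¹ ^ p * (b * ∫ z, {y | lam < ‖Du y‖}.indicator (fun y => ‖Du y‖ ^ p)
        (x + r • z) ∂(unitAvg n)) ≤
    ∫ z, (f (x + r • z) (Du (x + r • z)) - f (x + r • z) 0) ∂(unitAvg n) +
      errorConst n p q s C L W * r ^ errorExp n q s α *
        (1 + ∫ z, ‖Du (x + r • z)‖ ^ s ∂(unitAvg n)) := by
  have hs0 : 0 < s := by linarith
  have hm : Measurable fun z : Vec n => x + r • z := by fun_prop
  have hVm : AEStronglyMeasurable (fun z => u (x + r • z)) (unitAvg n) :=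
    (hum.comp_measurable hm).aestronglyMeasurable
  have hDm' : AEStronglyMeasurable (fun z => Du (x + r • z)) (unitAvg n) :=
    (hDm.comp_measurable hm).aestronglyMeasurable
  have hVs := ae_unitAvg_of_ae x hr hxB hs
  have hVco := ae_unitAvg_of_ae x hr hxB hco
  have hDs' : Integrable (fun z => ‖Du (x + r • z)‖ ^ s) (unitAvg n) :=
    integrable_unitAvg x hr hxB hDs
  have hDp' : Integrable (fun z => ‖Du (x + r • z)‖ ^ p) (unitAvg n) :=
    integrable_unitAvg x hr hxB hDp
  have hG' : Integrable (fun z => f (x + r • z) (Du (x + r • z)) - f (x + r • z) 0) (unitAvg n) :=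
    integrable_unitAvg x hr hxB hG
  have hD2 : MemLp (fun z => Du (x + r • z)) 2 (unitAvg n) := by
    have h1 := (memLp_of_integrable_rpow hDm' hs0 hDs').mono_exponent
      (p := ENNReal.ofReal 2) (ENNReal.ofReal_le_ofReal (by linarith))
    rwa [ENNReal.ofReal_ofNat] at h1
  set M := ∫ z, ‖Du (x + r • z)‖ ^ s ∂(unitAvg n) with hMdef
  have hM0 : 0 ≤ M := integral_nonneg fun z => by positivity
  have hMW : M ≤ W * (r ^ n)⁻¹ := by
    refine (integral_unitAvg_le (h := fun y => ‖Du y‖ ^ s) (fun y => by positivity) x hr hxB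
      hDs).trans ?_
    rw [mul_right_comm]
    gcongr
  set A := M ^ (1 / s) with hA
  have hA0 : 0 ≤ A := by positivity
  have hA1 := integral_norm_le_rpow_mean hDm' (by linarith : 1 ≤ s) hDs'
  have hA2 := integral_sq_le_rpow_mean hDm' (by linarith : 2 ≤ s) hDs'
  have hrA : r * A ≤ W ^ (1 / p) * r ^ α := mean_radius_le hnp hr hr1 hW1 hps hαp hM0 hMW
  set P : ℝ := 2 ^ (n + 2) * (r * A) with hPdef
  have hP0 : 0 ≤ P := by positivity
  have hPle : P ≤ 2 ^ (n + 2) * (W ^ (1 / p) * r ^ α) := by rw [hPdef]; gcongr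
  -- The exponent n + 3 in the smallness condition is one more than in P; the extra factor 2 keeps
  -- the mean at norm above 1/2.
  have hP1 : P ≤ 1 / 2 := by
    have : (2:ℝ) ^ (n + 3) = 2 * 2 ^ (n + 2) := by ring
    rw [this] at hrW
    linarith
  have hPoin : ∫⁻ z', ∫⁻ z, ‖u (x + r • z) - u (x + r • z')‖ₑ ^ 2 ∂(unitAvg n) ∂(unitAvg n) ≤
      ENNReal.ofReal (P ^ 2) := by
    refine (ha.poincare hDm hr hxB).trans ?_
    have e : ∫⁻ z, ‖Du (x + r • z)‖ₑ ^ 2 ∂(unitAvg n) =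
        ENNReal.ofReal (∫ z, ‖Du (x + r • z)‖ ^ 2 ∂(unitAvg n)) := by
      rw [ofReal_integral_eq_lintegral_ofReal (hD2.integrable_norm_pow two_ne_zero)
        (Eventually.of_forall fun z => by positivity)]
      refine lintegral_congr fun z => ?_
      rw [ENNReal.ofReal_pow (norm_nonneg _), ofReal_norm]
    rw [e, ← ENNReal.ofReal_mul (by positivity)]
    refine ENNReal.ofReal_le_ofReal ?_
    have h2 : (1:ℝ) ≤ 2 ^ (n + 2) := one_le_pow₀ (by norm_num)
    calc 2 ^ (n + 2) * r ^ 2 * ∫ z, ‖Du (x + r • z)‖ ^ 2 ∂(unitAvg n)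
        ≤ 2 ^ (n + 2) * r ^ 2 * A ^ 2 := by gcongr
      _ = 2 ^ (n + 2) * (r * A) ^ 2 := by ring
      -- The Poincaré constant is squared only to obtain a perfect square.
      _ ≤ (2 ^ (n + 2) * 2 ^ (n + 2)) * (r * A) ^ 2 := by
          gcongr
          nlinarith
      _ = P ^ 2 := by rw [hPdef]; ring
  obtain ⟨hv, hζ⟩ := norm_lmul_proj_mean_sub_le hVm hVs hVco hD2 hA0 hP0 hP1 hA2 hPoin hg
  refine ⟨hv, ?_⟩
  have hyΩ : ∀ᵐ z ∂(unitAvg n), x + r • z ∈ Ω := by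
    filter_upwards [ae_unitAvg_norm_lt] with z hz
    refine hBΩ (hxB ?_)
    rw [Metric.mem_ball, dist_eq_norm, add_sub_cancel_left, norm_smul, Real.norm_of_nonneg hr.le]
    nlinarith
  have hsm : MeasurableSet {y | lam < ‖Du y‖} := measurableSet_lt measurable_const hDm.norm.measurable
  set H : Vec n → ℝ := {y | lam < ‖Du y‖}.indicator (fun y => ‖Du y‖ ^ p) with hH
  have hHi : Integrable (fun z => H (x + r • z)) (unitAvg n) :=
    integrable_unitAvg x hr hxB (hDp.indicator hsm)
  have hEn := hf.energy_mean_le hp hpq hC hσ (hBΩ (hxB (Metric.mem_ball_self hr))) hr.le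
    (hD2.integrable one_le_two) hA1 hyΩ hG' (by positivity) (by linarith) hζ
    (H := fun z => 2⁻¹ ^ p * (b * H (x + r • z))) ((hHi.const_mul _).const_mul _) ?_
  · rw [integral_const_mul, integral_const_mul, ← mul_assoc] at hEn
    refine hEn.trans ?_
    refine add_le_add_right ?_ _
    exact error_le hC hr hr1 hασ hW1 hs0 hsq hM0 hMW (norm_nonneg g) hgL hP0 hPle
  · refine Eventually.of_forall fun z => ?_
    rcases hb with rfl | ⟨rfl, hb⟩
    · simp only [zero_mul, mul_zero]; positivity
    · by_cases hz : lam < ‖Du (x + r • z)‖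
      · have e : H (x + r • z) = ‖Du (x + r • z)‖ ^ p := indicator_of_mem (s := {y | lam < ‖Du y‖}) hz _
        rw [one_mul, e]
        exact rpow_norm_le_sub (by linarith) hb hz
      · have e : H (x + r • z) = 0 := indicator_of_notMem (s := {y | lam < ‖Du y‖}) hz _
        rw [e]; simp only [mul_zero]; positivity

end PointEnergy

/-! ### The integrated energy inequality -/

section Excess

variable {N n : ℕ} {p q σ C μ α : ℝ} {Ω : Set (Vec n)} {f : Vec n → Mat N n → ℝ}
  {x₀ : Vec n} {R : ℝ} {u : Vec n → Vec N} {Du : Vec n → Mat N n}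

/-- A Borel measurable constrained minimizer on a ball and its concentric balls. -/
structure IsBallMinimizer (p q σ C μ : ℝ) (Ω : Set (Vec n)) (f : Vec n → Mat N n → ℝ)
    (x₀ : Vec n) (R : ℝ) (u : Vec n → Vec N) (Du : Vec n → Mat N n) : Prop where
  admissible : IsAdmissible p q σ C μ Ω f
  isOpen : IsOpen Ω
  subset : Metric.closedBall x₀ R ⊆ Ω
  measurable : StronglyMeasurable u
  measurable_grad : StronglyMeasurable Du
  norm_eq : ∀ᵐ x ∂(volume.restrict (Metric.ball x₀ R)), ‖u x‖ = 1
  approx : ∃ U h, IsSmoothApprox (Metric.ball x₀ R) u Du U h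
  integrable : IntegrableOn (fun x => f x (Du x)) (Metric.ball x₀ R)
  le : ∀ R₁ ≤ R, ∀ (v : Vec n → Vec N) (Dv : Vec n → Mat N n),
    MemW1Sphere (Metric.ball x₀ R₁) 1 v Dv →
    MemW1Zero (Metric.ball x₀ R₁) (fun x => v x - u x) (fun x => Dv x - Du x) →
    ∫⁻ x in Metric.ball x₀ R₁, ENNReal.ofReal (f x (Du x)) ≤
      ∫⁻ x in Metric.ball x₀ R₁, ENNReal.ofReal (f x (Dv x))

namespace IsBallMinimizer

variable (hu : IsBallMinimizer p q σ C μ Ω f x₀ R u Du)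
include hu

lemma ball_subset : Metric.ball x₀ R ⊆ Ω := Metric.ball_subset_closedBall.trans hu.subset

lemma mono {R₁ : ℝ} (h : R₁ ≤ R) : IsBallMinimizer p q σ C μ Ω f x₀ R₁ u Du := by
  have hb := Metric.ball_subset_ball (x := x₀) h
  obtain ⟨U, H, hU⟩ := hu.approx
  have hlin : ∀ F : Vec n → ENNReal, ∫⁻ x in Metric.ball x₀ R₁, F x ≤ ∫⁻ x in Metric.ball x₀ R, F x :=
    fun F => lintegral_mono_set hb
  exact ⟨hu.admissible, hu.isOpen, (Metric.closedBall_subset_closedBall h).trans hu.subset,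
    hu.measurable, hu.measurable_grad, ae_mono (Measure.restrict_mono hb le_rfl) hu.norm_eq,
    ⟨U, H, ⟨hU.contDiff, hU.hasCompactSupport,
      ae_mono (Measure.restrict_mono hb le_rfl) hU.ae_tendsto,
      tendsto_of_tendsto_of_tendsto_of_le_of_le tendsto_const_nhds hU.tendsto
        (fun _ => zero_le) fun k => hlin _,
      tendsto_of_tendsto_of_tendsto_of_le_of_le tendsto_const_nhds hU.tendsto_grad
        (fun _ => zero_le) fun k => hlin _,
      fun k x hx => hU.sq_le k x (hb hx), hU.measurable_sq,
      tendsto_of_tendsto_of_tendsto_of_le_of_le tendsto_const_nhds hU.tendsto_sq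
        (fun _ => zero_le) fun k => hlin _⟩⟩,
    hu.integrable.mono_set hb, fun R₂ h₂ => hu.le R₂ (h₂.trans h)⟩

lemma integrable_rpow :
    IntegrableOn (fun y => ‖Du y‖ ^ p) (Metric.ball x₀ R) := by
  refine hu.integrable.mono' (hu.measurable_grad.norm.measurable.pow_const p).aestronglyMeasurable ?_
  rw [ae_restrict_iff' Metric.isOpen_ball.measurableSet]
  refine Eventually.of_forall fun x hx => ?_
  rw [Real.norm_of_nonneg (by positivity)]
  exact (hu.admissible.growth x (hu.ball_subset hx) _).1

lemma integral_rpow_le :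
    ∫ y in Metric.ball x₀ R, ‖Du y‖ ^ p ≤ ∫ y in Metric.ball x₀ R, f y (Du y) := by
  refine integral_mono_ae hu.integrable_rpow hu.integrable ?_
  rw [EventuallyLE, ae_restrict_iff' Metric.isOpen_ball.measurableSet]
  exact Eventually.of_forall fun x hx => (hu.admissible.growth x (hu.ball_subset hx) _).1

lemma integrable_apply_zero (hq : 0 < q) : IntegrableOn (fun y => f y 0) (Metric.ball x₀ R) := by
  have : IsFiniteMeasure (volume.restrict (Metric.ball x₀ R)) := ⟨by simp [measure_ball_lt_top]⟩
  refine Integrable.of_bound (((hu.admissible.aemeasurable 0).mono_measure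
    (Measure.restrict_mono hu.ball_subset le_rfl)).aestronglyMeasurable) C ?_
  rw [ae_restrict_iff' Metric.isOpen_ball.measurableSet]
  refine Eventually.of_forall fun x hx => ?_
  rw [Real.norm_of_nonneg (hu.admissible.nonneg (hu.ball_subset hx) _)]
  exact hu.admissible.apply_zero_le hq (hu.ball_subset hx)

lemma integrable_sub (hq : 0 < q) :
    IntegrableOn (fun y => f y (Du y) - f y 0) (Metric.ball x₀ R) :=
  hu.integrable.sub (hu.integrable_apply_zero hq)

lemma integrable_grad (hp : 1 ≤ p) : IntegrableOn Du (Metric.ball x₀ R) := by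
  have : IsFiniteMeasure (volume.restrict (Metric.ball x₀ R)) := ⟨by simp [measure_ball_lt_top]⟩
  have h1 := memLp_of_integrable_rpow hu.measurable_grad.aestronglyMeasurable (by linarith)
    hu.integrable_rpow
  exact h1.integrable (by simpa using hp)

lemma integrable_self : IntegrableOn u (Metric.ball x₀ R) := by
  have : IsFiniteMeasure (volume.restrict (Metric.ball x₀ R)) := ⟨by simp [measure_ball_lt_top]⟩
  exact Integrable.of_bound hu.measurable.aestronglyMeasurable 1 (hu.norm_eq.mono fun x hx => hx.le)

lemma coact_eq_zero (hp : 1 ≤ p) :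
    ∀ᵐ x ∂(volume.restrict (Metric.ball x₀ R)), coact (u x) (Du x) = 0 := by
  obtain ⟨U, h, ha⟩ := hu.approx
  exact ha.coact_eq_zero Metric.isOpen_ball measure_ball_lt_top.ne hu.integrable_self
    (hu.integrable_grad hp) hu.norm_eq

variable {R' l ε L W s lam ρ : ℝ} {τ : Vec n → ℝ}

/-- The pointwise energy inequality for the projected average with variable radius. -/
lemma energy_competitor_le (hp : 2 ≤ p) (hnp : (n:ℝ) < p) (hpq : p ≤ q) (hC : 1 ≤ C) (hα : 0 < α)
    (hασ : α ≤ σ) (hαp : α ≤ 1 - n / p) (hτ : IsRadius x₀ R R' l τ)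
    (hL : ∀ x, ‖gradient τ x‖ ≤ L * τ x ^ α) (hL0 : 0 ≤ L) (hτε : ∀ x, τ x ≤ ε) (hε0 : 0 < ε)
    (hε1 : ε ≤ 1) (hρ : ∀ x ∈ Metric.ball x₀ ρ, τ x = ε)
    (hps : p ≤ s) (hsq : s ≤ q) (hDs : IntegrableOn (fun y => ‖Du y‖ ^ s) (Metric.ball x₀ R))
    (hW1 : 1 ≤ W) (hW : unitVolInv n * ∫ y in Metric.ball x₀ R, ‖Du y‖ ^ s ≤ W)
    (hεW : 2 ^ (n + 3) * (W ^ (1 / p) * ε ^ α) ≤ 1) (hκ : 0 ≤ errorExp n q s α)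
    (hlam : ∀ x ∈ Metric.ball x₀ ρ, ‖∫ z, Du (x + ε • z) ∂(unitAvg n)‖ ≤ lam / 2) :
    ∀ᵐ x ∂(volume.restrict (Metric.ball x₀ R)), 1 / 2 < ‖avg τ u x‖ ∧
      f x (lmul (fderiv ℝ proj (avg τ u x)) (avgGrad τ Du x)) - f x 0 +
      convexConst p C * 2⁻¹ ^ p * ((Metric.ball x₀ ρ).indicator 1 x *
        ∫ z, {y | lam < ‖Du y‖}.indicator (fun y => ‖Du y‖ ^ p) (x + τ x • z) ∂(unitAvg n)) ≤
      ∫ z, (f (x + τ x • z) (Du (x + τ x • z)) - f (x + τ x • z) 0) ∂(unitAvg n) +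
      errorConst n p q s C L W * ε ^ errorExp n q s α *
        (1 + ∫ z, ‖Du (x + τ x • z)‖ ^ s ∂(unitAvg n)) := by
  obtain ⟨U, h, ha⟩ := hu.approx
  have hco := hu.coact_eq_zero (by linarith)
  have hE := errorConst_nonneg (n := n) (p := p) (q := q) (s := s) hC hL0 hW1
  filter_upwards [hu.norm_eq, hco] with x hx1 hx2
  have hint : 0 ≤ ∫ z, ‖Du (x + τ x • z)‖ ^ s ∂(unitAvg n) :=
    integral_nonneg fun z => by positivity
  -- Where τ = 0, the bound |∇τ| ≤ Lτ^α gives ∇τ = 0, so the competitor and its gradient agree with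
  -- u and Du and the gain is absent.
  rcases (hτ.nonneg x).eq_or_lt with h0 | h0
  · have hb : (Metric.ball x₀ ρ).indicator (1 : Vec n → ℝ) x = 0 :=
      indicator_of_notMem (fun hx => by have := hρ x hx; linarith) _
    have hg : gradient τ x = 0 := by
      have := hL x
      rw [← h0, Real.zero_rpow hα.ne', mul_zero] at this
      exact norm_le_zero_iff.1 this
    have hsh : ∀ (Z : Mat N n) (z : Vec n), shear Z z 0 = Z := fun Z z => by
      have : tens (act Z z) (0 : Vec n) = 0 := by ext ij; simp [tens]
      rw [shear, this, add_zero]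
    have ev : avg τ u x = u x := by simp [avg, ← h0]
    have eD : avgGrad τ Du x = Du x := by simp [avgGrad, hg, hsh, ← h0]
    rw [ev, eD, hb, lmul_fderiv_proj_of_coact_eq_zero hx1 hx2, hx1]
    refine ⟨by norm_num, ?_⟩
    have : 0 ≤ errorConst n p q s C L W * ε ^ errorExp n q s α *
        (1 + ∫ z, ‖Du (x + τ x • z)‖ ^ s ∂(unitAvg n)) := by positivity
    rw [← h0] at this ⊢
    simp only [zero_smul, add_zero, integral_const, probReal_univ, one_smul, zero_mul,
      mul_zero] at this ⊢
    linarith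
  · have hlt := hτε x
    have hgr : ‖gradient τ x‖ ≤ 1 / 2 := (hτ.norm_gradient_le x).trans hτ.le_half
    have hrα : τ x ^ α ≤ ε ^ α := Real.rpow_le_rpow h0.le hlt hα.le
    obtain ⟨h1, h2⟩ := hu.admissible.energy_proj_avg_le (lam := lam)
      (b := (Metric.ball x₀ ρ).indicator 1 x) hp hnp hpq hC (hα.le.trans hασ)
      hασ hαp hu.ball_subset ha hu.measurable hu.measurable_grad hu.norm_eq hco
      (hu.integrable_sub (by linarith)) hps hsq hDs hu.integrable_rpow hW1 hW h0
      (hlt.trans hε1) (hτ.ball_subset x h0) (hεW.trans' (by gcongr)) hgr (hL x) (by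
        by_cases hxρ : x ∈ Metric.ball x₀ ρ
        · exact Or.inr ⟨indicator_of_mem hxρ _, by rw [hρ x hxρ]; exact hlam x hxρ⟩
        · exact Or.inl (indicator_of_notMem hxρ _))
    refine ⟨h1, h2.trans ?_⟩
    have : τ x ^ errorExp n q s α ≤ ε ^ errorExp n q s α := Real.rpow_le_rpow h0.le hlt hκ
    gcongr

end IsBallMinimizer
end Excess

/-! ### Integration of the pointwise inequality and use of minimality. -/

section Excess

variable {N n : ℕ} {p q σ C μ α : ℝ} {Ω : Set (Vec n)} {f : Vec n → Mat N n → ℝ}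
  {x₀ : Vec n} {R : ℝ} {u : Vec n → Vec N} {Du : Vec n → Mat N n}

/-- For each |z| < 1 the larger ball contains the smaller one translated by -εz. This recovers the
integral over a fixed ball from the averaged gain. -/
lemma lintegral_ball_shift_le {ρ ρ₁ ε : ℝ} (hε : 0 ≤ ε) (hρ : ρ + ε ≤ ρ₁) {h : Vec n → ENNReal}
    (hh : Measurable h) :
    ∫⁻ y in Metric.ball x₀ ρ, h y ≤
      ∫⁻ x in Metric.ball x₀ ρ₁, ∫⁻ z, h (x + ε • z) ∂(unitAvg n) := by
  have hm : Measurable fun p : Vec n × Vec n => p.1 + ε • p.2 := by fun_prop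
  rw [lintegral_lintegral_swap (f := fun x z => h (x + ε • z)) (hh.comp hm).aemeasurable]
  calc ∫⁻ y in Metric.ball x₀ ρ, h y
      = ∫⁻ _, (∫⁻ y in Metric.ball x₀ ρ, h y) ∂(unitAvg n) := by simp
    _ ≤ _ := by
        refine lintegral_mono_ae ?_
        filter_upwards [ae_unitAvg_norm_lt] with z hz
        have e : ∫⁻ x in Metric.ball x₀ ρ₁, h (x + ε • z) =
            ∫⁻ x, (Metric.ball x₀ ρ₁).indicator (fun x => h (x + ε • z)) x :=
          (lintegral_indicator Metric.isOpen_ball.measurableSet _).symm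
        rw [e, ← lintegral_indicator Metric.isOpen_ball.measurableSet,
          ← lintegral_add_right_eq_self ((Metric.ball x₀ ρ).indicator h) (ε • z)]
        refine lintegral_mono fun x => ?_
        by_cases hx : x + ε • z ∈ Metric.ball x₀ ρ
        · have hx' : x ∈ Metric.ball x₀ ρ₁ := by
            rw [mem_ball_iff_norm] at hx ⊢
            have h1 : ‖ε • z‖ ≤ ε := by
              rw [norm_smul, Real.norm_of_nonneg hε]; nlinarith
            have h2 : x - x₀ = (x + ε • z - x₀) - ε • z := by abel
            rw [h2]
            linarith [norm_sub_le (x + ε • z - x₀) (ε • z)]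
          rw [indicator_of_mem hx, indicator_of_mem hx']
        · rw [indicator_of_notMem hx]; exact zero_le

namespace IsBallMinimizer

variable (hu : IsBallMinimizer p q σ C μ Ω f x₀ R u Du)
include hu

variable {R' l ε L W s lam ρ ρ₁ : ℝ} {τ : Vec n → ℝ}

/-- Minimality against the projected average. -/
lemma lintegral_energy_le (hp : 1 ≤ p) (hq : 0 < q) (hτ : IsRadius x₀ R R' l τ)
    (hv : ∀ᵐ x ∂(volume.restrict (Metric.ball x₀ R)), 1 / 2 < ‖avg τ u x‖) :
    ∫⁻ x in Metric.ball x₀ R, ENNReal.ofReal (f x (Du x) - f x 0 + C) ≤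
      ∫⁻ x in Metric.ball x₀ R, ENNReal.ofReal
        (f x (lmul (fderiv ℝ proj (avg τ u x)) (avgGrad τ Du x)) - f x 0 + C) := by
  obtain ⟨U, h, ha⟩ := hu.approx
  obtain ⟨c1, c2⟩ := ha.competitor hτ hu.measurable hu.measurable_grad hu.integrable_self
    (hu.integrable_grad hp) hu.norm_eq hv
  have h1 := hu.le R le_rfl _ _ c1 c2
  have hbm : AEMeasurable (fun x => ENNReal.ofReal (C - f x 0)) (volume.restrict (Metric.ball x₀ R)) :=
    (aemeasurable_const.sub (hu.integrable_apply_zero hq).aemeasurable).ennreal_ofReal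
  have e : ∀ Z : Vec n → Mat N n, ∫⁻ x in Metric.ball x₀ R, ENNReal.ofReal (f x (Z x) - f x 0 + C) =
      (∫⁻ x in Metric.ball x₀ R, ENNReal.ofReal (f x (Z x))) +
        ∫⁻ x in Metric.ball x₀ R, ENNReal.ofReal (C - f x 0) := by
    intro Z
    rw [← lintegral_add_right' _ hbm]
    refine setLIntegral_congr_fun Metric.isOpen_ball.measurableSet fun x hx => ?_
    have hx' := hu.ball_subset hx
    rw [← ENNReal.ofReal_add (hu.admissible.nonneg hx' _)
      (by linarith [hu.admissible.apply_zero_le hq hx'])]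
    congr 1; ring
  rw [e, e]
  exact add_le_add_left h1 _

/-- The integrated energy inequality. -/
lemma lintegral_superlevel_le (hp : 2 ≤ p) (hnp : (n:ℝ) < p) (hpq : p ≤ q) (hC : 1 ≤ C) (hα : 0 < α)
    (hασ : α ≤ σ) (hαp : α ≤ 1 - n / p) (hτ : IsRadius x₀ R R' l τ)
    (hL : ∀ x, ‖gradient τ x‖ ≤ L * τ x ^ α) (hL0 : 0 ≤ L) (hτε : ∀ x, τ x ≤ ε) (hε0 : 0 < ε)
    (hε1 : ε ≤ 1) (hρ₁ : ∀ x ∈ Metric.ball x₀ ρ₁, τ x = ε) (hρ : ρ + ε ≤ ρ₁)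
    (hps : p ≤ s) (hsq : s ≤ q) (hDs : IntegrableOn (fun y => ‖Du y‖ ^ s) (Metric.ball x₀ R))
    (hW1 : 1 ≤ W) (hW : unitVolInv n * ∫ y in Metric.ball x₀ R, ‖Du y‖ ^ s ≤ W)
    (hεW : 2 ^ (n + 3) * (W ^ (1 / p) * ε ^ α) ≤ 1) (hκ : 0 ≤ errorExp n q s α)
    (hlam : ∀ x ∈ Metric.ball x₀ ρ₁, ‖∫ z, Du (x + ε • z) ∂(unitAvg n)‖ ≤ lam / 2) :
    convexConst p C * 2⁻¹ ^ p *
      ∫ y in Metric.ball x₀ ρ, {y | lam < ‖Du y‖}.indicator (fun y => ‖Du y‖ ^ p) y ≤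
      2 * l * (∫ y in Metric.ball x₀ R, (f y (Du y) - f y 0 + C)) +
      errorConst n p q s C L W * ε ^ errorExp n q s α *
        (volume.real (Metric.ball x₀ R) + 2 * ∫ y in Metric.ball x₀ R, ‖Du y‖ ^ s) := by
  have hpt := hu.energy_competitor_le hp hnp hpq hC hα hασ hαp hτ hL hL0 hτε hε0 hε1 hρ₁ hps hsq hDs
    hW1 hW hεW hκ hlam
  have hmin := hu.lintegral_energy_le (by linarith) (by linarith) hτ (hpt.mono fun x hx => hx.1)
  have hfin : IsFiniteMeasure (volume.restrict (Metric.ball x₀ R)) :=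
    ⟨by simp [measure_ball_lt_top]⟩
  have hE := errorConst_nonneg (n := n) (p := p) (q := q) (s := s) hC hL0 hW1
  have hk := convexConst_pos hp hC
  set B := Metric.ball x₀ R with hB
  set c₁ := convexConst p C * 2⁻¹ ^ p with hc₁
  set K := errorConst n p q s C L W * ε ^ errorExp n q s α with hK
  have hK0 : 0 ≤ K := by positivity
  have hc0 : 0 ≤ c₁ := by positivity
  have hsm : MeasurableSet {y | lam < ‖Du y‖} :=
    measurableSet_lt measurable_const hu.measurable_grad.norm.measurable
  set H : Vec n → ℝ := {y | lam < ‖Du y‖}.indicator (fun y => ‖Du y‖ ^ p) with hH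
  have hHm : Measurable H := (hu.measurable_grad.norm.measurable.pow_const p).indicator hsm
  have hH0 : ∀ y, 0 ≤ H y := fun y => indicator_nonneg (fun y _ => by positivity) y
  have hHi : IntegrableOn H B := hu.integrable_rpow.indicator hsm
  have hSm : Measurable fun y => ENNReal.ofReal (‖Du y‖ ^ s) :=
    (hu.measurable_grad.norm.measurable.pow_const s).ennreal_ofReal
  -- As f(y,0) ≤ C, adding C makes the normalized energy nonnegative, so the comparison can be made
  -- with lower integrals and needs no prior integrability of the competitor's energy.
  have hGi : IntegrableOn (fun y => f y (Du y) - f y 0 + C) B :=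
    (hu.integrable_sub (by linarith)).add (integrable_const C)
  have hG0 : ∀ y ∈ B, 0 ≤ f y (Du y) - f y 0 + C := fun y hy => by
    have := hu.admissible.apply_zero_le (by linarith) (hu.ball_subset hy)
    have := hu.admissible.nonneg (hu.ball_subset hy) (Du y)
    linarith
  -- Tonelli for G(x + τ(x)z) needs a genuinely measurable integrand, while y ↦ f(y, Du(y)) is only
  -- a.e. measurable.
  set G := hGi.1.mk _ with hGdef
  have hGae : ∀ᵐ y ∂(volume.restrict B), f y (Du y) - f y 0 + C = G y := hGi.1.ae_eq_mk
  have hGm : Measurable G := hGi.1.stronglyMeasurable_mk.measurable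
  have hGae0 : ∀ᵐ y ∂(volume.restrict B), 0 ≤ G y := by
    filter_upwards [hGae, ae_restrict_mem Metric.isOpen_ball.measurableSet] with y hy hyB
    rw [← hy]; exact hG0 y hyB
  have hGi' : IntegrableOn G B := hGi.congr hGae
  have hmain : ∀ᵐ x ∂(volume.restrict B), ENNReal.ofReal
        (f x (lmul (fderiv ℝ proj (avg τ u x)) (avgGrad τ Du x)) - f x 0 + C) +
      ENNReal.ofReal c₁ * (Metric.ball x₀ ρ₁).indicator
        (fun x => ∫⁻ z, ENNReal.ofReal (H (x + ε • z)) ∂(unitAvg n)) x ≤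
      ∫⁻ z, ENNReal.ofReal (G (x + τ x • z)) ∂(unitAvg n) + ENNReal.ofReal K *
        (1 + ∫⁻ z, ENNReal.ofReal (‖Du (x + τ x • z)‖ ^ s) ∂(unitAvg n)) := by
    filter_upwards [hpt, ae_ae_unitAvg hτ hGae, ae_ae_unitAvg hτ hGae0,
      ae_restrict_mem Metric.isOpen_ball.measurableSet] with x hx hxG hxG0 hxB
    have hxi := hτ.integrable_add x hGi'
    have hxs := hτ.integrable_add x hDs
    have hxh := hτ.integrable_add x hHi
    have eG : ∫ z, G (x + τ x • z) ∂(unitAvg n) =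
        ∫ z, (f (x + τ x • z) (Du (x + τ x • z)) - f (x + τ x • z) 0) ∂(unitAvg n) + C := by
      rw [← integral_congr_ae hxG, integral_add (hτ.integrable_add x (hu.integrable_sub (by linarith)))
        (integrable_const C)]
      simp
    rw [← ofReal_integral_eq_lintegral_ofReal hxi hxG0,
      ← ofReal_integral_eq_lintegral_ofReal hxs (Eventually.of_forall fun z => by positivity),
      ← ENNReal.ofReal_one, ← ENNReal.ofReal_add zero_le_one
        (integral_nonneg fun z => by positivity), ← ENNReal.ofReal_mul hK0,
      ← ENNReal.ofReal_add (integral_nonneg_of_ae hxG0)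
        (mul_nonneg hK0 (add_nonneg zero_le_one (integral_nonneg fun z => by positivity)))]
    have eI : ENNReal.ofReal c₁ * (Metric.ball x₀ ρ₁).indicator
        (fun x => ∫⁻ z, ENNReal.ofReal (H (x + ε • z)) ∂(unitAvg n)) x =
        ENNReal.ofReal (c₁ * ((Metric.ball x₀ ρ₁).indicator 1 x *
          ∫ z, H (x + τ x • z) ∂(unitAvg n))) := by
      by_cases hxρ : x ∈ Metric.ball x₀ ρ₁
      · rw [indicator_of_mem hxρ, indicator_of_mem hxρ, ENNReal.ofReal_mul hc0,
          ← hρ₁ x hxρ, Pi.one_apply, one_mul,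
          ofReal_integral_eq_lintegral_ofReal hxh (Eventually.of_forall fun z => hH0 _)]
      · rw [indicator_of_notMem hxρ, indicator_of_notMem hxρ]; simp
    have hI0 : 0 ≤ c₁ * ((Metric.ball x₀ ρ₁).indicator 1 x *
          ∫ z, H (x + τ x • z) ∂(unitAvg n)) :=
      mul_nonneg hc0 (mul_nonneg (indicator_nonneg (fun _ _ => zero_le_one) _)
        (integral_nonneg fun z => hH0 _))
    have hF0 : 0 ≤ f x (lmul (fderiv ℝ proj (avg τ u x)) (avgGrad τ Du x)) - f x 0 + C := by
      have := hu.admissible.apply_zero_le (by linarith) (hu.ball_subset hxB)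
      have := hu.admissible.nonneg (hu.ball_subset hxB)
        (lmul (fderiv ℝ proj (avg τ u x)) (avgGrad τ Du x))
      linarith
    rw [eI, ← ENNReal.ofReal_add hF0 hI0]
    refine ENNReal.ofReal_le_ofReal ?_
    rw [eG]
    linarith [hx.2]
  have hm : Measurable fun p : Vec n × Vec n => p.1 + ε • p.2 := by fun_prop
  have hτc := hτ.contDiff.continuous
  have hmτ : Measurable fun p : Vec n × Vec n => p.1 + τ p.1 • p.2 := by fun_prop
  have hm1 : Measurable fun x => ∫⁻ z, ENNReal.ofReal (H (x + ε • z)) ∂(unitAvg n) :=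
    (hHm.ennreal_ofReal.comp hm).lintegral_prod_right'
  have hm2 : Measurable fun x => ∫⁻ z, ENNReal.ofReal (‖Du (x + τ x • z)‖ ^ s) ∂(unitAvg n) :=
    (hSm.comp hmτ).lintegral_prod_right'
  have hm3 : Measurable fun x => 1 + ∫⁻ z, ENNReal.ofReal (‖Du (x + τ x • z)‖ ^ s) ∂(unitAvg n) :=
    measurable_const.add hm2
  have hρB : Metric.ball x₀ ρ₁ ⊆ B := fun x hx => by
    have h1 : 0 < τ x := by rw [hρ₁ x hx]; exact hε0
    exact hτ.ball_subset x h1 (Metric.mem_ball_self h1)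
  have hInt := lintegral_mono_ae hmain
  rw [lintegral_add_right _ ((hm1.indicator Metric.isOpen_ball.measurableSet).const_mul _),
    lintegral_add_right _ (hm3.const_mul _),
    lintegral_const_mul _ (hm1.indicator Metric.isOpen_ball.measurableSet),
    lintegral_const_mul _ hm3,
    lintegral_indicator Metric.isOpen_ball.measurableSet,
    Measure.restrict_restrict Metric.isOpen_ball.measurableSet, inter_eq_left.2 hρB,
    lintegral_add_left measurable_const] at hInt
  have hl := hτ.l_nonneg
  have hl2 := hτ.le_half
  have hl3 : 0 ≤ (1 - l)⁻¹ := inv_nonneg.2 (by linarith)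
  have hGe : ∫⁻ x in B, ENNReal.ofReal (f x (Du x) - f x 0 + C) =
      ENNReal.ofReal (∫ y in B, (f y (Du y) - f y 0 + C)) := by
    rw [ofReal_integral_eq_lintegral_ofReal hGi]
    filter_upwards [ae_restrict_mem Metric.isOpen_ball.measurableSet] with y hy
    exact hG0 y hy
  have hGe' : ∫⁻ x in B, ENNReal.ofReal (G x) =
      ENNReal.ofReal (∫ y in B, (f y (Du y) - f y 0 + C)) := by
    rw [← hGe]
    exact lintegral_congr_ae (hGae.mono fun y hy => by simp only [hy])
  have hSe : ∫⁻ x in B, ENNReal.ofReal (‖Du x‖ ^ s) = ENNReal.ofReal (∫ y in B, ‖Du y‖ ^ s) :=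
    (ofReal_integral_eq_lintegral_ofReal hDs (Eventually.of_forall fun z => by positivity)).symm
  have hGint0 : 0 ≤ ∫ y in B, (f y (Du y) - f y 0 + C) :=
    setIntegral_nonneg Metric.isOpen_ball.measurableSet hG0
  have hS0 : 0 ≤ ∫ y in B, ‖Du y‖ ^ s := integral_nonneg fun y => by positivity
  set IG := ∫ y in B, (f y (Du y) - f y 0 + C) with hIG
  set IS := ∫ y in B, ‖Du y‖ ^ s with hIS
  have hHρ : IntegrableOn H (Metric.ball x₀ ρ) :=
    hHi.mono_set ((Metric.ball_subset_ball (by linarith)).trans hρB)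
  have hHe : ∫⁻ x in Metric.ball x₀ ρ, ENNReal.ofReal (H x) =
      ENNReal.ofReal (∫ y in Metric.ball x₀ ρ, H y) :=
    (ofReal_integral_eq_lintegral_ofReal hHρ (Eventually.of_forall hH0)).symm
  have hH0' : 0 ≤ ∫ y in Metric.ball x₀ ρ, H y := integral_nonneg hH0
  have b1 := hτ.lintegral_avg_le hGm.ennreal_ofReal
  have b2 := hτ.lintegral_avg_le_two hSm
  have b3 := lintegral_ball_shift_le (x₀ := x₀) hε0.le hρ hHm.ennreal_ofReal
  rw [hGe', ← ENNReal.ofReal_mul hl3] at b1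
  rw [hSe] at b2
  rw [hHe] at b3
  rw [hGe] at hmin
  have hvol : ∫⁻ _ in B, (1 : ENNReal) = ENNReal.ofReal (volume.real B) := by
    rw [ofReal_measureReal (measure_ball_lt_top.ne)]; simp [hB]
  rw [hvol] at hInt
  have hb2 : (2 : ENNReal) * ENNReal.ofReal IS = ENNReal.ofReal (2 * IS) := by
    rw [ENNReal.ofReal_mul zero_le_two]; simp
  rw [hb2] at b2
  have hfinal : ENNReal.ofReal (IG + c₁ * ∫ y in Metric.ball x₀ ρ, H y) ≤
      ENNReal.ofReal ((1 - l)⁻¹ * IG + K * (volume.real B + 2 * IS)) := by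
    rw [ENNReal.ofReal_add hGint0 (mul_nonneg hc0 hH0'), ENNReal.ofReal_mul hc0,
      ENNReal.ofReal_add (mul_nonneg hl3 hGint0) (by positivity),
      ENNReal.ofReal_mul hK0, ENNReal.ofReal_add measureReal_nonneg (by positivity)]
    calc _ ≤ _ := add_le_add hmin (by gcongr)
      _ ≤ _ := hInt
      _ ≤ _ := by gcongr
  rw [ENNReal.ofReal_le_ofReal_iff (add_nonneg (mul_nonneg hl3 hGint0)
    (by positivity))] at hfinal
  -- The energy of u on the left cancels the 1, leaving only the factor 2l of order ε.
  have hinv : (1 - l)⁻¹ ≤ 1 + 2 * l := by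
    rw [inv_le_iff_one_le_mul₀ (by linarith)]; nlinarith
  nlinarith [mul_le_mul_of_nonneg_right hinv hGint0]

end IsBallMinimizer
end Excess

/-! ### Decay of the gradient on superlevel sets -/

section Decay

variable {n : ℕ} {p q α : ℝ}

lemma volume_real_ball_le (x₀ : Vec n) {R R₀ : ℝ} (h : R ≤ R₀) :
    volume.real (Metric.ball x₀ R) ≤ volume.real (Metric.ball (0 : Vec n) R₀) := by
  rw [measureReal_def, Measure.addHaar_ball_center, ← measureReal_def]
  exact measureReal_mono (Metric.ball_subset_ball h) measure_ball_lt_top.ne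

/-- With `W` and `L` proportional to the energy bound X, all dependence on X is a power, which keeps
the final estimate polynomial in the energy. -/
lemma errorConst_le {s C L K W w X : ℝ} (hp : 1 ≤ p) (hC : 1 ≤ C)
    (hX : 1 ≤ X) (hw : 0 ≤ w) (hW : W = w * X) (hL : L = K * X) :
    errorConst n p q s C L W ≤
      C * 20 ^ (q + 1) * 2 ^ q * (8 * 2 ^ (n + 2) * w ^ (1 / p) + K + 1) * w ^ ((q - s) / s) *
        X ^ (1 + (q - s) / s) := by
  have hX0 : 0 < X := by linarith
  have hXp : X ^ (1 / p) ≤ X := by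
    conv_rhs => rw [← Real.rpow_one X]
    exact Real.rpow_le_rpow_of_exponent_le hX ((div_le_one (by linarith)).2 hp)
  rw [errorConst, hW, hL, Real.mul_rpow hw hX0.le, Real.mul_rpow hw hX0.le, Real.rpow_add hX0,
    Real.rpow_one]
  have h1 : 8 * 2 ^ (n + 2) * (w ^ (1 / p) * X ^ (1 / p)) + K * X + 1 ≤
      (8 * 2 ^ (n + 2) * w ^ (1 / p) + K + 1) * X := by
    have : 8 * 2 ^ (n + 2) * (w ^ (1 / p) * X ^ (1 / p)) ≤ 8 * 2 ^ (n + 2) * (w ^ (1 / p) * X) := by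
      gcongr
    linarith
  calc _ ≤ C * 20 ^ (q + 1) * 2 ^ q * ((8 * 2 ^ (n + 2) * w ^ (1 / p) + K + 1) * X) *
        (w ^ ((q - s) / s) * X ^ ((q - s) / s)) := by gcongr
    _ = _ := by ring

/-- The constraint on the averaging radius, for energies at most `X`. -/
lemma radius_small {K w X e ε : ℝ} (hp : 1 ≤ p) (hα : 0 < α) (hK : 0 < K) (hw : 1 ≤ w) (hX : 1 ≤ X)
    (he : e = min (1 / 3) (min (1 / (2 * K)) ((2 ^ (n + 3) * w ^ (1 / p)) ^ (-(1 / α)))))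
    (hε : 0 < ε) (hεe : ε ≤ e * X ^ (-(1 + 1 / (p * α)))) :
    ε ≤ 1 / 3 * X⁻¹ ∧ ε * (K * X) ≤ 1 / 2 ∧ 2 ^ (n + 3) * ((w * X) ^ (1 / p) * ε ^ α) ≤ 1 := by
  have hX0 : 0 < X := by linarith
  have hpα : 0 < p * α := by positivity
  have he1 : e ≤ 1 / 3 := he ▸ min_le_left _ _
  have he2 : e ≤ 1 / (2 * K) := he ▸ (min_le_right _ _).trans (min_le_left _ _)
  have he3 : e ≤ (2 ^ (n + 3) * w ^ (1 / p)) ^ (-(1 / α)) :=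
    he ▸ (min_le_right _ _).trans (min_le_right _ _)
  have he0 : 0 < e := by
    rw [he]
    exact lt_min (by norm_num) (lt_min (by positivity) (by positivity))
  -- The exponent 1 + 1/(pα) serves two purposes: X⁻¹ handles the support and Lipschitz conditions,
  -- and X^(-1/(pα)) the smallness of (wX)^(1/p) ε^α.
  have h1 : ε ≤ e * X⁻¹ := by
    refine hεe.trans ?_
    gcongr
    rw [← Real.rpow_neg_one]
    exact Real.rpow_le_rpow_of_exponent_le hX (by have : 0 < 1 / (p * α) := by positivity
                                                  linarith)
  have h2 : ε ≤ e * X ^ (-(1 / (p * α))) := by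
    refine hεe.trans ?_
    gcongr ?_ * ?_
    exact Real.rpow_le_rpow_of_exponent_le hX (by linarith)
  refine ⟨h1.trans (by gcongr), ?_, ?_⟩
  · calc ε * (K * X) ≤ (1 / (2 * K) * X⁻¹) * (K * X) := by
          gcongr
          exact h1.trans (by gcongr)
      _ = 1 / 2 := by field_simp
  · set Y : ℝ := 2 ^ (n + 3) * w ^ (1 / p) with hY
    have hY0 : 0 < Y := by positivity
    have h3 : ε ^ α ≤ Y⁻¹ * X ^ (-(1 / p)) := by
      calc ε ^ α ≤ (Y ^ (-(1 / α)) * X ^ (-(1 / (p * α)))) ^ α := by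
            gcongr
            exact h2.trans (by gcongr)
        _ = Y⁻¹ * X ^ (-(1 / p)) := by
            rw [Real.mul_rpow (by positivity) (by positivity), ← Real.rpow_mul hY0.le,
              ← Real.rpow_mul hX0.le, ← Real.rpow_neg_one]
            congr 2 <;> field_simp
    calc 2 ^ (n + 3) * ((w * X) ^ (1 / p) * ε ^ α)
        = Y * X ^ (1 / p) * ε ^ α := by rw [Real.mul_rpow (by linarith) hX0.le, hY]; ring
      _ ≤ Y * X ^ (1 / p) * (Y⁻¹ * X ^ (-(1 / p))) := by gcongr
      _ = 1 := by
          rw [Real.rpow_neg hX0.le]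
          have : X ^ (1 / p) ≠ 0 := by positivity
          field_simp

/-- Jensen's inequality at scale ε. Twice this bound is the threshold beyond which large gradients
are detected, which fixes the relation λ ~ ε^(-n/s). -/
lemma norm_mean_le {N : ℕ} {x : Vec n} {B : Set (Vec n)} {Du : Vec n → Mat N n} {s w X ε : ℝ}
    (hs : 1 ≤ s) (hDm : StronglyMeasurable Du) (hw : unitVolInv n ≤ w) (hε : 0 < ε)
    (hB : Metric.ball x ε ⊆ B) (hDs : IntegrableOn (fun y => ‖Du y‖ ^ s) B)
    (hX : ∫ y in B, ‖Du y‖ ^ s ≤ X) :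
    ‖∫ z, Du (x + ε • z) ∂(unitAvg n)‖ ≤ (w * X) ^ (1 / s) * ε ^ (-(n / s)) := by
  have hs0 : 0 < s := by linarith
  have hm : Measurable fun z : Vec n => x + ε • z := by fun_prop
  have h0 : 0 ≤ ∫ y in B, ‖Du y‖ ^ s := integral_nonneg fun y => by positivity
  have hω := unitVolInv_nonneg (n := n)
  refine (norm_integral_le_integral_norm _).trans ((integral_norm_le_rpow_mean
    (hDm.comp_measurable hm).aestronglyMeasurable hs (integrable_unitAvg x hε hB hDs)).trans ?_)
  calc _ ≤ (unitVolInv n * (ε ^ n)⁻¹ * ∫ y in B, ‖Du y‖ ^ s) ^ (1 / s) := by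
        refine Real.rpow_le_rpow (integral_nonneg fun z => by positivity) ?_ (by positivity)
        exact integral_unitAvg_le (h := fun y => ‖Du y‖ ^ s) (fun y => by positivity) x hε hB hDs
    _ ≤ (w * X * (ε ^ n)⁻¹) ^ (1 / s) := by
        refine Real.rpow_le_rpow (by positivity) ?_ (by positivity)
        rw [mul_right_comm]
        gcongr
        linarith
    _ = _ := by
        rw [Real.mul_rpow (mul_nonneg (by linarith) (by linarith)) (by positivity),
          Real.inv_rpow (by positivity), ← Real.rpow_natCast, ← Real.rpow_mul hε.le,
          ← Real.rpow_neg hε.le]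
        congr 2; ring

/-- The Lipschitz loss is of order ε X², the averaging error of order ε^κ X^(2+r). Since ε ≤ ε^κ and
X ≥ 1, the second form covers both. -/
lemma decay_arith {r ε κ X K C V IG E E₀ v IS : ℝ} (hr0 : 0 ≤ r) (hε : 0 < ε) (hεκ : ε ≤ ε ^ κ)
    (hX : 1 ≤ X) (hK : 0 < K) (hC : 0 ≤ C) (hV : 0 ≤ V) (hIG0 : 0 ≤ IG) (hIG : IG ≤ (1 + C * V) * X)
    (hE0 : 0 ≤ E₀) (hE : E₀ ≤ E * X ^ (1 + r)) (hv0 : 0 ≤ v) (hv : v ≤ V) (hS0 : 0 ≤ IS)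
    (hS : IS ≤ X) :
    2 * (ε * (3 * K * X)) * IG + E₀ * ε ^ κ * (v + 2 * IS) ≤
      (2 * (3 * K) * (1 + C * V) + E * (V + 2)) * (X ^ (2 + r) * ε ^ κ) := by
  have hX0 : 0 < X := by linarith
  have hεκ0 : 0 ≤ ε ^ κ := by positivity
  have hXX : X * X ≤ X ^ (2 + r) := by
    calc X * X = X ^ (2:ℝ) := by rw [Real.rpow_two]; ring
      _ ≤ _ := Real.rpow_le_rpow_of_exponent_le hX (by linarith)
  have hXX2 : X ^ (1 + r) * X = X ^ (2 + r) := by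
    rw [← Real.rpow_add_one hX0.ne']; congr 1; ring
  have b1 : 2 * (ε * (3 * K * X)) * IG ≤
      2 * (3 * K) * (1 + C * V) * (X ^ (2 + r) * ε ^ κ) := by
    calc _ ≤ 2 * (ε ^ κ * (3 * K * X)) * ((1 + C * V) * X) := by gcongr
      _ = 2 * (3 * K) * (1 + C * V) * (X * X * ε ^ κ) := by ring
      _ ≤ _ := by gcongr
  have b2 : E₀ * ε ^ κ * (v + 2 * IS) ≤ E * (V + 2) * (X ^ (2 + r) * ε ^ κ) := by
    have h1 : v + 2 * IS ≤ (V + 2) * X := by nlinarith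
    calc _ ≤ E * X ^ (1 + r) * ε ^ κ * ((V + 2) * X) := by
          apply mul_le_mul _ h1 (by positivity)
          · exact mul_nonneg (hE0.trans hE) hεκ0
          · gcongr
      _ = E * (V + 2) * (X ^ (1 + r) * X * ε ^ κ) := by ring
      _ = _ := by rw [hXX2]
  linarith

namespace IsBallMinimizer

variable {N : ℕ} {σ C μ : ℝ} {Ω : Set (Vec n)} {f : Vec n → Mat N n → ℝ}
  {x₀ : Vec n} {R : ℝ} {u : Vec n → Vec N} {Du : Vec n → Mat N n}
  (hu : IsBallMinimizer p q σ C μ Ω f x₀ R u Du)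
include hu

lemma integral_shifted_nonneg (hq : 0 < q) :
    0 ≤ ∫ y in Metric.ball x₀ R, (f y (Du y) - f y 0 + C) := by
  refine setIntegral_nonneg Metric.isOpen_ball.measurableSet fun y hy => ?_
  have := hu.admissible.apply_zero_le hq (hu.ball_subset hy)
  have := hu.admissible.nonneg (hu.ball_subset hy) (Du y)
  linarith

lemma integral_shifted_le (hq : 0 < q) (hC : 1 ≤ C) {X V : ℝ}
    (hfX : ∫ y in Metric.ball x₀ R, f y (Du y) ≤ X) (hX : 1 ≤ X)
    (hvol : volume.real (Metric.ball x₀ R) ≤ V) :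
    ∫ y in Metric.ball x₀ R, (f y (Du y) - f y 0 + C) ≤ (1 + C * V) * X := by
  have hfin : IsFiniteMeasure (volume.restrict (Metric.ball x₀ R)) :=
    ⟨by simp [measure_ball_lt_top]⟩
  have hV0 : 0 ≤ V := measureReal_nonneg.trans hvol
  have h1 : ∫ y in Metric.ball x₀ R, (f y (Du y) - f y 0 + C) ≤
      ∫ y in Metric.ball x₀ R, (f y (Du y) + C) := by
    refine integral_mono_ae ((hu.integrable_sub hq).add (integrable_const C))
      (hu.integrable.add (integrable_const C)) ?_
    filter_upwards [ae_restrict_mem Metric.isOpen_ball.measurableSet] with y hy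
    have := hu.admissible.nonneg (hu.ball_subset hy) 0
    linarith
  have h2 : ∫ y in Metric.ball x₀ R, (f y (Du y) + C) =
      (∫ y in Metric.ball x₀ R, f y (Du y)) + C * volume.real (Metric.ball x₀ R) := by
    rw [integral_add hu.integrable (integrable_const C)]
    simp [mul_comm]
  have h3 : C * volume.real (Metric.ball x₀ R) ≤ C * V := by gcongr
  nlinarith [mul_nonneg (by linarith : 0 ≤ C) hV0]

end IsBallMinimizer

lemma errorExp_le_one {s : ℝ} (hs : 0 < s) (hsq : s ≤ q) (hα1 : α ≤ 1) : errorExp n q s α ≤ 1 := by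
  have : 0 ≤ (n:ℝ) * ((q - s) / s) := mul_nonneg (Nat.cast_nonneg n) (div_nonneg (by linarith) hs.le)
  rw [errorExp]; linarith

set_option maxHeartbeats 800000 in
/-- Decay of the `p`-energy on superlevel sets, given integrability to the powers `s₀` and `s`. -/
lemma superlevel_decay (hp : 2 ≤ p) (hnp : (n:ℝ) < p) (hpq : p ≤ q) (hα : 0 < α)
    (hαp : α ≤ 1 - n / p) (hα1 : α < 1) {s₀ s : ℝ} (hps : p ≤ s₀) (hsq : s₀ ≤ q) (hs : 1 ≤ s)
    (hκ : 0 ≤ errorExp n q s₀ α) {C R₀ : ℝ} (hC : 1 ≤ C) :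
    ∃ e c : ℝ, 0 < e ∧ e ≤ 1 ∧ 0 < c ∧
      ∀ {N : ℕ} {σ μ : ℝ} {Ω : Set (Vec n)} {f : Vec n → Mat N n → ℝ} {x₀ : Vec n} {R : ℝ}
        {u : Vec n → Vec N} {Du : Vec n → Mat N n}, IsBallMinimizer p q σ C μ Ω f x₀ R u Du →
      α ≤ σ → ∀ {ρ X ε : ℝ}, 0 < ρ → ρ < R → R ≤ R₀ → 1 ≤ X → (R - ρ)⁻¹ ≤ X →
      ∫ y in Metric.ball x₀ R, f y (Du y) ≤ X →
      IntegrableOn (fun y => ‖Du y‖ ^ s₀) (Metric.ball x₀ R) →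
      ∫ y in Metric.ball x₀ R, ‖Du y‖ ^ s₀ ≤ X →
      IntegrableOn (fun y => ‖Du y‖ ^ s) (Metric.ball x₀ R) →
      ∫ y in Metric.ball x₀ R, ‖Du y‖ ^ s ≤ X →
      0 < ε → ε ≤ e * X ^ (-(1 + 1 / (p * α))) →
      ∫ y in Metric.ball x₀ ρ, {y | 2 * (((1 + unitVolInv n) * X) ^ (1 / s) * ε ^ (-(n / s))) <
        ‖Du y‖}.indicator (fun y => ‖Du y‖ ^ p) y ≤
        c * X ^ (2 + (q - s₀) / s₀) * ε ^ errorExp n q s₀ α := by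
  obtain ⟨K, hK, hcut⟩ := exists_cutoff hα1
  have hω := unitVolInv_nonneg (n := n)
  have hk := convexConst_pos hp hC
  set w : ℝ := 1 + unitVolInv n with hw
  set V := volume.real (Metric.ball (0 : Vec n) R₀) with hV
  have hV0 : 0 ≤ V := measureReal_nonneg
  set E : ℝ := C * 20 ^ (q + 1) * 2 ^ q * (8 * 2 ^ (n + 2) * w ^ (1 / p) + 3 * K + 1) *
    w ^ ((q - s₀) / s₀) with hE
  have hE0 : 0 ≤ E := by positivity
  set M : ℝ := 2 * (3 * K) * (1 + C * V) + E * (V + 2) with hM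
  have hM0 : 0 ≤ M := by positivity
  have hs₀ : 0 < s₀ := by linarith
  refine ⟨min (1 / 3) (min (1 / (2 * (3 * K))) ((2 ^ (n + 3) * w ^ (1 / p)) ^ (-(1 / α)))),
    (convexConst p C * 2⁻¹ ^ p)⁻¹ * (M + 1), ?_, ?_, by positivity, ?_⟩
  · exact lt_min (by norm_num) (lt_min (by positivity) (by positivity))
  · exact (min_le_left _ _).trans (by norm_num)
  intro N σ μ Ω f x₀ R u Du hu hασ ρ X ε hρ hρR hRR₀ hX hdX hfX hDs₀ hX₀ hDs hXs hε hεe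
  have hX0 : 0 < X := by linarith
  have hd : 0 < R - ρ := by linarith
  obtain ⟨k1, k2, k3⟩ := radius_small (n := n) (by linarith : 1 ≤ p) hα (by positivity : 0 < 3 * K)
    (by linarith : 1 ≤ w) hX rfl hε hεe
  have hXd : X⁻¹ ≤ R - ρ := inv_le_of_inv_le₀ hd hdX
  have hX1 : X⁻¹ ≤ 1 := inv_le_one_of_one_le₀ hX
  have hε1 : ε ≤ 1 := by linarith
  -- The gap R - ρ is cut into thirds: one for the shift by ε, one for the cutoff to decay, one to
  -- keep the averaging balls inside the ball of radius R.
  obtain ⟨η, η1, η2, η3, η4, η5⟩ := hcut n x₀ (ρ + (R - ρ) / 3) (ρ + 2 * (R - ρ) / 3)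
    (by linarith) (by linarith)
  have hη0 : ∀ x, 0 ≤ η x ^ α := fun x => Real.rpow_nonneg (η2 x).1 _
  have η5' : ∀ x, ‖gradient η x‖ ≤ 3 * K * X * η x ^ α := fun x => by
    refine (η5 x).trans ?_
    have : K / (ρ + 2 * (R - ρ) / 3 - (ρ + (R - ρ) / 3)) = 3 * K * (R - ρ)⁻¹ := by
      have : ρ + 2 * (R - ρ) / 3 - (ρ + (R - ρ) / 3) = (R - ρ) / 3 := by ring
      rw [this]; field_simp
    rw [this]
    have := hη0 x
    gcongr
  obtain ⟨hτ, hτg⟩ := isRadius_smul (R := R) η1 η2 η4 hα.le hα1.le (by positivity) η5' hε hε1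
    (by linarith) k2
  have hW : unitVolInv n * ∫ y in Metric.ball x₀ R, ‖Du y‖ ^ s₀ ≤ w * X := by
    have : 0 ≤ ∫ y in Metric.ball x₀ R, ‖Du y‖ ^ s₀ := integral_nonneg fun y => by positivity
    gcongr
    linarith
  have main := hu.lintegral_superlevel_le (ρ := ρ) (ρ₁ := ρ + (R - ρ) / 3) (W := w * X)
    (lam := 2 * ((w * X) ^ (1 / s) * ε ^ (-(n / s)))) hp hnp
    hpq hC hα hασ hαp hτ hτg (by positivity) (fun x => by nlinarith [η2 x]) hε hε1
    (fun x hx => by rw [η3 x hx, mul_one]) (by linarith) hps hsq hDs₀ (by nlinarith) hW k3 hκ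
    (fun x hx => by
      rw [mul_div_cancel_left₀ _ two_ne_zero]
      refine norm_mean_le hs hu.measurable_grad (by linarith) hε ?_ hDs hXs
      refine Metric.ball_subset_ball' ?_
      rw [Metric.mem_ball] at hx
      linarith)
  have hvol : volume.real (Metric.ball x₀ R) ≤ V := volume_real_ball_le x₀ hRR₀
  have hIG := hu.integral_shifted_le (by linarith) hC hfX hX hvol
  have hIG0 := hu.integral_shifted_nonneg (by linarith)
  have hEc := errorConst_le (n := n) (q := q) (s := s₀) (K := 3 * K) (by linarith : 1 ≤ p) hC hX
    (by linarith : 0 ≤ w) rfl rfl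
  have hεκ : ε ≤ ε ^ errorExp n q s₀ α := by
    conv_lhs => rw [← Real.rpow_one ε]
    exact Real.rpow_le_rpow_of_exponent_ge hε hε1 (errorExp_le_one hs₀ hsq hα1.le)
  have hE1 := errorConst_nonneg (n := n) (p := p) (q := q) (s := s₀) hC
    (by positivity : 0 ≤ 3 * K * X) (by nlinarith : 1 ≤ w * X)
  have h3 := main.trans (decay_arith (div_nonneg (by linarith) hs₀.le) hε hεκ hX hK (by linarith)
    hV0 hIG0 hIG hE1 hEc measureReal_nonneg hvol (integral_nonneg fun y => by positivity) hX₀)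
  have hc0 : 0 < convexConst p C * 2⁻¹ ^ p := by positivity
  rw [← hM, ← le_div_iff₀' hc0] at h3
  refine h3.trans ?_
  rw [div_eq_inv_mul, mul_assoc, mul_assoc]
  gcongr
  linarith

end Decay

/-! ### Higher integrability -/

section LayerCake

variable {β : Type*} [MeasurableSpace β] {ν : Measure β} {φ : β → ℝ} {p δ Λ b θ D : ℝ}

lemma exists_nat_pow_lt {Λ b t : ℝ} (hΛ : 0 < Λ) (hb : 1 < b) (ht : Λ < t) :
    ∃ j : ℕ, Λ * b ^ j < t ∧ t ≤ Λ * b ^ (j + 1) := by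
  have hex : ∃ j : ℕ, t ≤ Λ * b ^ j := by
    obtain ⟨j, hj⟩ := pow_unbounded_of_one_lt (t / Λ) hb
    exact ⟨j, by rw [div_lt_iff₀ hΛ] at hj; linarith⟩
  classical
  have h1 := Nat.find_spec hex
  have h0 : Nat.find hex ≠ 0 := fun h => by
    rw [h] at h1; simp at h1; linarith
  obtain ⟨j, hj⟩ := Nat.exists_eq_succ_of_ne_zero h0
  refine ⟨j, ?_, ?_⟩
  · have := Nat.find_min hex (m := j) (by omega)
    linarith
  · rw [hj] at h1; exact h1

/-- Geometric decay of a `p`-energy on superlevel sets gives integrability of a higher power. -/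
lemma integrable_rpow_of_superlevel (hφm : Measurable φ) (hφ0 : ∀ x, 0 ≤ φ x) (hp : 0 ≤ p) (hδ : 0 < δ)
    (hΛ : 0 < Λ) (hb : 1 < b) (hθ : 0 ≤ θ) (hbθ : b ^ δ * θ < 1)
    (hi : Integrable (fun x => φ x ^ p) ν)
    (hD : ∀ j : ℕ, ∫ x, {x | Λ * b ^ j < φ x}.indicator (fun x => φ x ^ p) x ∂ν ≤ D * θ ^ j) :
    Integrable (fun x => φ x ^ (p + δ)) ν ∧
      ∫ x, φ x ^ (p + δ) ∂ν ≤ Λ ^ δ * (∫ x, φ x ^ p ∂ν + D * (b ^ δ * (1 - b ^ δ * θ)⁻¹)) := by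
  have hb0 : 0 < b := by linarith
  have hsm : ∀ j : ℕ, MeasurableSet {x | Λ * b ^ j < φ x} := fun j =>
    measurableSet_lt measurable_const hφm
  have hind0 : ∀ (j : ℕ) x, 0 ≤ {x | Λ * b ^ j < φ x}.indicator (fun x => φ x ^ p) x := fun j x =>
    indicator_nonneg (fun x _ => Real.rpow_nonneg (hφ0 x) _) x
  have hp0 : ∀ x, 0 ≤ φ x ^ p := fun x => Real.rpow_nonneg (hφ0 x) _
  have hD0 : 0 ≤ D := by
    have := (integral_nonneg (μ := ν) (hind0 0)).trans (hD 0)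
    simpa using this
  have hbδ : 0 < b ^ δ := by positivity
  have hden : 0 < 1 - b ^ δ * θ := by linarith
  -- Each point with φ > Λ lies in one shell Λb^j < φ ≤ Λb^(j+1), where φ^δ is at most the outer
  -- value; the resulting series is geometric with ratio b^δ θ.
  have hpt : ∀ x, ENNReal.ofReal (φ x ^ (p + δ)) ≤ ENNReal.ofReal (Λ ^ δ * φ x ^ p) +
      ∑' j : ℕ, ENNReal.ofReal ((Λ * b ^ (j + 1)) ^ δ *
        {x | Λ * b ^ j < φ x}.indicator (fun x => φ x ^ p) x) := by
    intro x
    have hsplit : φ x ^ (p + δ) = φ x ^ δ * φ x ^ p := by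
      rw [Real.rpow_add_of_nonneg (hφ0 x) hp hδ.le, mul_comm]
    rcases le_or_gt (φ x) Λ with h | h
    · refine le_trans (ENNReal.ofReal_le_ofReal ?_) le_self_add
      rw [hsplit]
      exact mul_le_mul_of_nonneg_right (Real.rpow_le_rpow (hφ0 x) h hδ.le) (hp0 x)
    · obtain ⟨j, hj1, hj2⟩ := exists_nat_pow_lt hΛ hb h
      refine le_trans ?_ (le_trans (ENNReal.le_tsum j) le_add_self)
      refine ENNReal.ofReal_le_ofReal ?_
      rw [indicator_of_mem (s := {x | Λ * b ^ j < φ x}) hj1, hsplit]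
      exact mul_le_mul_of_nonneg_right (Real.rpow_le_rpow (hφ0 x) hj2 hδ.le) (hp0 x)
  have hgeo : ∀ j : ℕ, (Λ * b ^ (j + 1)) ^ δ * (D * θ ^ j) = Λ ^ δ * (D * b ^ δ) * (b ^ δ * θ) ^ j := by
    intro j
    have : (b ^ (j + 1)) ^ δ = b ^ δ * (b ^ δ) ^ j := by
      rw [pow_succ, Real.mul_rpow (by positivity) hb0.le, ← Real.rpow_natCast b, ← Real.rpow_mul hb0.le,
        ← Real.rpow_natCast (b ^ δ), ← Real.rpow_mul hb0.le, mul_comm (j : ℝ), mul_comm]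
    rw [Real.mul_rpow hΛ.le (by positivity), this, mul_pow]
    ring
  have hsummable : Summable fun j : ℕ => Λ ^ δ * (D * b ^ δ) * (b ^ δ * θ) ^ j :=
    (summable_geometric_of_lt_one (by positivity) hbθ).mul_left _
  have hlin : ∫⁻ x, ENNReal.ofReal (φ x ^ (p + δ)) ∂ν ≤
      ENNReal.ofReal (Λ ^ δ * (∫ x, φ x ^ p ∂ν + D * (b ^ δ * (1 - b ^ δ * θ)⁻¹))) := by
    have hm1 : ∀ j : ℕ, Measurable fun x => ENNReal.ofReal ((Λ * b ^ (j + 1)) ^ δ *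
        {x | Λ * b ^ j < φ x}.indicator (fun x => φ x ^ p) x) := fun j =>
      (((hφm.pow_const p).indicator (hsm j)).const_mul _).ennreal_ofReal
    refine (lintegral_mono hpt).trans ?_
    rw [lintegral_add_left ((hφm.pow_const p).const_mul _).ennreal_ofReal,
      lintegral_tsum fun j => (hm1 j).aemeasurable, mul_add,
      ENNReal.ofReal_add (mul_nonneg (by positivity) (integral_nonneg hp0)) (by positivity)]
    refine add_le_add ?_ ?_
    · rw [← ofReal_integral_eq_lintegral_ofReal (hi.const_mul _)
        (Eventually.of_forall fun x => mul_nonneg (by positivity) (hp0 x)), integral_const_mul]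
    · have e : Λ ^ δ * (D * (b ^ δ * (1 - b ^ δ * θ)⁻¹)) =
          ∑' j : ℕ, Λ ^ δ * (D * b ^ δ) * (b ^ δ * θ) ^ j := by
        rw [tsum_mul_left, tsum_geometric_of_lt_one (by positivity) hbθ]; ring
      rw [e, ENNReal.ofReal_tsum_of_nonneg (fun j => by positivity) hsummable]
      refine ENNReal.tsum_le_tsum fun j => ?_
      rw [← ofReal_integral_eq_lintegral_ofReal ((hi.indicator (hsm j)).const_mul _)
        (Eventually.of_forall fun x => mul_nonneg (by positivity) (hind0 j x)), integral_const_mul,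
        ← hgeo]
      refine ENNReal.ofReal_le_ofReal ?_
      have := hD j
      gcongr
  have hnn : 0 ≤ᵐ[ν] fun x => φ x ^ (p + δ) :=
    Eventually.of_forall fun x => Real.rpow_nonneg (hφ0 x) _
  have hmeas : AEStronglyMeasurable (fun x => φ x ^ (p + δ)) ν :=
    (hφm.pow_const _).aestronglyMeasurable
  refine ⟨⟨hmeas, ?_⟩, ?_⟩
  · rw [hasFiniteIntegral_iff_ofReal hnn]
    exact hlin.trans_lt ENNReal.ofReal_lt_top
  · rw [integral_eq_lintegral_of_nonneg_ae hnn hmeas]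
    exact ENNReal.toReal_le_of_le_ofReal (mul_nonneg (by positivity)
      (add_nonneg (integral_nonneg hp0) (by positivity))) hlin

end LayerCake

/-! ### One step of improvement of the integrability exponent. -/

section HigherIntegrability

variable {n : ℕ} {p q α : ℝ}

/-- Quantitative local integrability of `|Du|^s` for constrained minimizers. -/
def HigherIntegrability (n : ℕ) (p q α s : ℝ) : Prop :=
  ∃ b : ℝ, 1 ≤ b ∧ ∀ C R₀ : ℝ, 1 ≤ C → ∃ c : ℝ, 1 ≤ c ∧
    ∀ {N : ℕ} {σ μ : ℝ} {Ω : Set (Vec n)} {f : Vec n → Mat N n → ℝ} {x₀ : Vec n} {R : ℝ}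
      {u : Vec n → Vec N} {Du : Vec n → Mat N n}, IsBallMinimizer p q σ C μ Ω f x₀ R u Du →
      α ≤ σ → ∀ {ρ X : ℝ}, 0 < ρ → ρ < R → R ≤ R₀ → 1 ≤ X → (R - ρ)⁻¹ ≤ X →
      ∫ y in Metric.ball x₀ R, f y (Du y) ≤ X →
      IntegrableOn (fun y => ‖Du y‖ ^ s) (Metric.ball x₀ ρ) ∧
        ∫ y in Metric.ball x₀ ρ, ‖Du y‖ ^ s ≤ c * X ^ b

lemma IsBallMinimizer.integral_mono_ball {N : ℕ} {σ C μ : ℝ} {Ω : Set (Vec n)}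
    {f : Vec n → Mat N n → ℝ} {x₀ : Vec n} {R ρ : ℝ} {u : Vec n → Vec N} {Du : Vec n → Mat N n}
    (hu : IsBallMinimizer p q σ C μ Ω f x₀ R u Du) (hρ : ρ ≤ R) :
    ∫ y in Metric.ball x₀ ρ, f y (Du y) ≤ ∫ y in Metric.ball x₀ R, f y (Du y) := by
  refine setIntegral_mono_set hu.integrable ?_ (Metric.ball_subset_ball hρ).eventuallyLE
  filter_upwards [ae_restrict_mem Metric.isOpen_ball.measurableSet] with y hy
  exact hu.admissible.nonneg (hu.ball_subset hy) _

lemma higherIntegrability_self : HigherIntegrability n p q α p := by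
  refine ⟨1, le_rfl, fun C R₀ hC => ⟨1, le_rfl, ?_⟩⟩
  intro N σ μ Ω f x₀ R u Du hu hασ ρ X hρ hρR hR hX hdX hfX
  have hu' := hu.mono hρR.le
  refine ⟨hu'.integrable_rpow, ?_⟩
  rw [one_mul, Real.rpow_one]
  exact (hu'.integral_rpow_le.trans (hu.integral_mono_ball hρR.le)).trans hfX

lemma threshold_rpow {w Y e m r s δ : ℝ} (hw0 : 0 < w) (hY0 : 0 < Y) (he0 : 0 < e) :
    (2 * ((w * Y) ^ (1 / s) * (e * Y ^ (-m)) ^ (-(r / s)))) ^ δ =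
      2 ^ δ * w ^ (δ / s) * e ^ (-(r / s * δ)) * Y ^ (δ / s + m * (r / s * δ)) := by
  rw [Real.mul_rpow (by norm_num) (by positivity), Real.mul_rpow (by positivity) (by positivity),
    Real.mul_rpow hw0.le hY0.le, Real.mul_rpow he0.le (by positivity),
    Real.mul_rpow (by positivity) (by positivity), Real.mul_rpow (by positivity) (by positivity),
    ← Real.rpow_mul hw0.le, ← Real.rpow_mul hY0.le, ← Real.rpow_mul hY0.le, ← Real.rpow_mul he0.le,
    ← Real.rpow_mul hY0.le, Real.rpow_add hY0]
  have a1 : 1 / s * δ = δ / s := by ring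
  have a2 : -(r / s) * δ = -(r / s * δ) := by ring
  have a3 : -m * -(r / s) * δ = m * (r / s * δ) := by ring
  rw [a1, a2, a3]; ring

set_option maxHeartbeats 1000000 in
/-- One improvement of the integrability exponent. -/
lemma HigherIntegrability.improve (hp : 2 ≤ p) (hnp : (n:ℝ) < p) (hpq : p ≤ q) (hn : 0 < n)
    (hα : 0 < α) (hαp : α ≤ 1 - n / p) (hα1 : α < 1) {s₀ s s' : ℝ} (hps : p ≤ s₀) (hsq : s₀ ≤ q)
    (hs : 1 ≤ s) (hκ : 0 ≤ errorExp n q s₀ α) (h₀ : HigherIntegrability n p q α s₀)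
    (h : HigherIntegrability n p q α s) (hps' : p < s')
    (hs' : n * (s' - p) / s < errorExp n q s₀ α) : HigherIntegrability n p q α s' := by
  obtain ⟨b₀, hb₀, H₀⟩ := h₀
  obtain ⟨b₁, hb₁, H₁⟩ := h
  have hs0 : 0 < s := by linarith
  set β := 2 + (q - s₀) / s₀ with hβ
  have hβ2 : 2 ≤ β := by
    have : 0 ≤ (q - s₀) / s₀ := div_nonneg (by linarith) (by linarith)
    linarith
  set δ := s' - p with hδdef
  have hδ : 0 < δ := by linarith
  set m := 1 + 1 / (p * α) with hm
  have hm0 : 0 < m := by have : 0 < p * α := by positivity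
                         positivity
  set κ := errorExp n q s₀ α with hκdef
  set γ := δ / s + m * (n / s * δ) + β with hγ
  have hn0 : (0:ℝ) < n := by exact_mod_cast hn
  have hγ1 : 1 ≤ γ := by
    have : 0 ≤ δ / s + m * (n / s * δ) := by positivity
    linarith
  set B := max b₀ b₁ with hB
  have hB1 : 1 ≤ B := hb₀.trans (le_max_left _ _)
  set w := 1 + unitVolInv n with hw
  have hω := unitVolInv_nonneg (n := n)
  have hw0 : 0 < w := by linarith
  refine ⟨B * γ, by nlinarith, fun C R₀ hC => ?_⟩
  obtain ⟨c₀, hc₀, H₀⟩ := H₀ C R₀ hC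
  obtain ⟨c₁, hc₁, H₁⟩ := H₁ C R₀ hC
  obtain ⟨e, c, he0, he1, hc, Hd⟩ := superlevel_decay hp hnp hpq hα hαp hα1 hps hsq hs hκ (R₀ := R₀) hC
  -- Halving ε multiplies the threshold by 2^(n/s) and the superlevel bound by 2^(-κ). The series
  -- converges for 2^(nδ/s - κ) < 1, which is the hypothesis on s'.
  set bb : ℝ := 2 ^ (n / s : ℝ) with hbb
  set θ : ℝ := 2 ^ (-κ) with hθ
  have hbb1 : 1 < bb := Real.one_lt_rpow (by norm_num) (by positivity)
  have hbbδ : bb ^ δ * θ < 1 := by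
    rw [hbb, hθ, ← Real.rpow_mul (by norm_num), ← Real.rpow_add (by norm_num)]
    refine Real.rpow_lt_one_of_one_lt_of_neg (by norm_num) ?_
    have : (n:ℝ) / s * δ = n * δ / s := by ring
    linarith
  set Q := bb ^ δ * (1 - bb ^ δ * θ)⁻¹ with hQ
  have hQ0 : 0 ≤ Q := mul_nonneg (by positivity) (inv_nonneg.2 (by linarith))
  set c₂ := 2 ^ δ * w ^ (δ / s) * e ^ (-(n / s * δ)) * (1 + c * Q) with hc₂
  have hc₂0 : 0 ≤ c₂ := by positivity
  refine ⟨max 1 (c₂ * ((c₀ + c₁) * 2 ^ B) ^ γ), le_max_left _ _, ?_⟩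
  intro N σ μ Ω f x₀ R u Du hu hασ ρ X hρ hρR hR hX hdX hfX
  have hd : 0 < R - ρ := by linarith
  have hX0 : 0 < X := by linarith
  set ρ' := (ρ + R) / 2 with hρ'
  have hu' := hu.mono (by linarith : ρ' ≤ R)
  have hinv : (R - ρ')⁻¹ ≤ 2 * X := by
    have : R - ρ' = (R - ρ) / 2 := by rw [hρ']; ring
    rw [this, inv_div, div_eq_mul_inv]; gcongr
  have hinv' : (ρ' - ρ)⁻¹ ≤ 2 * X := by
    have : ρ' - ρ = (R - ρ) / 2 := by rw [hρ']; ring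
    rw [this, inv_div, div_eq_mul_inv]; gcongr
  obtain ⟨i₀, k₀⟩ := H₀ hu hασ (by linarith) (by linarith : ρ' < R) hR (by linarith) hinv
    (hfX.trans (by linarith))
  obtain ⟨i₁, k₁⟩ := H₁ hu hασ (by linarith) (by linarith : ρ' < R) hR (by linarith) hinv
    (hfX.trans (by linarith))
  -- A single bound on the intermediate ball for the energy, the inverse gap and both integrals of
  -- powers of |Du|, so that the decay estimate applies with one parameter.
  set Y := (c₀ + c₁) * (2 * X) ^ B with hY
  have h2X : 2 * X ≤ (2 * X) ^ B := by
    conv_lhs => rw [← Real.rpow_one (2 * X)]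
    exact Real.rpow_le_rpow_of_exponent_le (by linarith) hB1
  have hXB : 0 < (2 * X) ^ B := by positivity
  have hY2X : 2 * X ≤ Y := h2X.trans (le_mul_of_one_le_left hXB.le (by linarith))
  have hY1 : 1 ≤ Y := by linarith
  have hY0 : 0 < Y := by linarith
  have kY₀ : c₀ * (2 * X) ^ b₀ ≤ Y := by
    have : (2 * X) ^ b₀ ≤ (2 * X) ^ B :=
      Real.rpow_le_rpow_of_exponent_le (by linarith) (le_max_left _ _)
    calc c₀ * (2 * X) ^ b₀ ≤ c₀ * (2 * X) ^ B := by gcongr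
      _ ≤ (c₀ + c₁) * (2 * X) ^ B := by gcongr; linarith
  have kY₁ : c₁ * (2 * X) ^ b₁ ≤ Y := by
    have : (2 * X) ^ b₁ ≤ (2 * X) ^ B :=
      Real.rpow_le_rpow_of_exponent_le (by linarith) (le_max_right _ _)
    calc c₁ * (2 * X) ^ b₁ ≤ c₁ * (2 * X) ^ B := by gcongr
      _ ≤ (c₀ + c₁) * (2 * X) ^ B := by gcongr; linarith
  have hfY : ∫ y in Metric.ball x₀ ρ', f y (Du y) ≤ Y := by
    have := hu.integral_mono_ball (by linarith : ρ' ≤ R)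
    linarith
  set ε₀ := e * Y ^ (-m) with hε₀
  have hε₀0 : 0 < ε₀ := by positivity
  have hYm : Y ^ (-m) ≤ 1 := Real.rpow_le_one_of_one_le_of_nonpos hY1 (by linarith)
  have hε₀1 : ε₀ ≤ 1 := by
    exact mul_le_one₀ he1 (by positivity) hYm
  set Λ := 2 * ((w * Y) ^ (1 / s) * ε₀ ^ (-(n / s) : ℝ)) with hΛ
  have hΛ0 : 0 < Λ := by positivity
  have hdecay : ∀ j : ℕ, ∫ y in Metric.ball x₀ ρ, {y | Λ * bb ^ j < ‖Du y‖}.indicator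
      (fun y => ‖Du y‖ ^ p) y ≤ c * Y ^ β * ε₀ ^ κ * θ ^ j := by
    intro j
    have h2j : (0:ℝ) < (2 ^ j)⁻¹ := by positivity
    have h2j1 : ((2:ℝ) ^ j)⁻¹ ≤ 1 := inv_le_one_of_one_le₀ (one_le_pow₀ (by norm_num))
    have hd := Hd hu' hασ hρ (by linarith) (by linarith) hY1 (hinv'.trans hY2X) hfY i₀
      (k₀.trans kY₀) i₁ (k₁.trans kY₁) (mul_pos hε₀0 h2j) (mul_le_of_le_one_right hε₀0.le h2j1)
    have hpow : ∀ r : ℝ, (((2:ℝ) ^ j)⁻¹) ^ r = ((2:ℝ) ^ (-r)) ^ j := fun r => by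
      rw [← Real.rpow_natCast, ← Real.rpow_natCast, ← Real.rpow_neg (by norm_num),
        ← Real.rpow_mul (by norm_num), ← Real.rpow_mul (by norm_num)]
      congr 1; ring
    have e1 : 2 * ((w * Y) ^ (1 / s) * (ε₀ * (2 ^ j)⁻¹) ^ (-(n / s) : ℝ)) = Λ * bb ^ j := by
      rw [Real.mul_rpow hε₀0.le h2j.le, hpow, neg_neg, hΛ]; ring
    have e2 : c * Y ^ β * (ε₀ * (2 ^ j)⁻¹) ^ κ = c * Y ^ β * ε₀ ^ κ * θ ^ j := by
      rw [Real.mul_rpow hε₀0.le h2j.le, hpow]; ring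
    rw [e1, e2] at hd
    exact hd
  have huρ := hu.mono hρR.le
  obtain ⟨j1, j2⟩ := integrable_rpow_of_superlevel (ν := volume.restrict (Metric.ball x₀ ρ))
    hu.measurable_grad.norm.measurable (fun x => norm_nonneg _) (by linarith : 0 ≤ p) hδ hΛ0 hbb1
    (by positivity) hbbδ huρ.integrable_rpow hdecay
  have hpδ : p + δ = s' := by rw [hδdef]; ring
  rw [hpδ] at j1 j2
  refine ⟨j1, j2.trans ?_⟩
  have hIp : ∫ y in Metric.ball x₀ ρ, ‖Du y‖ ^ p ≤ Y ^ β := by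
    have h1 := huρ.integral_rpow_le.trans (hu.integral_mono_ball hρR.le)
    have h2 : Y ≤ Y ^ β := by
      conv_lhs => rw [← Real.rpow_one Y]
      exact Real.rpow_le_rpow_of_exponent_le hY1 (by linarith)
    linarith
  have hεκ : ε₀ ^ κ ≤ 1 := Real.rpow_le_one hε₀0.le hε₀1 hκ
  have hΛδ : Λ ^ δ = 2 ^ δ * w ^ (δ / s) * e ^ (-(n / s * δ)) * Y ^ (δ / s + m * (n / s * δ)) :=
    threshold_rpow hw0 hY0 he0
  have hYβ : 0 ≤ Y ^ β := by positivity
  calc Λ ^ δ * ((∫ y in Metric.ball x₀ ρ, ‖Du y‖ ^ p) + c * Y ^ β * ε₀ ^ κ * Q)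
      ≤ Λ ^ δ * (Y ^ β + c * Y ^ β * 1 * Q) := by gcongr
    _ = c₂ * Y ^ γ := by
        rw [hΛδ, hγ, Real.rpow_add hY0 (δ / s + m * (n / s * δ)), hc₂]; ring
    _ = c₂ * ((c₀ + c₁) * 2 ^ B) ^ γ * X ^ (B * γ) := by
        rw [hY, Real.mul_rpow zero_le_two hX0.le, ← mul_assoc, Real.mul_rpow (by positivity)
          (by positivity) (z := γ), ← Real.rpow_mul hX0.le]; ring
    _ ≤ _ := by
        gcongr
        exact le_max_right _ _

end HigherIntegrability

/-! ### Constrained local minimizers -/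

section Iteration

variable {n : ℕ} {p q α : ℝ}

lemma higherIntegrability_of_le {t : ℝ} (ht : 0 ≤ t) (htp : t ≤ p) :
    HigherIntegrability n p q α t := by
  refine ⟨1, le_rfl, fun C R₀ hC => ⟨1 + volume.real (Metric.ball (0 : Vec n) R₀),
    by linarith [measureReal_nonneg (μ := volume) (s := Metric.ball (0 : Vec n) R₀)], ?_⟩⟩
  intro N σ μ Ω f x₀ R u Du hu hασ ρ X hρ hρR hR hX hdX hfX
  have hu' := hu.mono hρR.le
  have hfin : IsFiniteMeasure (volume.restrict (Metric.ball x₀ ρ)) :=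
    ⟨by simp [measure_ball_lt_top]⟩
  have hle : ∀ y, ‖Du y‖ ^ t ≤ 1 + ‖Du y‖ ^ p := fun y => by
    have h0 : 0 ≤ ‖Du y‖ ^ p := by positivity
    rcases le_total ‖Du y‖ 1 with h | h
    · linarith [Real.rpow_le_one (norm_nonneg _) h ht]
    · linarith [Real.rpow_le_rpow_of_exponent_le h htp]
  have hi : IntegrableOn (fun y => 1 + ‖Du y‖ ^ p) (Metric.ball x₀ ρ) :=
    (integrable_const (1:ℝ)).add hu'.integrable_rpow
  have hit : IntegrableOn (fun y => ‖Du y‖ ^ t) (Metric.ball x₀ ρ) :=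
    hi.mono' (hu.measurable_grad.norm.measurable.pow_const t).aestronglyMeasurable
      (Eventually.of_forall fun y => by
        rw [Real.norm_of_nonneg (by positivity)]; exact hle y)
  refine ⟨hit, (integral_mono hit hi hle).trans ?_⟩
  rw [integral_add (integrable_const (1:ℝ)) hu'.integrable_rpow]
  have h1 := (hu'.integral_rpow_le.trans (hu.integral_mono_ball hρR.le)).trans hfX
  have h2 := volume_real_ball_le x₀ (hρR.le.trans hR)
  have h3 := measureReal_nonneg (μ := volume) (s := Metric.ball (0 : Vec n) R₀)
  simp only [integral_const, measureReal_restrict_apply_univ, smul_eq_mul, mul_one, Real.rpow_one]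
  nlinarith

/-- Induction on steps of a fixed length g. The condition of one improvement holds with a uniform
margin as long as the exponent does not exceed t, which is strictly below the fixed point np/(n-α).
-/
lemma higherIntegrability_of_lt (hn : 2 ≤ n) (hnp : (n:ℝ) < p) (hpq : p < q)
    (hα : 0 < α) (hαp : α ≤ 1 - n / p) (hratio : q / p < ((n : ℝ) + α) / n) {t : ℝ} (ht : 0 ≤ t)
    (ht' : t < n * p / (n - α)) : HigherIntegrability n p q α t := by
  have hn2 : (2:ℝ) ≤ n := by exact_mod_cast hn
  have hn0 : (0:ℝ) < n := by linarith
  have hp0 : 0 < p := by linarith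
  have hα1 : α < 1 := by have : 0 < (n:ℝ) / p := by positivity
                         linarith
  rw [div_lt_div_iff₀ hp0 hn0] at hratio
  rw [lt_div_iff₀ (by linarith)] at ht'
  -- The two entries are the margins in the hypothesis on q/p and in t < np/(n-α), needed below and
  -- above the exponent q respectively; half of the smaller one, divided by n, leaves strict
  -- inequalities.
  set g := min ((n + α) * p - q * n) (n * p - t * (n - α)) / (2 * n) with hg
  have hg0 : 0 < g := div_pos (lt_min (by linarith) (by linarith)) (by linarith)
  have hgn : 2 * (n * g) = min ((n + α) * p - q * n) (n * p - t * (n - α)) := by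
    rw [hg]; field_simp
  have hg1 : n * g < (n + α) * p - q * n := by
    have := min_le_left ((n + α) * p - q * n) (n * p - t * (n - α))
    nlinarith
  have hg2 : n * g < n * p - t * (n - α) := by
    have := min_le_right ((n + α) * p - q * n) (n * p - t * (n - α))
    nlinarith
  have key : ∀ k : ℕ, ∀ s, p ≤ s → s ≤ max p t → s ≤ p + k * g → HigherIntegrability n p q α s := by
    intro k
    induction k with
    | zero =>
      intro s hs _ hs2
      have : s = p := by
        have : s ≤ p := by simpa using hs2
        linarith
      rw [this]
      exact higherIntegrability_self
    | succ k ih =>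
      intro s' hs' hst hs'k
      rcases hs'.eq_or_lt with h | h
      · rw [← h]; exact higherIntegrability_self
      have htp : s' ≤ t := by
        rcases le_max_iff.1 hst with h1 | h1
        · linarith
        · exact h1
      set s := max p (s' - g) with hs
      have hps : p ≤ s := le_max_left _ _
      have hss' : s' ≤ s + g := by linarith [le_max_right p (s' - g)]
      have hst2 : s ≤ t := max_le (by linarith) (by linarith)
      have hsk : s ≤ p + k * g := by
        push_cast at hs'k
        refine max_le ?_ (by linarith)
        have : 0 ≤ (k:ℝ) * g := by positivity
        linarith
      have hs0 : 0 < s := by linarith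
      have H := ih s hps (hst2.trans (le_max_right _ _)) hsk
      have H₀ := ih (min s q) (le_min hps hpq.le) ((min_le_left _ _).trans
        (hst2.trans (le_max_right _ _))) ((min_le_left _ _).trans hsk)
      -- With s' ≤ s + g: for s ≤ q the claim follows from ng + n(q - p) < αp ≤ αs; for s ≥ q it
      -- follows from (n - α)s' + αg < np, using s' ≤ t.
      have hcond : n * (s' - p) / s < errorExp n q (min s q) α := by
        rcases le_total s q with hsq | hsq
        · rw [min_eq_left hsq, errorExp, ← mul_div_assoc, lt_sub_iff_add_lt, ← add_div,
            div_lt_iff₀ hs0]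
          nlinarith
        · rw [min_eq_right hsq, errorExp, sub_self, zero_div, mul_zero, sub_zero, div_lt_iff₀ hs0]
          nlinarith
      have hκ : 0 ≤ errorExp n q (min s q) α :=
        (div_nonneg (mul_nonneg hn0.le (by linarith)) hs0.le).trans hcond.le
      exact HigherIntegrability.improve (by linarith) hnp hpq.le (by omega) hα hαp hα1
        (le_min hps hpq.le) (min_le_right _ _) (by linarith) hκ H₀ H h hcond
  rcases le_total t p with h | h
  · exact higherIntegrability_of_le ht h
  · obtain ⟨k, hk⟩ := exists_nat_ge ((t - p) / g)
    rw [div_le_iff₀ hg0] at hk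
    exact key k t h (le_max_right _ _) (by linarith)

end Iteration

/-! ### Passage from local minimizers to Borel representatives on balls, and the local estimate. -/

section Representatives

variable {N n : ℕ} {p q σ C μ α : ℝ} {Ω B : Set (Vec n)} {f : Vec n → Mat N n → ℝ}

lemma IsWeakGradient.congr {u v : Vec n → Vec N} {Du Dv : Vec n → Mat N n}
    (h : IsWeakGradient B u Du) (hv : LocallyIntegrableOn v B) (hDv : LocallyIntegrableOn Dv B)
    (e : u =ᵐ[volume.restrict B] v) (e' : Du =ᵐ[volume.restrict B] Dv) : IsWeakGradient B v Dv := by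
  refine ⟨hv, hDv, fun φ h1 h2 h3 i j => ?_⟩
  have := h.integral_eq φ h1 h2 h3 i j
  have a1 : ∫ x in B, v x i * fderiv ℝ φ x (EuclideanSpace.single j 1) =
      ∫ x in B, u x i * fderiv ℝ φ x (EuclideanSpace.single j 1) :=
    integral_congr_ae (e.mono fun x hx => by simp only [hx])
  have a2 : ∫ x in B, Dv x (i, j) * φ x = ∫ x in B, Du x (i, j) * φ x :=
    integral_congr_ae (e'.mono fun x hx => by simp only [hx])
  rw [a1, a2, this]

lemma MemW1.congr {t : ℝ} {u v : Vec n → Vec N} {Du Dv : Vec n → Mat N n} (ht : 1 ≤ t)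
    (hB : volume B ≠ ⊤) (h : MemW1 B t u Du) (e : u =ᵐ[volume.restrict B] v)
    (e' : Du =ᵐ[volume.restrict B] Dv) : MemW1 B t v Dv := by
  have hfin : IsFiniteMeasure (volume.restrict B) := ⟨by simpa using hB.lt_top⟩
  have h1 : 1 ≤ ENNReal.ofReal t := by simpa using ht
  have m1 := h.memLp.ae_eq e
  have m2 := h.memLp_grad.ae_eq e'
  have i1 : IntegrableOn v B := m1.integrable h1
  have i2 : IntegrableOn Dv B := m2.integrable h1
  exact ⟨h.isWeakGradient.congr i1.locallyIntegrableOn i2.locallyIntegrableOn e e', m1, m2⟩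

lemma MemW1Zero.congr {w v : Vec n → Vec N} {Dw Dv : Vec n → Mat N n}
    (hB : volume B ≠ ⊤) (h : MemW1Zero B w Dw) (e : w =ᵐ[volume.restrict B] v)
    (e' : Dw =ᵐ[volume.restrict B] Dv) : MemW1Zero B v Dv := by
  obtain ⟨h1, φ, h2, h3, h4⟩ := h
  refine ⟨h1.congr le_rfl hB e e', φ, h2, h3.congr fun k => eLpNorm_congr_ae ?_,
    h4.congr fun k => eLpNorm_congr_ae ?_⟩
  · exact e.mono fun x hx => by simp only [hx]
  · exact e'.mono fun x hx => by simp only [hx]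

lemma isOpenSubcompact_ball {x₀ : Vec n} {R : ℝ} (h : Metric.closedBall x₀ R ⊆ Ω) :
    IsOpenSubcompact (Metric.ball x₀ R) Ω :=
  ⟨Metric.isOpen_ball, (isCompact_closedBall x₀ R).of_isClosed_subset isClosed_closure
    Metric.closure_ball_subset_closedBall, Metric.closure_ball_subset_closedBall.trans h⟩

/-- Constrained local minimizers have Borel representatives on balls. -/
lemma IsConstrainedLocalMinimizer.exists_isBallMinimizer (hf : IsAdmissible p q σ C μ Ω f)
    (hΩ : IsOpen Ω) (hp : 2 ≤ p) {u : Vec n → Vec N} {Du : Vec n → Mat N n}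
    (hu : MemW1LocSphere Ω p u Du) (hmin : IsConstrainedLocalMinimizer Ω f u Du) {x₀ : Vec n}
    {R : ℝ} (hR : Metric.closedBall x₀ R ⊆ Ω) :
    ∃ (v : Vec n → Vec N) (Dv : Vec n → Mat N n), IsBallMinimizer p q σ C μ Ω f x₀ R v Dv ∧
      Du =ᵐ[volume.restrict (Metric.ball x₀ R)] Dv := by
  obtain ⟨δ, hδ, hδΩ⟩ := (isCompact_closedBall x₀ R).exists_cthickening_subset_open hΩ hR
  set S := Metric.thickening δ (Metric.closedBall x₀ R) with hS
  have hSc : IsCompact (Metric.cthickening δ (Metric.closedBall x₀ R)) :=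
    (isCompact_closedBall x₀ R).cthickening
  have hSo : IsOpen S := Metric.isOpen_thickening
  have hcl : closure S ⊆ Metric.cthickening δ (Metric.closedBall x₀ R) :=
    Metric.closure_thickening_subset_cthickening _ _
  have hsub : Metric.closedBall x₀ R ⊆ S := Metric.self_subset_thickening hδ _
  have hSt : volume S ≠ ⊤ := ((measure_mono (subset_closure.trans hcl)).trans_lt
    hSc.measure_lt_top).ne
  have hfin : IsFiniteMeasure (volume.restrict S) := ⟨by simpa using hSt.lt_top⟩
  obtain ⟨hW, hs⟩ := hu S ⟨hSo, hSc.of_isClosed_subset isClosed_closure hcl, hcl.trans hδΩ⟩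
  have e1 := hW.memLp.1.ae_eq_mk
  have e2 := hW.memLp_grad.1.ae_eq_mk
  have mu := hW.memLp.1.stronglyMeasurable_mk
  have mDu := hW.memLp_grad.1.stronglyMeasurable_mk
  set v := hW.memLp.1.mk u with hv
  set Dv := hW.memLp_grad.1.mk Du with hDv
  have hW' := hW.congr (by linarith) hSt e1 e2
  have hres : volume.restrict (Metric.ball x₀ R) ≤ volume.restrict S :=
    Measure.restrict_mono (Metric.ball_subset_closedBall.trans hsub) le_rfl
  have e1' : u =ᵐ[volume.restrict (Metric.ball x₀ R)] v := ae_mono hres e1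
  have e2' : Du =ᵐ[volume.restrict (Metric.ball x₀ R)] Dv := ae_mono hres e2
  have hm2 : MemLp Dv 2 (volume.restrict S) := by
    have := hW'.memLp_grad.mono_exponent (p := ENNReal.ofReal 2) (ENNReal.ofReal_le_ofReal hp)
    rwa [ENNReal.ofReal_ofNat] at this
  have hi2 : IntegrableOn (fun x => ‖Dv x‖ ^ 2) S := hm2.integrable_norm_pow two_ne_zero
  have hfi : IntegrableOn (fun x => f x (Du x)) (Metric.ball x₀ R) :=
    (hmin.locallyIntegrable.integrableOn_compact_subset hR (isCompact_closedBall x₀ R)).mono_set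
      Metric.ball_subset_closedBall
  refine ⟨v, Dv, ⟨hf, hΩ, hR, mu, mDu, ?_, exists_isSmoothApprox hSo hW'.isWeakGradient
    hi2.locallyIntegrableOn hsub, hfi.congr (e2'.mono fun x hx => by simp only [hx]), ?_⟩, e2'⟩
  · filter_upwards [ae_mono hres hs, e1'] with x hx hx'
    rw [← hx']; exact hx
  · intro R₁ hR₁ w Dw hw hw0
    have hres₁ : volume.restrict (Metric.ball x₀ R₁) ≤ volume.restrict (Metric.ball x₀ R) :=
      Measure.restrict_mono (Metric.ball_subset_ball hR₁) le_rfl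
    have a1 : u =ᵐ[volume.restrict (Metric.ball x₀ R₁)] v := ae_mono hres₁ e1'
    have a2 : Du =ᵐ[volume.restrict (Metric.ball x₀ R₁)] Dv := ae_mono hres₁ e2'
    have := hmin.le (Metric.ball x₀ R₁)
      (isOpenSubcompact_ball ((Metric.closedBall_subset_closedBall hR₁).trans hR)) w Dw hw
      (hw0.congr measure_ball_lt_top.ne (a1.mono fun x hx => by simp only [hx])
        (a2.mono fun x hx => by simp only [hx]))
    have a3 : ∫⁻ x in Metric.ball x₀ R₁, ENNReal.ofReal (f x (Du x)) =
        ∫⁻ x in Metric.ball x₀ R₁, ENNReal.ofReal (f x (Dv x)) :=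
      lintegral_congr_ae (a2.mono fun x hx => by simp only [hx])
    exact a3 ▸ this

/-- Local higher integrability of constrained minimizers, with an estimate. -/
lemma HigherIntegrability.minimizer_estimate {t : ℝ} (H : HigherIntegrability n p q α t)
    (hp : 2 ≤ p) : ∃ b : ℝ, 0 < b ∧ ∀ C R₀ : ℝ, 1 ≤ C → 0 < R₀ → ∃ c : ℝ, 0 < c ∧
    ∀ {N : ℕ} {σ μ : ℝ} {Ω : Set (Vec n)} {f : Vec n → Mat N n → ℝ}
      {u : Vec n → Vec N} {Du : Vec n → Mat N n}, α ≤ σ → IsOpen Ω → IsAdmissible p q σ C μ Ω f →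
      MemW1LocSphere Ω p u Du → IsConstrainedLocalMinimizer Ω f u Du →
      ∀ (x₀ : Vec n) (ρ R : ℝ), 0 < ρ → ρ < R → R ≤ R₀ → Metric.closedBall x₀ R ⊆ Ω →
      IntegrableOn (fun x => ‖Du x‖ ^ t) (Metric.ball x₀ ρ) ∧
      IntegrableOn (fun x => f x (Du x)) (Metric.ball x₀ R) ∧
      ∫ x in Metric.ball x₀ ρ, ‖Du x‖ ^ t ≤
        c / (R - ρ) ^ b * (1 + ∫ x in Metric.ball x₀ R, f x (Du x)) ^ b := by
  obtain ⟨b, hb, H⟩ := H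
  refine ⟨b, by linarith, fun C R₀ hC hR₀ => ?_⟩
  obtain ⟨c, hc, H⟩ := H C R₀ hC
  refine ⟨c * (1 + R₀) ^ b, by positivity, ?_⟩
  intro N σ μ Ω f u Du hασ hΩ hf hu hmin x₀ ρ R hρ hρR hR hball
  obtain ⟨v, Dv, hv, e⟩ := hmin.exists_isBallMinimizer hf hΩ hp hu hball
  have ef : (fun x => f x (Dv x)) =ᵐ[volume.restrict (Metric.ball x₀ R)] fun x => f x (Du x) :=
    e.mono fun x hx => by simp only [hx]
  have e' : Du =ᵐ[volume.restrict (Metric.ball x₀ ρ)] Dv :=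
    ae_mono (Measure.restrict_mono (Metric.ball_subset_ball hρR.le) le_rfl) e
  have et : (fun x => ‖Dv x‖ ^ t) =ᵐ[volume.restrict (Metric.ball x₀ ρ)] fun x => ‖Du x‖ ^ t :=
    e'.mono fun x hx => by simp only [hx]
  have hI0 : 0 ≤ ∫ x in Metric.ball x₀ R, f x (Du x) :=
    setIntegral_nonneg Metric.isOpen_ball.measurableSet fun x hx =>
      hf.nonneg (hv.ball_subset hx) _
  set I := ∫ x in Metric.ball x₀ R, f x (Du x) with hI
  have hd : 0 < R - ρ := by linarith
  have hdR : R - ρ ≤ 1 + R₀ := by linarith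
  have hX : 1 ≤ (1 + R₀) / (R - ρ) := (one_le_div hd).2 hdR
  -- This X dominates 1, the inverse gap and the energy at once, and as a product its b-th power
  -- splits into the two factors of the estimate. The factor 1 + R₀ makes up for gaps larger than 1.
  obtain ⟨h1, h2⟩ := H hv hασ (X := (1 + R₀) / (R - ρ) * (1 + I)) hρ hρR hR (by nlinarith) (by
      rw [inv_eq_one_div]
      have : 1 / (R - ρ) ≤ (1 + R₀) / (R - ρ) := by gcongr; linarith
      nlinarith) (by
      rw [integral_congr_ae ef]
      nlinarith)
  refine ⟨h1.congr et, hv.integrable.congr ef, ?_⟩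
  rw [integral_congr_ae et] at h2
  refine h2.trans_eq ?_
  rw [Real.mul_rpow (by positivity) (by positivity), Real.div_rpow (by positivity) hd.le]
  ring

/-- The map itself is bounded because |u| = 1, so only the gradient matters; the closure of the
subdomain is compact, which reduces the claim to small balls. -/
lemma memW1LocSphere_of_integrableOn_ball {t : ℝ} (ht : 0 < t) {u : Vec n → Vec N}
    {Du : Vec n → Mat N n} (hΩ : IsOpen Ω) (hu : MemW1LocSphere Ω p u Du)
    (h : ∀ (x₀ : Vec n) (R : ℝ), 0 < R → Metric.closedBall x₀ R ⊆ Ω →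
      IntegrableOn (fun x => ‖Du x‖ ^ t) (Metric.ball x₀ (R / 2))) : MemW1LocSphere Ω t u Du := by
  intro U hU
  obtain ⟨hW, hs⟩ := hu U hU
  have hUt : volume U ≠ ⊤ := ((measure_mono subset_closure).trans_lt hU.2.1.measure_lt_top).ne
  have hfin : IsFiniteMeasure (volume.restrict U) := ⟨by simpa using hUt.lt_top⟩
  refine ⟨⟨hW.isWeakGradient, MemLp.of_bound hW.memLp.1 1 (hs.mono fun x hx => hx.le),
    memLp_of_integrable_rpow hW.memLp_grad.1 ht ?_⟩, hs⟩
  have hloc : LocallyIntegrableOn (fun x => ‖Du x‖ ^ t) (closure U) := by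
    intro x hx
    obtain ⟨R, hR, hRΩ⟩ := Metric.nhds_basis_closedBall.mem_iff.1 (hΩ.mem_nhds (hU.2.2 hx))
    exact ⟨Metric.ball x (R / 2), mem_nhdsWithin_of_mem_nhds
      (Metric.ball_mem_nhds x (by positivity)), h x R hR hRΩ⟩
  exact (hloc.integrableOn_isCompact hU.2.1).mono_set subset_closure

end Representatives

end SphereMin

end

theorem theorem1 (n : ℕ) (hn : 2 ≤ n) (p q α t : ℝ)
    (hnp : (n : ℝ) < p) (hpq : p < q) (hratio : q / p < ((n : ℝ) + α) / n)
    (ht : 1 < t) (ht' : t < n * p / (n - α)) :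
    ∃ αt βt : ℝ, 0 < αt ∧ 0 < βt ∧
      ∀ (N : ℕ), q < (N : ℝ) - 1 → ∀ C : ℝ, 1 ≤ C → ∀ R₀ : ℝ, 0 < R₀ →
      ∃ c : ℝ, 0 < c ∧
        ∀ (σ μ : ℝ), 0 < σ → σ ≤ 1 → α = min σ (1 - n / p) → 0 ≤ μ → μ ≤ 1 →
        ∀ Ω : Set (SphereMin.Vec n), IsOpen Ω → Bornology.IsBounded Ω →
        ∀ f : SphereMin.Vec n → SphereMin.Mat N n → ℝ,
          SphereMin.IsAdmissible p q σ C μ Ω f →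
          (SphereMin.ClassA Ω f ∨ SphereMin.ClassB p q σ Ω f ∨ SphereMin.ClassC p q σ Ω f) →
        ∀ (u : SphereMin.Vec n → SphereMin.Vec N) (Du : SphereMin.Vec n → SphereMin.Mat N n),
          SphereMin.MemW1LocSphere Ω p u Du →
          SphereMin.IsConstrainedLocalMinimizer Ω f u Du →
          SphereMin.MemW1LocSphere Ω t u Du ∧
          ∀ (x₀ : SphereMin.Vec n) (ρ R : ℝ), 0 < ρ → ρ < R → R ≤ R₀ →
            Metric.closedBall x₀ R ⊆ Ω →
            IntegrableOn (fun x => ‖Du x‖ ^ t) (Metric.ball x₀ ρ) ∧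
            IntegrableOn (fun x => f x (Du x)) (Metric.ball x₀ R) ∧
            ∫ x in Metric.ball x₀ ρ, ‖Du x‖ ^ t ≤
              c / (R - ρ) ^ αt * (1 + ∫ x in Metric.ball x₀ R, f x (Du x)) ^ βt := by
  have hn2 : (2:ℝ) ≤ n := by exact_mod_cast hn
  have hp0 : 0 < p := by linarith
  by_cases hα : 0 < α ∧ α ≤ 1 - n / p
  · have H := SphereMin.higherIntegrability_of_lt hn hnp hpq hα.1 hα.2 hratio
      (by linarith : (0:ℝ) ≤ t) ht'
    obtain ⟨b, hb, H⟩ := H.minimizer_estimate (by linarith)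
    refine ⟨b, b, hb, hb, fun N _ C hC R₀ hR₀ => ?_⟩
    obtain ⟨c, hc, Hc⟩ := H C R₀ hC hR₀
    refine ⟨c, hc, ?_⟩
    intro σ μ _ _ hασ _ _ Ω hΩ _ f hf _ u Du hu hmin
    have hασ' : α ≤ σ := hασ ▸ min_le_left _ _
    refine ⟨SphereMin.memW1LocSphere_of_integrableOn_ball (by linarith) hΩ hu
      fun x₀ R hR hball => ?_, Hc hασ' hΩ hf hu hmin⟩
    obtain ⟨c', _, Hc'⟩ := H C R hC hR
    exact (Hc' hασ' hΩ hf hu hmin x₀ (R / 2) R (by linarith) (by linarith) le_rfl hball).1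
  -- If α is not in (0, 1 - n/p], it cannot equal min(σ, 1 - n/p) for any σ > 0, so arbitrary
  -- constants do.
  · refine ⟨1, 1, one_pos, one_pos, fun N _ C _ R₀ _ => ⟨1, one_pos, ?_⟩⟩
    intro σ μ hσ _ hασ
    refine absurd ⟨?_, hασ ▸ min_le_right _ _⟩ hα
    rw [hασ]
    exact lt_min hσ (by rw [sub_pos, div_lt_one hp0]; exact hnp)
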